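/- Let $d\ge 1$, $\alpha\in(0,1)$, $\varepsilon>0$, and let $\Omega\subset\mathbb R^d$ be a bounded open set with Lipschitz boundary. For $s\ge 0$ let $H^s(\Omega)$ be the Sobolev(–Slobodeckij) space with norm $\|v\|_{H^s(\Omega)}^2=\sum_{|\beta|\le m}\|D^\beta v\|_{L^2(\Omega)}^2+\sum_{|\beta|=m}\iint_{\Omega\times\Omega}\frac{|D^\beta v(x)-D^\beta v(y)|^2}{|x-y|^{d+2\sigma}}\,dx\,dy$, where $s=m+\sigma$, $m=\lfloor s\rfloor$ (the last sum is omitted if $\sigma=0$), and let $\tilde H^s(\Omega)$ be the space of those $v\in H^s(\Omega)$ whose extension by zero belongs to $H^s(\mathbb R^d)$, normed by the $H^s(\mathbb R^d)$ norm of the extension. Put $$c_{d,\alpha}=\frac{2^\alpha\Gamma(\frac{\alpha+d}2)}{\pi^{d/2}|\Gamma(-\alpha/2)|},\qquad \rho_\Omega(x)=c_{d,\alpha}\int_{\mathbb R^d\setminus\Omega}\frac{dy}{|x-y|^{d+\alpha}},$$ $$a(u,v)=\frac{c_{d,\alpha}}2\iint_{\Omega\times\Omega}\frac{(u(x)-u(y))(v(x)-v(y))}{|x-y|^{d+\alpha}}\,dx\,dy+\int_\Omega\rho_\Omega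 uv\,dx .$$ For a bounded linear functional $f$ on $\tilde H^{\alpha/2}(\Omega)$, let $u\in\tilde H^{\alpha/2}(\Omega)$ be the variational solution of $(-\Delta)^{\alpha/2}u=f$ in $\Omega$, $u=0$ in $\mathbb R^d\setminus\Omega$, i.e. $a(u,v)=(f,v)$ for all $v\in\tilde H^{\alpha/2}(\Omega)$. Let $X\subset\Omega$ be a non-empty finite set of points with mesh norm $h=\sup_{x\in\Omega}\min_{x_j\in X}|x-x_j|$, let $\Phi(x)=(\varepsilon^2+|x|^2)^{(\alpha-d)/2}$ and $V_N=\operatorname{span}\{\Phi(\cdot-x_j):x_j\in X\}$, and let $u_N\in V_N$ be a solution of the Galerkin equations $a(u_N,v_N)=(f,v_N)$ for all $v_N\in V_N$. Let $\mathcal N_\Phi(\Omega)$ be the native space of $\Phi$ on $\Omega$, i.e. the reproducing kernel Hilbert space on $\Omega$ with kernel $\Phi(x-y)$. (1) There is a constant $K>0$ depending only on $d$, $\alpha$ and $\Omega$ such that, for all $\varepsilon, X, f, u, u_N$ as above, all $s\ge0$ with $u\in H^s(\Omega)$ and all $C\ge 0$: if the approximation property $$\inf_{v_N\in V_N}\|u-v_N\|_{H^{\alpha/2}(\Omega)}\le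 C\,h^{s-\alpha/2}\,\|u\|_{H^s(\Omega)}$$ holds, then $$\|u-u_N\|_{H^{\alpha/2}(\Omega)}\le K\,C\,h^{s-\alpha/2}\,\|u\|_{H^s(\Omega)} .$$ (2) There are constants $c>0$ and $h_0>0$ depending only on $d$, $\alpha$, $\varepsilon$ and $\Omega$ such that, for all $X$ with $h\le h_0$ and all $f,u$ as above with $u\in\mathcal N_\Phi(\Omega)$, $$\inf_{v_N\in V_N}\|u-v_N\|_{H^{\alpha/2}(\Omega)}\le e^{-c/h}\,\|u\|_{\mathcal N_\Phi(\Omega)} .$$ -/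

import Mathlib

open MeasureTheory Set
open scoped NNReal ENNReal ContDiff

noncomputable section

namespace FracRBF

/-- The Euclidean space `ℝ^d`. -/
abbrev Sp (d : ℕ) : Type := EuclideanSpace ℝ (Fin d)

variable {d : ℕ}

/-! ### Domains -/

/-- A bounded Lipschitz domain (not necessarily connected): a bounded open set which, near each of
its boundary points, is the part of a ball lying strictly above the graph of a Lipschitz function.
The graph is taken in the direction of a unit vector `n` over the hyperplane orthogonal to `n`. -/
structure IsLipschitzDomain (Ω : Set (Sp d)) : Prop where
  isOpen : IsOpen Ω
  isBounded : Bornology.IsBounded Ω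
  exists_graph : ∀ x ∈ frontier Ω, ∃ (n : Sp d) (φ : Sp d → ℝ) (L : ℝ≥0) (r : ℝ),
    ‖n‖ = 1 ∧ LipschitzWith L φ ∧ 0 < r ∧
      Ω ∩ Metric.ball x r =
        {y ∈ Metric.ball x r | φ (y - inner ℝ n y • n) < inner ℝ n y}

/-! ### Sobolev spaces -/

/-- The classical partial derivative `D^β φ` for a multi-index `β`. -/
def multiDeriv (β : Fin d → ℕ) (φ : Sp d → ℝ) : Sp d → ℝ :=
  (List.finRange d).foldr
    (fun i ψ => (fun (η : Sp d → ℝ) x => fderiv ℝ η x (EuclideanSpace.single i 1))^[β i] ψ) φ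

/-- `g` is the weak derivative `D^β v` in the open set `Ω`: integration by parts against all
test functions `φ ∈ C_c^∞(Ω)`. -/
def HasWeakDeriv (Ω : Set (Sp d)) (β : Fin d → ℕ) (v g : Sp d → ℝ) : Prop :=
  ∀ φ : Sp d → ℝ, ContDiff ℝ ∞ φ → HasCompactSupport φ → tsupport φ ⊆ Ω →
    ∫ x in Ω, v x * multiDeriv β φ x = (-1) ^ (∑ i, β i) * ∫ x in Ω, g x * φ x

/-- The square of the Gagliardo seminorm `|v|_{H^σ(Ω)}`, `0 < σ < 1`. -/
def gagliardoSq (Ω : Set (Sp d)) (σ : ℝ) (v : Sp d → ℝ) : ℝ≥0∞ :=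
  ∫⁻ x in Ω, ∫⁻ y in Ω, ENNReal.ofReal ((v x - v y) ^ 2 / ‖x - y‖ ^ ((d : ℝ) + 2 * σ))

/-- The norm `‖v‖_{H^s(Ω)}` for real `s ≥ 0`. With `s = m + σ`, `m = ⌊s⌋`, `0 ≤ σ < 1`, its square
is `∑_{|β| ≤ m} ‖D^β v‖²_{L²(Ω)} + ∑_{|β| = m} |D^β v|²_{H^σ(Ω)}`, the last sum being
absent when `σ = 0`. The infimum is over the families of weak derivatives of `v` up to order `m`
in `L²(Ω)`; such a family is unique up to null sets, and the norm is `⊤` when there is none. -/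
def sobolevNorm (Ω : Set (Sp d)) (s : ℝ) (v : Sp d → ℝ) : ℝ≥0∞ :=
  ⨅ (g : (Fin d → ℕ) → Sp d → ℝ)
    (_ : MemLp v 2 (volume.restrict Ω) ∧
      ∀ β, ∑ i, β i ≤ ⌊s⌋₊ → MemLp (g β) 2 (volume.restrict Ω) ∧ HasWeakDeriv Ω β v (g β)),
    ((∑ k ∈ Finset.range (⌊s⌋₊ + 1), ∑ β ∈ Finset.piAntidiag Finset.univ k,
          eLpNorm (g β) 2 (volume.restrict Ω) ^ 2) +
        (if Int.fract s = 0 then 0 else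
          ∑ β ∈ Finset.piAntidiag Finset.univ ⌊s⌋₊, gagliardoSq Ω (Int.fract s) (g β))) ^
      (1 / 2 : ℝ)

/-- `v ∈ H^s(Ω)`. -/
def MemSobolev (Ω : Set (Sp d)) (s : ℝ) (v : Sp d → ℝ) : Prop :=
  sobolevNorm Ω s v < ⊤

/-- `v ∈ H̃^s(Ω)`: `v ∈ H^s(Ω)` and its extension by zero belongs to `H^s(ℝ^d)`.
Values of `v` off `Ω` are irrelevant. -/
def MemTilde (Ω : Set (Sp d)) (s : ℝ) (v : Sp d → ℝ) : Prop :=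
  MemSobolev Ω s v ∧ MemSobolev univ s (Ω.indicator v)

/-- `‖v‖_{H̃^s(Ω)}`, the `H^s(ℝ^d)` norm of the extension by zero. -/
def tildeNorm (Ω : Set (Sp d)) (s : ℝ) (v : Sp d → ℝ) : ℝ≥0∞ :=
  sobolevNorm univ s (Ω.indicator v)

/-- `f` is a bounded linear functional on `H̃^s(Ω)`, with `f v` in the role of the duality
pairing `(f, v)`. Boundedness makes `f v` depend only on the class of `v` up to null sets of `Ω`. -/
structure IsDualElement (Ω : Set (Sp d)) (s : ℝ) (f : (Sp d → ℝ) → ℝ) : Prop where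
  map_add : ∀ v w, MemTilde Ω s v → MemTilde Ω s w → f (v + w) = f v + f w
  map_smul : ∀ (a : ℝ) v, MemTilde Ω s v → f (a • v) = a * f v
  bounded : ∃ M : ℝ, ∀ v, MemTilde Ω s v → |f v| ≤ M * (tildeNorm Ω s v).toReal

/-! ### The fractional Poisson problem -/

/-- The constant `c_{d,α}` of the integral fractional Laplacian `(-Δ)^{α/2}`. -/
def fracConst (d : ℕ) (α : ℝ) : ℝ :=
  2 ^ α * Real.Gamma ((α + d) / 2) / (Real.pi ^ ((d : ℝ) / 2) * |Real.Gamma (-α / 2)|)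

/-- `ρ_Ω(x) = c_{d,α} ∫_{Ω^c} |x - y|^{-d-α} dy`. -/
def rho (Ω : Set (Sp d)) (α : ℝ) (x : Sp d) : ℝ :=
  fracConst d α * ∫ y in Ωᶜ, 1 / ‖x - y‖ ^ ((d : ℝ) + α)

/-- The bilinear form `a(u,v) = ((-Δ)_Ω^{α/2} u, v) + (ρ_Ω u, v)` (the case `ν = 0`), where the
pairing of the regional fractional Laplacian is the symmetric double integral
`(c_{d,α}/2) ∬_{Ω×Ω} (u(x)-u(y)) (v(x)-v(y)) |x-y|^{-d-α}`. -/
def bilin (Ω : Set (Sp d)) (α : ℝ) (u v : Sp d → ℝ) : ℝ :=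
  fracConst d α / 2 *
      (∫ p : Sp d × Sp d, (u p.1 - u p.2) * (v p.1 - v p.2) / ‖p.1 - p.2‖ ^ ((d : ℝ) + α)
        ∂((volume.restrict Ω).prod (volume.restrict Ω))) +
    ∫ x in Ω, rho Ω α x * u x * v x

/-- `u ∈ H̃^{α/2}(Ω)` is the (variational) solution of `(-Δ)^{α/2} u = f` in `Ω`, `u = 0` in
`Ω^c`. -/
structure IsWeakSolution (Ω : Set (Sp d)) (α : ℝ) (f : (Sp d → ℝ) → ℝ) (u : Sp d → ℝ) : Prop where
  mem : MemTilde Ω (α / 2) u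
  eq : ∀ v, MemTilde Ω (α / 2) v → bilin Ω α u v = f v

/-! ### The RBF Galerkin scheme -/

/-- The generalized multiquadric `Φ(x) = (ε² + |x|²)^{(α-d)/2}`. -/
def gmq (ε α : ℝ) (x : Sp d) : ℝ :=
  (ε ^ 2 + ‖x‖ ^ 2) ^ ((α - d) / 2)

/-- The trial space `V_N = span {Φ(· - x_j) : x_j ∈ X}`. -/
def trialSpace (ε α : ℝ) (X : Finset (Sp d)) : Submodule ℝ (Sp d → ℝ) :=
  Submodule.span ℝ ((fun z x => gmq ε α (x - z)) '' (X : Set (Sp d)))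

/-- The mesh norm `h = sup_{x ∈ Ω} min_{x_j ∈ X} |x - x_j|`. -/
def fillDistance (Ω : Set (Sp d)) (X : Finset (Sp d)) : ℝ :=
  sSup ((fun x => Metric.infDist x (X : Set (Sp d))) '' Ω)

/-- `u_N ∈ V_N` solves the Galerkin equations `a(u_N, v_N) = (f, v_N)` for all `v_N ∈ V_N`. -/
structure IsGalerkinSolution (Ω : Set (Sp d)) (ε α : ℝ) (X : Finset (Sp d))
    (f : (Sp d → ℝ) → ℝ) (uN : Sp d → ℝ) : Prop where
  mem : uN ∈ trialSpace ε α X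
  eq : ∀ v ∈ trialSpace ε α X, bilin Ω α uN v = f v

/-- The best approximation error `inf_{v_N ∈ V_N} ‖u - v_N‖_{H^{α/2}(Ω)}`. -/
def bestApprox (Ω : Set (Sp d)) (ε α : ℝ) (X : Finset (Sp d)) (u : Sp d → ℝ) : ℝ≥0∞ :=
  ⨅ v ∈ trialSpace ε α X, sobolevNorm Ω (α / 2) (u - v)

/-! ### The native space -/

/-- The kernel `(x, y) ↦ Φ(x - y)` on `Ω`, as a matrix of (scalar) operators on `ℝ`. -/
def gmqKernel (Ω : Set (Sp d)) (ε α : ℝ) : Matrix Ω Ω (ℝ →L[ℝ] ℝ) :=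
  Matrix.of fun x y => gmq ε α ((x : Sp d) - (y : Sp d)) • ContinuousLinearMap.id ℝ ℝ

/-- The Gaussian kernel is positive semidefinite. -/
theorem gaussian_sum_nonneg {ι : Type*} (s : Finset ι) (w : ι → ℝ) (x : ι → Sp d) {t : ℝ}
    (ht : 0 ≤ t) :
    0 ≤ ∑ i ∈ s, ∑ j ∈ s, w i * w j * Real.exp (-t * ‖x i - x j‖ ^ 2) := by
  set μ := ProbabilityTheory.stdGaussian (Sp d)
  have key : ∀ a : Sp d, Real.exp (-‖a‖ ^ 2 / 2) = ∫ z, Real.cos (inner ℝ z a) ∂μ := by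
    intro a
    have h := congrArg Complex.re (ProbabilityTheory.charFun_stdGaussian (E := Sp d) a)
    rw [charFun_apply] at h
    have h1 : Complex.re (Complex.exp (-‖a‖ ^ 2 / 2)) = Real.exp (-‖a‖ ^ 2 / 2) := by
      rw [← Complex.exp_ofReal_re]; push_cast; rfl
    have hint : Integrable (fun z => Complex.exp ((inner ℝ z a : ℝ) * Complex.I)) μ := by
      refine Integrable.of_bound (C := 1) (by fun_prop) (ae_of_all _ fun z => ?_)
      rw [Complex.norm_exp_ofReal_mul_I]
    have h2 := integral_re hint
    simp only [RCLike.re_eq_complex_re, Complex.exp_ofReal_mul_I_re] at h2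
    rw [← h1, ← h, h2]
  have hexp : ∀ i j, Real.exp (-t * ‖x i - x j‖ ^ 2) =
      ∫ z, Real.cos (inner ℝ z (Real.sqrt (2 * t) • (x i - x j))) ∂μ := by
    intro i j
    rw [← key, norm_smul, mul_pow, Real.norm_eq_abs, sq_abs, Real.sq_sqrt (by positivity)]
    congr 1; ring
  have hI : ∀ i j, Integrable
      (fun z => w i * w j * Real.cos (inner ℝ z (Real.sqrt (2 * t) • (x i - x j)))) μ := by
    intro i j
    refine Integrable.const_mul ?_ _
    refine Integrable.of_bound (C := 1) (by fun_prop) (ae_of_all _ fun z => ?_)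
    exact Real.abs_cos_le_one _
  have hsum : ∑ i ∈ s, ∑ j ∈ s, w i * w j * Real.exp (-t * ‖x i - x j‖ ^ 2) =
      ∫ z, ∑ i ∈ s, ∑ j ∈ s,
        w i * w j * Real.cos (inner ℝ z (Real.sqrt (2 * t) • (x i - x j))) ∂μ := by
    rw [integral_finsetSum _ fun i _ => integrable_finsetSum _ fun j _ => hI i j]
    refine Finset.sum_congr rfl fun i _ => ?_
    rw [integral_finsetSum _ fun j _ => hI i j]
    refine Finset.sum_congr rfl fun j _ => ?_
    rw [integral_const_mul, hexp]
  rw [hsum]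
  refine integral_nonneg fun z => ?_
  set θ : ι → ℝ := fun i => inner ℝ z (Real.sqrt (2 * t) • x i) with hθ
  have hsq : ∑ i ∈ s, ∑ j ∈ s,
        w i * w j * Real.cos (inner ℝ z (Real.sqrt (2 * t) • (x i - x j))) =
      (∑ i ∈ s, w i * Real.cos (θ i)) ^ 2 + (∑ i ∈ s, w i * Real.sin (θ i)) ^ 2 := by
    rw [sq, sq, Finset.sum_mul_sum, Finset.sum_mul_sum, ← Finset.sum_add_distrib]
    refine Finset.sum_congr rfl fun i _ => ?_
    rw [← Finset.sum_add_distrib]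
    refine Finset.sum_congr rfl fun j _ => ?_
    rw [smul_sub, inner_sub_right, Real.cos_sub]
    simp only [hθ]
    ring
  show 0 ≤ ∑ i ∈ s, ∑ j ∈ s,
        w i * w j * Real.cos (inner ℝ z (Real.sqrt (2 * t) • (x i - x j)))
  rw [hsq]
  positivity

/-- The generalized multiquadric is positive semidefinite when its exponent is negative. -/
theorem gmq_sum_nonneg {ι : Type*} (s : Finset ι) (w : ι → ℝ) (x : ι → Sp d) {ε α : ℝ}
    (hε : 0 < ε) (hα : α < d) :
    0 ≤ ∑ i ∈ s, ∑ j ∈ s, w i * w j * gmq ε α (x i - x j) := by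
  set p : ℝ := (d - α) / 2 with hp
  have hp0 : 0 < p := by rw [hp]; linarith
  have key : ∀ a : ℝ, 0 < a →
      a ^ ((α - d) / 2) = (Real.Gamma p)⁻¹ * ∫ t in Ioi (0 : ℝ), t ^ (p - 1) * Real.exp (-(a * t)) := by
    intro a ha
    rw [Real.integral_rpow_mul_exp_neg_mul_Ioi hp0 ha]
    have : (α - d) / 2 = -p := by rw [hp]; ring
    have hΓ := (Real.Gamma_pos_of_pos hp0).ne'
    rw [this, Real.rpow_neg ha.le, Real.div_rpow zero_le_one ha.le, Real.one_rpow]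
    field_simp
  have ha : ∀ i j, 0 < ε ^ 2 + ‖x i - x j‖ ^ 2 := fun i j => by positivity
  have hI : ∀ i j, IntegrableOn
      (fun t : ℝ => t ^ (p - 1) * Real.exp (-((ε ^ 2 + ‖x i - x j‖ ^ 2) * t))) (Ioi 0) := by
    intro i j
    refine .of_integral_ne_zero ?_
    rw [Real.integral_rpow_mul_exp_neg_mul_Ioi hp0 (ha i j)]
    have hΓ := Real.Gamma_pos_of_pos hp0
    have := ha i j
    positivity
  have hsum : ∑ i ∈ s, ∑ j ∈ s, w i * w j * gmq ε α (x i - x j) =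
      (Real.Gamma p)⁻¹ * ∫ t in Ioi (0 : ℝ), ∑ i ∈ s, ∑ j ∈ s,
        w i * w j * (t ^ (p - 1) * Real.exp (-((ε ^ 2 + ‖x i - x j‖ ^ 2) * t))) := by
    rw [integral_finsetSum _ fun i _ => integrable_finsetSum _ fun j _ => (hI i j).const_mul _,
      Finset.mul_sum]
    refine Finset.sum_congr rfl fun i _ => ?_
    rw [integral_finsetSum _ fun j _ => (hI i j).const_mul _, Finset.mul_sum]
    refine Finset.sum_congr rfl fun j _ => ?_
    rw [integral_const_mul, gmq, key _ (ha i j)]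
    ring
  rw [hsum]
  refine mul_nonneg (inv_nonneg.mpr (Real.Gamma_pos_of_pos hp0).le) ?_
  refine setIntegral_nonneg measurableSet_Ioi fun t ht => ?_
  have ht' : (0 : ℝ) < t := ht
  have hfac : ∑ i ∈ s, ∑ j ∈ s,
        w i * w j * (t ^ (p - 1) * Real.exp (-((ε ^ 2 + ‖x i - x j‖ ^ 2) * t))) =
      t ^ (p - 1) * Real.exp (-(ε ^ 2 * t)) *
        ∑ i ∈ s, ∑ j ∈ s, w i * w j * Real.exp (-t * ‖x i - x j‖ ^ 2) := by
    simp only [Finset.mul_sum]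
    refine Finset.sum_congr rfl fun i _ => Finset.sum_congr rfl fun j _ => ?_
    have : -((ε ^ 2 + ‖x i - x j‖ ^ 2) * t) = -(ε ^ 2 * t) + -t * ‖x i - x j‖ ^ 2 := by ring
    rw [this, Real.exp_add]
    ring
  rw [hfac]
  exact mul_nonneg (by positivity) (gaussian_sum_nonneg s w x ht'.le)

theorem lt_dim {α : ℝ} (hd : 0 < d) (hα : α < 1) : α < d :=
  hα.trans_le (Nat.one_le_cast.mpr hd)

theorem gmqKernel_posSemidef (Ω : Set (Sp d)) {ε α : ℝ} (hε : 0 < ε) (hα : α < d) :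
    (gmqKernel Ω ε α).PosSemidef := by
  have hH : (gmqKernel Ω ε α).IsHermitian := by
    ext x y
    have h1 : star (ContinuousLinearMap.id ℝ ℝ) = ContinuousLinearMap.id ℝ ℝ :=
      star_one (ℝ →L[ℝ] ℝ)
    simp [gmqKernel, gmq, norm_sub_rev, h1]
  have tfae := (RKHS.posSemidef_tfae (K := gmqKernel Ω ε α)).out 0 2
  rw [tfae]
  refine ⟨hH, fun vv => ?_⟩
  have := gmq_sum_nonneg vv.support vv (fun i => (i : Sp d)) hε hα
  refine this.trans_eq ?_
  simp only [Finsupp.sum, gmqKernel, RCLike.re_to_real]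
  refine Finset.sum_congr rfl fun i _ => Finset.sum_congr rfl fun j _ => ?_
  simp [gmq, norm_sub_rev (i : Sp d) (j : Sp d)]
  ring

/-- The native space `N_Φ(Ω)`: the Hilbert space completion of the span of the functions
`Φ(· - y)`, `y ∈ Ω`, with `(Φ(· - x), Φ(· - y))_Φ = Φ(x - y)`, realized as a space of functions on
`Ω`, that is, the reproducing kernel Hilbert space on `Ω` with kernel `Φ(x - y)`. -/
abbrev NativeSpace (Ω : Set (Sp d)) {ε α : ℝ} (hε : 0 < ε) (hα : α < d) : Type :=
  haveI : Fact (gmqKernel Ω ε α).PosSemidef := ⟨gmqKernel_posSemidef Ω hε hα⟩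
  RKHS.OfKernel (gmqKernel Ω ε α)

end FracRBF

end

open FracRBF

/-!
The two assertions are Céa's lemma for the form `a` and the spectral convergence of kernel
interpolation.

*Quasi-optimality.* For an order `α / 2 < 1 / 2` the `H^{α/2}(Ω)` norm of an `L²` function is the
square root of `energySq`. Galerkin orthogonality gives `a(e, e) ≤ a(u - v, u - v)` for the error
`e = u - u_N` and every trial function `v`, so it is enough that `a` is bounded and coercive on
`H^{α/2}(Ω)`. Coercivity holds because `ρ_Ω` is bounded below on a bounded set
(`exists_le_extPotential`). Boundedness is the fractional Hardy inequality
`∫_Ω w² dist(·, Ωᶜ)^{-α} ≤ C ‖w‖²_{H^{α/2}(Ω)}` (`BoundaryCharts.exists_hardy`), which needs no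
boundary values since `α < 1`: the mass of `w²` in a boundary layer of height `t` is compared with
its mass in `N` disjoint inward translates of the layer, and so is a fraction of order `1 / N` of the
mass in a layer about `N` times thicker, up to differences of `w` at distance of order `N t`. Summed
over dyadic `t` with weights `t^{-α}`, the first part loses a factor `N^α` and can be absorbed, and
the second part is the Gagliardo seminorm. The same inequality shows that extension by zero maps
`H^{α/2}(Ω)` to `H^{α/2}(ℝ^d)` (`BoundaryCharts.memTilde`), so that trial functions are admissible
in the weak formulation.

*Exponential convergence.* Let `w` be `g` minus its interpolant, which is the residual of an
orthogonal projection in the native space. Every point `x` of `Ω` is within distance `L r`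
of the centre of a ball of a fixed small radius `r` inside `Ω`. Polynomials of degree `m` of order
`r / h` are controlled at `x` by their values at the points of `X` in this ball with a constant exponential in
`m` (`abs_le_of_mem_linePoly`); this is proved on a cube, from Bernstein's inequality applied to the
polynomial times the weight `∏ (1 - z_i²)^m`. By duality the evaluation at `x` equals, on such
polynomials, a combination of evaluations on `X` (`exists_coeff_of_abs_le`). Since `Φ` is
approximated by polynomials at a rate `(B r)^{m/2}` with `B` independent of `r`
(`exists_linePoly_approx_gmq`), the rate beats the exponential constant when `r` is small, and
`|w| ≤ C e^{-c/h} ‖g‖` follows (`exists_abs_apply_le_exp`). Elements of the native space are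
Lipschitz, and the kernel `|x - y|^{1-d-α}` is integrable, so the square of the Gagliardo seminorm
of `w` is bounded by a multiple of the product of its sup norm and its Lipschitz constant (`exists_gagliardoSq_le`).
-/

open FracRBF

namespace FracRBF

/-! ### Polynomial inequalities on an interval -/

open Polynomial in
/-- The growth estimate inside the unit disc, by the maximum principle for the polynomial
`w ^ n * Q ((w + w⁻¹) / 2)`: on the unit circle `(w + w⁻¹) / 2` is the real part of `w`. -/
theorem norm_eval_joukowski_le_of_norm_le_one {Q : ℝ[X]} {n : ℕ} (hQ : Q.natDegree ≤ n) {M : ℝ}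
    (hM : ∀ x ∈ Icc (-1 : ℝ) 1, |Q.eval x| ≤ M) {w : ℂ} (hw : w ≠ 0) (hw1 : ‖w‖ ≤ 1) :
    ‖aeval ((w + w⁻¹) / 2) Q‖ ≤ M * (‖w‖⁻¹) ^ n := by
  set R : ℂ → ℂ := fun z => ∑ k ∈ Finset.range (n + 1),
    (Q.coeff k : ℂ) * (((z ^ 2 + 1) / 2) ^ k * z ^ (n - k)) with hR
  have hRz : ∀ z : ℂ, z ≠ 0 → R z = z ^ n * aeval ((z + z⁻¹) / 2) Q := by
    intro z hz
    rw [aeval_eq_sum_range' (Nat.lt_succ_of_le hQ), Finset.mul_sum]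
    refine Finset.sum_congr rfl fun k hk => ?_
    have hk' : k ≤ n := Nat.lt_succ_iff.mp (Finset.mem_range.mp hk)
    have : (z + z⁻¹) / 2 = ((z ^ 2 + 1) / 2) / z := by field_simp
    have h2 : z ^ n = z ^ (n - k) * z ^ k := by rw [← pow_add]; congr 1; omega
    rw [this, Complex.real_smul, h2]
    generalize (z ^ 2 + 1) / 2 = A
    rw [div_pow]
    field_simp
  have hdiff : Differentiable ℂ R := by
    rw [hR]; fun_prop
  have hcirc : ∀ z ∈ frontier (Metric.ball (0 : ℂ) 1), ‖R z‖ ≤ M := by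
    intro z hz
    rw [frontier_ball _ one_ne_zero, mem_sphere_zero_iff_norm] at hz
    have hz0 : z ≠ 0 := by
      rintro rfl; simp at hz
    have hre : (z + z⁻¹) / 2 = (z.re : ℂ) := by
      rw [Complex.inv_def, Complex.normSq_eq_norm_sq, hz]
      simp [Complex.add_conj]
    rw [hRz z hz0, norm_mul, norm_pow, hz, one_pow, one_mul, hre]
    have : aeval (z.re : ℂ) Q = ((Q.eval z.re : ℝ) : ℂ) := by
      have := aeval_algebraMap_apply ℂ z.re Q
      simpa using this
    rw [this, Complex.norm_real, Real.norm_eq_abs]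
    have h1 := Complex.abs_re_le_norm z
    rw [hz] at h1
    exact hM _ (abs_le.mp h1)
  have hb := Complex.norm_le_of_forall_mem_frontier_norm_le Metric.isBounded_ball
    hdiff.diffContOnCl hcirc (z := w) (by
      rw [closure_ball _ one_ne_zero, mem_closedBall_zero_iff]; exact hw1)
  rw [hRz w hw, norm_mul, norm_pow] at hb
  have hpos : 0 < ‖w‖ ^ n := by positivity
  rw [inv_pow, ← div_eq_mul_inv, le_div_iff₀ hpos]
  linarith

open Polynomial in
/-- The **Bernstein–Walsh inequality**: the growth of a polynomial off the interval `[-1, 1]`,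
written in the Joukowski coordinate `w`. -/
theorem norm_eval_joukowski_le {Q : ℝ[X]} {n : ℕ} (hQ : Q.natDegree ≤ n) {M : ℝ}
    (hM : ∀ x ∈ Icc (-1 : ℝ) 1, |Q.eval x| ≤ M) {w : ℂ} (hw : w ≠ 0) :
    ‖aeval ((w + w⁻¹) / 2) Q‖ ≤ M * (max ‖w‖ ‖w‖⁻¹) ^ n := by
  have hM0 : 0 ≤ M := (abs_nonneg _).trans (hM 0 (by simp))
  rcases le_total ‖w‖ 1 with h | h
  · refine (norm_eval_joukowski_le_of_norm_le_one hQ hM hw h).trans ?_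
    gcongr
    exact le_max_right _ _
  · have h1 : ‖w⁻¹‖ ≤ 1 := by rw [norm_inv]; exact inv_le_one_of_one_le₀ h
    have := norm_eval_joukowski_le_of_norm_le_one hQ hM (inv_ne_zero hw) h1
    rw [inv_inv, add_comm, norm_inv, inv_inv] at this
    refine this.trans ?_
    gcongr
    exact le_max_left _ _

open Polynomial in
/-- Growth of a polynomial on the real line outside `[-1, 1]`. -/
theorem abs_eval_le_mul_two_mul_pow {Q : ℝ[X]} {n : ℕ} (hQ : Q.natDegree ≤ n) {M : ℝ}
    (hM : ∀ x ∈ Icc (-1 : ℝ) 1, |Q.eval x| ≤ M) {y : ℝ} (hy : 1 ≤ |y|) :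
    |Q.eval y| ≤ M * (2 * |y|) ^ n := by
  have hM0 : 0 ≤ M := (abs_nonneg _).trans (hM 0 (by simp))
  have key : ∀ (P : ℝ[X]), P.natDegree ≤ n → (∀ x ∈ Icc (-1 : ℝ) 1, |P.eval x| ≤ M) →
      ∀ t : ℝ, 1 ≤ t → |P.eval t| ≤ M * (2 * t) ^ n := by
    intro P hP hPM t ht
    set s := Real.sqrt (t ^ 2 - 1) with hs
    have hs2 : s ^ 2 = t ^ 2 - 1 := Real.sq_sqrt (by nlinarith)
    have hs0 : 0 ≤ s := Real.sqrt_nonneg _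
    have hst : s ≤ t := by nlinarith
    have hpos : 0 < t + s := by linarith
    have hinv : (t + s)⁻¹ = t - s := by
      rw [inv_eq_iff_eq_inv, eq_comm]
      refine inv_eq_of_mul_eq_one_left ?_
      nlinarith
    have h := norm_eval_joukowski_le hP hPM (w := ((t + s : ℝ) : ℂ))
      (by exact_mod_cast hpos.ne')
    rw [← Complex.ofReal_inv, hinv, ← Complex.ofReal_add,
      show t + s + (t - s) = 2 * t by ring] at h
    have h2 : (((2 * t : ℝ) : ℂ) / 2) = (t : ℂ) := by push_cast; ring
    have h3 : aeval (t : ℂ) P = ((P.eval t : ℝ) : ℂ) := by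
      simpa using aeval_algebraMap_apply ℂ t P
    rw [h2, h3, Complex.norm_real, Complex.norm_real, Real.norm_eq_abs, Real.norm_eq_abs,
      abs_of_pos hpos, hinv] at h
    refine h.trans ?_
    gcongr
    exact max_le (by linarith) (by linarith)
  rcases le_total 0 y with h0 | h0
  · rw [abs_of_nonneg h0] at hy ⊢
    exact key Q hQ hM y hy
  · rw [abs_of_nonpos h0] at hy ⊢
    have := key (Q.comp (-X)) (by rw [natDegree_comp]; simpa using hQ)
      (fun x hx => by simpa using hM (-x) ⟨by linarith [hx.2], by linarith [hx.1]⟩) (-y) hy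
    simpa using this

open Polynomial in
/-- **Bernstein's inequality** for the derivative of a polynomial inside `[-1, 1]`, up to a
constant. -/
theorem abs_derivative_mul_sqrt_le {Q : ℝ[X]} {n : ℕ} (hQ : Q.natDegree ≤ n) {M : ℝ}
    (hM : ∀ x ∈ Icc (-1 : ℝ) 1, |Q.eval x| ≤ M) {y : ℝ} (hy : y ∈ Icc (-1 : ℝ) 1) :
    |Q.derivative.eval y| * Real.sqrt (1 - y ^ 2) ≤ 4 * n * M := by
  have hM0 : 0 ≤ M := (abs_nonneg _).trans (hM 0 (by simp))
  rcases Nat.eq_zero_or_pos n with rfl | hn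
  · have : Q.derivative = 0 := by
      rw [eq_C_of_natDegree_le_zero hQ, derivative_C]
    simp [this]
  set s := Real.sqrt (1 - y ^ 2) with hs
  have hs2 : s ^ 2 = 1 - y ^ 2 := Real.sq_sqrt (by nlinarith [hy.1, hy.2])
  -- `w₀` is the Joukowski preimage of `y` on the unit circle; in the disc of radius `1 / (2 n)`
  -- around it the growth factor `max |w| |w|⁻¹ ^ n` is at most `2`
  set w₀ : ℂ := ⟨y, s⟩ with hw₀
  have hnorm : ‖w₀‖ = 1 := by
    have : ‖w₀‖ ^ 2 = 1 := by
      rw [← Complex.normSq_eq_norm_sq, Complex.normSq_apply]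
      simp only [hw₀]; nlinarith
    nlinarith [norm_nonneg w₀]
  have hw0 : w₀ ≠ 0 := by rintro h; rw [h] at hnorm; simp at hnorm
  have hinv : w₀⁻¹ = ⟨y, -s⟩ := by
    rw [Complex.inv_def, Complex.normSq_eq_norm_sq, hnorm]
    apply Complex.ext <;> simp [hw₀]
  set r : ℝ := 1 / (2 * n) with hr
  have hn' : (1 : ℝ) ≤ n := by exact_mod_cast hn
  have hr0 : 0 < r := by positivity
  have hr1 : r ≤ 1 / 2 := by
    rw [hr, div_le_div_iff₀ (by positivity) (by norm_num)]; linarith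
  have hrn : (n : ℝ) * r = 1 / 2 := by rw [hr]; field_simp
  set G : ℂ → ℂ := fun w => aeval ((w + w⁻¹) / 2) Q with hG
  have hnz : ∀ w ∈ Metric.closedBall w₀ r, 1 - r ≤ ‖w‖ ∧ ‖w‖ ≤ 1 + r := by
    intro w hw
    rw [Metric.mem_closedBall, dist_eq_norm] at hw
    have h1 := norm_sub_norm_le w₀ w
    have h2 := norm_sub_norm_le w w₀
    rw [norm_sub_rev] at h1
    rw [hnorm] at h1 h2
    constructor <;> linarith
  have hnz' : ∀ w ∈ Metric.closedBall w₀ r, w ≠ 0 := by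
    rintro w hw rfl
    have := (hnz 0 hw).1
    simp at this; linarith
  have hderiv : ∀ w : ℂ, w ≠ 0 → HasDerivAt G
      (aeval ((w + w⁻¹) / 2) Q.derivative * ((1 - (w ^ 2)⁻¹) / 2)) w := by
    intro w hw
    have h1 : HasDerivAt (fun w : ℂ => (w + w⁻¹) / 2) ((1 - (w ^ 2)⁻¹) / 2) w := by
      have := ((hasDerivAt_id w).add (hasDerivAt_inv hw)).div_const 2
      simpa [sub_eq_add_neg] using this
    exact (Polynomial.hasDerivAt_aeval Q ((w + w⁻¹) / 2)).comp w h1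
  have hdc : DiffContOnCl ℂ G (Metric.ball w₀ r) := by
    refine DifferentiableOn.diffContOnCl ?_
    rw [closure_ball _ hr0.ne']
    exact fun w hw => (hderiv w (hnz' w hw)).differentiableAt.differentiableWithinAt
  have hbound : ∀ z ∈ Metric.sphere w₀ r, ‖G z‖ ≤ 2 * M := by
    intro z hz
    have hz' := Metric.sphere_subset_closedBall hz
    obtain ⟨h1, h2⟩ := hnz z hz'
    refine (norm_eval_joukowski_le hQ hM (hnz' z hz')).trans ?_
    have hpos : 0 < 1 - r := by linarith
    have hmax : max ‖z‖ ‖z‖⁻¹ ≤ (1 - r)⁻¹ := by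
      refine max_le (h2.trans ?_) (by gcongr)
      rw [le_inv_comm₀ (by linarith) hpos, ← one_div, le_div_iff₀ (by linarith)]
      nlinarith
    have hpow : ((1 - r)⁻¹) ^ n ≤ 2 := by
      rw [inv_pow]
      have hb := one_add_mul_le_pow (a := -r) (by linarith) n
      have : (1 : ℝ) / 2 ≤ (1 - r) ^ n := by
        rw [show 1 - r = 1 + -r by ring]; linarith
      calc ((1 - r) ^ n)⁻¹ ≤ (1 / 2)⁻¹ := by gcongr
        _ = 2 := by norm_num
    calc M * (max ‖z‖ ‖z‖⁻¹) ^ n ≤ M * ((1 - r)⁻¹) ^ n := by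
          gcongr
      _ ≤ M * 2 := by gcongr
      _ = 2 * M := by ring
  have hC := Complex.norm_deriv_le_of_forall_mem_sphere_norm_le hr0 hdc hbound
  rw [(hderiv w₀ hw0).deriv, norm_mul] at hC
  have hy' : (w₀ + w₀⁻¹) / 2 = (y : ℂ) := by
    rw [hinv]; apply Complex.ext <;> simp [hw₀]
  have hq : aeval (y : ℂ) Q.derivative = ((Q.derivative.eval y : ℝ) : ℂ) := by
    simpa using aeval_algebraMap_apply ℂ y Q.derivative
  have hfac : (1 - (w₀ ^ 2)⁻¹) / 2 = w₀⁻¹ * (s * Complex.I) := by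
    have : w₀ - w₀⁻¹ = 2 * (s * Complex.I) := by
      rw [hinv]; apply Complex.ext <;> simp [hw₀]; ring
    have h2 : (s : ℂ) * Complex.I = (w₀ - w₀⁻¹) / 2 := by rw [this]; ring
    rw [h2]; field_simp
  rw [hy', hq, hfac, norm_mul, norm_inv, hnorm, norm_mul, Complex.norm_I, Complex.norm_real,
    Complex.norm_real, Real.norm_eq_abs, Real.norm_eq_abs, abs_of_nonneg (Real.sqrt_nonneg _)] at hC
  have : 2 * M / r = 4 * n * M := by rw [hr]; field_simp; ring
  rw [this] at hC
  simpa using hC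

/-! ### A norming set for polynomials on a cube -/

open Polynomial in
/-- A bound at scattered points for a function which is a polynomial of degree at most `m` in each
variable, tested against the weight `∏ i, (1 - z i ^ 2) ^ m`. The weight keeps the maximum away
from the faces of the cube, where Bernstein's inequality degenerates; this is why a density of
order `1 / m`, instead of `1 / m ^ 2`, suffices. -/
theorem abs_mul_prod_one_sub_sq_pow_le {d m : ℕ} (hm : 1 ≤ m) {F : (Fin d → ℝ) → ℝ}
    (hF : Continuous F)
    (hP : ∀ z i, ∃ P : ℝ[X], P.natDegree ≤ m ∧ ∀ t, F (Function.update z i t) = P.eval t)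
    {η S : ℝ} (hη0 : 0 ≤ η) (hη : 72 * d * m * η ≤ 1)
    (hS : ∀ y : Fin d → ℝ, (∀ i, y i ^ 2 ≤ 13 / 16) → ∃ x, (∀ i, |x i - y i| ≤ η) ∧ |F x| ≤ S)
    {z : Fin d → ℝ} (hz : ∀ i, |z i| ≤ 1) :
    |F z| * ∏ i, (1 - z i ^ 2) ^ m ≤ 2 * S := by
  set q : (Fin d → ℝ) → ℝ := fun z => F z * ∏ i, (1 - z i ^ 2) ^ m with hq
  have hqc : Continuous q := by rw [hq]; fun_prop
  set K : Set (Fin d → ℝ) := Set.pi univ fun _ => Icc (-1 : ℝ) 1 with hK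
  have hKc : IsCompact K := isCompact_univ_pi fun _ => isCompact_Icc
  have hmemK : ∀ z : Fin d → ℝ, z ∈ K ↔ ∀ i, |z i| ≤ 1 := by
    intro z; simp only [hK, Set.mem_univ_pi, mem_Icc, abs_le]
  have hW1 : ∀ z ∈ K, ∀ i, 0 ≤ 1 - z i ^ 2 ∧ 1 - z i ^ 2 ≤ 1 := by
    intro z hz i
    have h1 := (sq_le_one_iff_abs_le_one _).mpr ((hmemK z).mp hz i)
    exact ⟨by linarith, by nlinarith [sq_nonneg (z i)]⟩
  have hW0 : ∀ z ∈ K, 0 ≤ ∏ i, (1 - z i ^ 2) ^ m :=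
    fun z hz => Finset.prod_nonneg fun i _ => pow_nonneg (hW1 z hz i).1 _
  have hqabs : ∀ z ∈ K, |q z| = |F z| * ∏ i, (1 - z i ^ 2) ^ m := by
    intro z hz
    rw [hq, abs_mul, abs_of_nonneg (hW0 z hz)]
  have hqF : ∀ z ∈ K, |q z| ≤ |F z| := by
    intro z hz
    rw [hqabs z hz]
    exact mul_le_of_le_one_right (abs_nonneg _)
      (Finset.prod_le_one (fun i _ => pow_nonneg (hW1 z hz i).1 _)
        fun i _ => pow_le_one₀ (hW1 z hz i).1 (hW1 z hz i).2)
  obtain ⟨y, hyK, hymax⟩ := hKc.exists_isMaxOn ⟨z, (hmemK z).mpr hz⟩ hqc.abs.continuousOn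
  set M := |q y| with hM
  have hMmax : ∀ z ∈ K, |q z| ≤ M := fun z hz => hymax hz
  have hzM := hMmax z ((hmemK z).mpr hz)
  rw [hqabs z ((hmemK z).mpr hz)] at hzM
  refine hzM.trans ?_
  have hm' : (1 : ℝ) ≤ m := by exact_mod_cast hm
  rcases (abs_nonneg (q y)).eq_or_lt with h0 | hMpos
  · obtain ⟨x, -, hx⟩ := hS 0 (by intro i; norm_num)
    have := (abs_nonneg _).trans hx
    rw [hM, ← h0]; linarith
  -- restriction of `q` to a line parallel to an axis
  have hline : ∀ v ∈ K, ∀ i, ∃ P : ℝ[X], P.natDegree ≤ m ∧ ∃ W : ℝ, 0 ≤ W ∧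
      (∀ t, q (Function.update v i t) = P.eval t * W * (1 - t ^ 2) ^ m) := by
    intro v hv i
    obtain ⟨P, hPd, hPe⟩ := hP v i
    refine ⟨P, hPd, ∏ j ∈ Finset.univ.erase i, (1 - v j ^ 2) ^ m,
      Finset.prod_nonneg fun j _ => pow_nonneg (hW1 v hv j).1 _, fun t => ?_⟩
    rw [hq]
    simp only
    rw [hPe, ← Finset.mul_prod_erase _ _ (Finset.mem_univ i), Function.update_self, mul_assoc,
      mul_comm ((1 - t ^ 2) ^ m)]
    congr 2
    refine Finset.prod_congr rfl fun j hj => ?_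
    rw [Function.update_of_ne (Finset.ne_of_mem_erase hj)]
  have hupd : ∀ v ∈ K, ∀ i, ∀ t, |t| ≤ 1 → Function.update v i t ∈ K := by
    intro v hv i t ht
    rw [hmemK] at hv ⊢
    intro j
    rcases eq_or_ne j i with rfl | hj
    · simpa using ht
    · simpa [hj] using hv j
  -- the maximum stays away from the faces of the cube
  have hyi : ∀ i, y i ^ 2 ≤ 13 / 16 := by
    intro i
    obtain ⟨P, hPd, W, hW, hPe⟩ := hline y hyK i
    have hy1 : |y i| ≤ 1 := (hmemK y).mp hyK i
    by_contra hcon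
    push Not at hcon
    -- `P` is at most `M (4 / 3) ^ m` on `[-1/2, 1/2]`, hence at most `M (16 / 3) ^ m` on `[-1, 1]`,
    -- which contradicts `|q y| = M` when `1 - y i ^ 2 < 3 / 16`
    set R : ℝ[X] := (P.comp (C (1 / 2) * X)) * C W with hR
    have hRd : R.natDegree ≤ m := by
      refine (natDegree_mul_C_le _ _).trans ?_
      rw [natDegree_comp]
      have : (C (1 / 2 : ℝ) * X).natDegree ≤ 1 := (natDegree_C_mul_le _ _).trans natDegree_X_le
      nlinarith
    have hRe : ∀ t, R.eval t = P.eval (1 / 2 * t) * W := by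
      intro t; simp [hR]
    have hRM : ∀ t ∈ Icc (-1 : ℝ) 1, |R.eval t| ≤ M * (4 / 3) ^ m := by
      intro t ht
      have ht1 : |1 / 2 * t| ≤ 1 / 2 := by
        rw [abs_mul, abs_of_pos (by norm_num : (0 : ℝ) < 1 / 2)]
        have := abs_le.mpr ht; linarith
      have h1 := hMmax _ (hupd y hyK i (1 / 2 * t) (by linarith))
      have h3 : (3 / 4 : ℝ) ≤ 1 - (1 / 2 * t) ^ 2 := by nlinarith [ht.1, ht.2]
      have h6 : 0 ≤ 1 - (1 / 2 * t) ^ 2 := by linarith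
      rw [hPe, ← hRe, abs_mul, abs_of_nonneg (pow_nonneg h6 m)] at h1
      have h4 : (3 / 4 : ℝ) ^ m ≤ (1 - (1 / 2 * t) ^ 2) ^ m := by gcongr
      have h5 : (3 / 4 : ℝ) ^ m * (4 / 3) ^ m = 1 := by rw [← mul_pow]; norm_num
      calc |R.eval t| = |R.eval t| * (3 / 4 : ℝ) ^ m * (4 / 3) ^ m := by rw [mul_assoc, h5, mul_one]
        _ ≤ M * (4 / 3) ^ m := by
          gcongr
          exact (mul_le_mul_of_nonneg_left h4 (abs_nonneg _)).trans h1
    have hy34 : 3 / 4 ≤ |y i| := by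
      rw [← sq_abs] at hcon
      nlinarith [abs_nonneg (y i)]
    have h2y : |2 * y i| = 2 * |y i| := by rw [abs_mul]; norm_num
    have hgrow := abs_eval_le_mul_two_mul_pow hRd hRM (y := 2 * y i) (by rw [h2y]; linarith)
    have hself : q y = R.eval (2 * y i) * (1 - y i ^ 2) ^ m := by
      have := hPe (y i)
      rw [Function.update_eq_self] at this
      rw [this, hRe]
      congr 4
      ring
    have h0 : 0 ≤ 1 - y i ^ 2 := (hW1 y hyK i).1
    have hle : M ≤ M * (16 / 3 * (1 - y i ^ 2)) ^ m := by
      calc M = |R.eval (2 * y i)| * (1 - y i ^ 2) ^ m := by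
            rw [hM, hself, abs_mul, abs_of_nonneg (pow_nonneg h0 _)]
        _ ≤ (M * (4 / 3) ^ m * (2 * |2 * y i|) ^ m) * (1 - y i ^ 2) ^ m := by gcongr
        _ ≤ (M * (4 / 3) ^ m * 4 ^ m) * (1 - y i ^ 2) ^ m := by
            have : 2 * |2 * y i| ≤ 4 := by rw [h2y]; linarith
            gcongr
        _ = M * (16 / 3 * (1 - y i ^ 2)) ^ m := by
            rw [mul_assoc M, ← mul_pow, mul_assoc M, ← mul_pow]; norm_num
    have hlt : (16 / 3 * (1 - y i ^ 2)) ^ m < 1 :=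
      pow_lt_one₀ (by positivity) (by linarith) (by omega)
    have hMpos' : 0 < M := hMpos
    nlinarith
  obtain ⟨x, hxy, hxS⟩ := hS y hyi
  have hηi : ∀ _ : Fin d, η ≤ 1 / 72 := by
    intro i
    have hd : (1 : ℝ) ≤ d := by
      have : 0 < d := i.pos
      exact_mod_cast this
    have h1 : (1 : ℝ) ≤ d * m := by nlinarith
    nlinarith
  have hy92 : ∀ i, |y i| ≤ 903 / 1000 := fun i =>
    abs_le_of_sq_le_sq (by linarith [hyi i]) (by norm_num)
  have hx92 : ∀ i, |x i| ≤ 92 / 100 := by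
    intro i
    have h1 := abs_sub_abs_le_abs_sub (x i) (y i)
    linarith [hxy i, hηi i, hy92 i]
  have hxK : x ∈ K := (hmemK x).mpr fun i => (hx92 i).trans (by norm_num)
  -- changing one coordinate: the restriction of `q` has degree at most `3 m` and is bounded by `M`,
  -- and `√(1 - t ^ 2) ≥ 1 / 3` on the segment in question
  have hstep : ∀ v ∈ K, ∀ i, v i = y i →
      |q (Function.update v i (x i)) - q v| ≤ 36 * m * M * η := by
    intro v hv i hvi
    obtain ⟨P, hPd, W, hW, hPe⟩ := hline v hv i
    set R : ℝ[X] := P * C W * (1 - X ^ 2) ^ m with hR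
    have hRe : ∀ t, R.eval t = q (Function.update v i t) := by
      intro t; rw [hPe]; simp [hR]
    have hRd : R.natDegree ≤ 3 * m := by
      have h1 : (1 - X ^ 2 : ℝ[X]).natDegree ≤ 2 := by
        refine (natDegree_sub_le _ _).trans ?_
        simp
      refine natDegree_mul_le.trans ?_
      have h2 := natDegree_mul_C_le P W
      have h3 : ((1 - X ^ 2 : ℝ[X]) ^ m).natDegree ≤ m * 2 :=
        natDegree_pow_le.trans (Nat.mul_le_mul_left _ h1)
      omega
    have hRM : ∀ t ∈ Icc (-1 : ℝ) 1, |R.eval t| ≤ M := by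
      intro t ht
      rw [hRe]
      exact hMmax _ (hupd v hv i t (abs_le.mpr ht))
    have hder : ∀ t ∈ Icc (-(92 / 100) : ℝ) (92 / 100), ‖R.derivative.eval t‖ ≤ 36 * m * M := by
      intro t ht
      have hb := abs_derivative_mul_sqrt_le hRd hRM (y := t)
        ⟨by linarith [ht.1], by linarith [ht.2]⟩
      have hs : (1 / 3 : ℝ) ≤ Real.sqrt (1 - t ^ 2) :=
        Real.le_sqrt_of_sq_le (by nlinarith [ht.1, ht.2])
      push_cast at hb
      rw [Real.norm_eq_abs]
      nlinarith [mul_le_mul_of_nonneg_left hs (abs_nonneg (R.derivative.eval t))]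
    have hmv := (convex_Icc (-(92 / 100) : ℝ) (92 / 100)).norm_image_sub_le_of_norm_hasDerivWithin_le
      (f := fun t => R.eval t) (fun t _ => (R.hasDerivAt t).hasDerivWithinAt) hder
      (abs_le.mp ((hy92 i).trans (by norm_num))) (abs_le.mp (hx92 i))
    simp only [hRe] at hmv
    rw [← hvi, Function.update_eq_self, Real.norm_eq_abs, hvi, Real.norm_eq_abs] at hmv
    refine hmv.trans ?_
    have hMpos' : 0 < M := hMpos
    gcongr
    exact hxy i
  -- passing from `y` to `x` one coordinate at a time
  have hpath : ∀ s : Finset (Fin d), s.piecewise x y ∈ K ∧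
      |q (s.piecewise x y) - q y| ≤ s.card * (36 * m * M * η) := by
    intro s
    induction s using Finset.induction_on with
    | empty => simpa using hyK
    | insert i s hi ih =>
      rw [Finset.piecewise_insert]
      refine ⟨hupd _ ih.1 i _ ((hmemK x).mp hxK i), ?_⟩
      have h1 := hstep _ ih.1 i (by simp [hi])
      rw [Finset.card_insert_of_notMem hi]
      push_cast
      calc _ ≤ |q (Function.update (s.piecewise x y) i (x i)) - q (s.piecewise x y)| +
              |q (s.piecewise x y) - q y| := abs_sub_le _ _ _
        _ ≤ _ := by linarith [ih.2]
  have hfin := (hpath Finset.univ).2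
  rw [Finset.piecewise_univ, Finset.card_univ, Fintype.card_fin] at hfin
  have h1 : (d : ℝ) * (36 * m * M * η) ≤ M / 2 := by
    have hMpos' : 0 < M := hMpos
    nlinarith
  have h2 := abs_sub_abs_le_abs_sub (q y) (q x)
  rw [abs_sub_comm] at h2
  linarith [hqF x hxK]

/-! ### Local polynomial reproduction -/

/-- Functionals dominated on a finite set are combinations of point evaluations on that set,
with the same bound for the coefficients in the `ℓ¹` norm. -/
theorem exists_coeff_of_abs_le {E : Type*} (V : Submodule ℝ (E → ℝ)) (Y : Finset E) (x : E)
    {Λ : ℝ} (hΛ : 0 ≤ Λ)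
    (h : ∀ p ∈ V, ∀ S : ℝ, 0 ≤ S → (∀ y ∈ Y, |p y| ≤ S) → |p x| ≤ Λ * S) :
    ∃ b : E → ℝ, ∑ y ∈ Y, |b y| ≤ Λ ∧ ∀ p ∈ V, p x = ∑ y ∈ Y, b y * p y := by
  classical
  set T : V →ₗ[ℝ] (Y → ℝ) := (LinearMap.funLeft ℝ ℝ ((↑) : Y → E)).comp V.subtype with hT
  have hTa : ∀ p y, T p y = (p : E → ℝ) y := fun p y => rfl
  set ev : Module.Dual ℝ V := (LinearMap.proj x).comp V.subtype with hev
  have heva : ∀ p, ev p = (p : E → ℝ) x := fun p => rfl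
  have hbd : ∀ p, |ev p| ≤ Λ * ‖T p‖ := fun p =>
    h p p.2 _ (norm_nonneg _) fun y hy => by
      simpa [hTa] using norm_le_pi_norm (T p) ⟨y, hy⟩
  have hmem : ev ∈ LinearMap.range T.dualMap := by
    rw [LinearMap.range_dualMap_eq_dualAnnihilator_ker, Submodule.mem_dualAnnihilator]
    intro p hp
    have := hbd p
    rw [LinearMap.mem_ker.mp hp, norm_zero, mul_zero] at this
    exact abs_nonpos_iff.mp this
  obtain ⟨φ, hφ⟩ := hmem
  have hφa : ∀ p, φ (T p) = ev p := fun p => by rw [← hφ]; rfl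
  set f : StrongDual ℝ (LinearMap.range T) :=
    (φ.comp (LinearMap.range T).subtype).mkContinuous Λ (by
      rintro ⟨_, p, rfl⟩
      simpa [hφa] using hbd p) with hf
  obtain ⟨g, hg, hgn⟩ := exists_extension_norm_eq (LinearMap.range T) f
  have hgΛ : ‖g‖ ≤ Λ := hgn.trans_le (LinearMap.mkContinuous_norm_le _ hΛ _)
  set b : E → ℝ := fun y => if hy : y ∈ Y then g (Pi.single ⟨y, hy⟩ 1) else 0 with hb
  have hgsum : ∀ v : Y → ℝ, g v = ∑ y : Y, v y * b y := by
    intro v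
    conv_lhs => rw [← Finset.univ_sum_single v, map_sum]
    refine Finset.sum_congr rfl fun y _ => ?_
    have : (Pi.single y (v y) : Y → ℝ) = v y • Pi.single y 1 := by
      rw [← Pi.single_smul, smul_eq_mul, mul_one]
    rw [this, map_smul, smul_eq_mul]
    simp [hb]
  refine ⟨b, ?_, fun p hp => ?_⟩
  · have h1 := hgsum fun y => SignType.sign (b y)
    have h2 : ‖(fun y : Y => ((SignType.sign (b y) : SignType) : ℝ))‖ ≤ 1 := by
      rw [pi_norm_le_iff_of_nonneg zero_le_one]
      intro y
      rcases lt_trichotomy (b y) 0 with h | h | h <;> simp [h]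
    have h3 := (le_abs_self _).trans (g.le_opNorm_of_le h2)
    rw [h1, mul_one] at h3
    refine le_trans (le_of_eq ?_) (h3.trans hgΛ)
    rw [← Finset.sum_coe_sort]
    refine Finset.sum_congr rfl fun y _ => ?_
    rw [sign_mul_self]
  · have h1 : g (T ⟨p, hp⟩) = ev ⟨p, hp⟩ := by
      have := hg ⟨T ⟨p, hp⟩, LinearMap.mem_range_self _ _⟩
      rw [← hφa]
      exact this
    rw [hgsum] at h1
    refine h1.symm.trans ?_
    rw [← Finset.sum_coe_sort Y fun y => b y * p y]
    exact Finset.sum_congr rfl fun y _ => mul_comm (p (y : E)) (b y)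

/-- The continuous functions on `ℝ^d` whose restriction to every line is a polynomial of degree at
most `m`. These are the polynomials of total degree at most `m`; the encoding by restrictions to
lines is the form in which the one-dimensional inequalities apply. -/
def linePoly (d m : ℕ) : Submodule ℝ (Sp d → ℝ) where
  carrier := {f | Continuous f ∧
    ∀ a b, ∃ P : Polynomial ℝ, P.natDegree ≤ m ∧ ∀ t : ℝ, f (a + t • b) = P.eval t}
  add_mem' := by
    rintro f g ⟨hf, hf'⟩ ⟨hg, hg'⟩
    refine ⟨hf.add hg, fun a b => ?_⟩
    obtain ⟨P, hP, hPe⟩ := hf' a b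
    obtain ⟨Q, hQ, hQe⟩ := hg' a b
    exact ⟨P + Q, (Polynomial.natDegree_add_le _ _).trans (max_le hP hQ), fun t => by
      simp [hPe, hQe]⟩
  zero_mem' := ⟨continuous_zero, fun a b => ⟨0, by simp, fun t => by simp⟩⟩
  smul_mem' := by
    rintro r f ⟨hf, hf'⟩
    refine ⟨hf.const_smul r, fun a b => ?_⟩
    obtain ⟨P, hP, hPe⟩ := hf' a b
    exact ⟨Polynomial.C r * P, (Polynomial.natDegree_C_mul_le _ _).trans hP, fun t => by
      simp [hPe]⟩

theorem norm_le_mul_of_abs_le {d : ℕ} {v : Sp d} {a : ℝ} (ha : 0 ≤ a) (h : ∀ i, |v i| ≤ a) :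
    ‖v‖ ≤ d * a := by
  refine abs_le_of_sq_le_sq' ?_ (by positivity) |>.2
  rw [EuclideanSpace.real_norm_sq_eq]
  calc ∑ i, v i ^ 2 ≤ ∑ _i : Fin d, a ^ 2 :=
        Finset.sum_le_sum fun i _ => by rw [← sq_abs]; gcongr; exact h i
    _ = d * a ^ 2 := by simp
    _ ≤ (d * a) ^ 2 := by
      rw [mul_pow]
      gcongr
      rcases Nat.eq_zero_or_pos d with rfl | hd
      · simp
      · have : (1 : ℝ) ≤ d := by exact_mod_cast hd
        nlinarith

theorem abs_apply_le_norm {d : ℕ} (v : Sp d) (i : Fin d) : |v i| ≤ ‖v‖ :=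
  PiLp.norm_apply_le v i

open Polynomial in
/-- Points of density `h` in a ball of radius `r` control polynomials of degree at most `m` at
distance `L * r` from the centre, with a constant exponential in `m`, as soon as `m` is at most a
small multiple of `r / h`. -/
theorem abs_le_of_mem_linePoly {d m : ℕ} (hd : 0 < d) (hm : 1 ≤ m) {f : Sp d → ℝ}
    (hf : f ∈ linePoly d m) {c x : Sp d} {r L h S : ℝ} (hr : 0 < r) (hL : 1 ≤ L) (hh : 0 ≤ h)
    (hx : ‖x - c‖ ≤ L * r) (hmh : 72 * d ^ 2 * m * h ≤ r) {X : Set (Sp d)}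
    (hX : ∀ y, ‖y - c‖ ≤ r → ∃ z ∈ X, ‖y - z‖ ≤ h)
    (hS : ∀ z ∈ X, ‖z - c‖ ≤ r → |f z| ≤ S) :
    |f x| ≤ 2 * (((4 / 3) ^ d * (4 * d * L)) ^ m) * S := by
  have hd1 : (1 : ℝ) ≤ d := by exact_mod_cast hd
  have hm1 : (1 : ℝ) ≤ m := by exact_mod_cast hm
  set a : ℝ := r / d with ha
  have ha0 : 0 < a := by positivity
  have hda : d * a = r := by rw [ha]; field_simp
  -- `ι` maps the unit cube onto a cube of half-side `r / d`, which lies in the ball of radius `r`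
  set ι : (Fin d → ℝ) → Sp d := fun z => c + a • WithLp.toLp 2 z with hι
  have hιi : ∀ z i, (ι z - c) i = a * z i := by intro z i; simp [hι]
  have hιc : Continuous ι := by
    rw [hι]
    exact continuous_const.add ((PiLp.continuous_toLp 2 _).const_smul a)
  have hιn : ∀ z : Fin d → ℝ, (∀ i, |z i| ≤ 1) → ‖ι z - c‖ ≤ r := by
    intro z hz
    rw [← hda]
    refine norm_le_mul_of_abs_le ha0.le fun i => ?_
    rw [hιi, abs_mul, abs_of_pos ha0]
    exact mul_le_of_le_one_right ha0.le (hz i)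
  have hηa : 72 * d * m * (h / a) ≤ 1 := by
    rw [ha, div_div_eq_mul_div, ← mul_div_assoc, div_le_one hr]
    nlinarith
  have hη72 : h / a ≤ 1 / 72 := by
    have h0 : 0 ≤ h / a := by positivity
    have : (1 : ℝ) ≤ d * m := by nlinarith
    nlinarith
  have hnorming := fun z hz => abs_mul_prod_one_sub_sq_pow_le (F := fun z => f (ι z)) (S := S)
    (z := z) hm (hf.1.comp hιc) (by
      intro z i
      obtain ⟨P, hPd, hPe⟩ := hf.2 (ι (Function.update z i 0)) (a • EuclideanSpace.single i 1)
      refine ⟨P, hPd, fun t => ?_⟩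
      rw [← hPe]
      congr 1
      ext j
      rcases eq_or_ne j i with rfl | hj
      · simp [hι, mul_comm]
      · simp [hι, hj]) (η := h / a) (by positivity) hηa (by
      intro y hy
      have hy92 : ∀ i, |y i| ≤ 903 / 1000 :=
        fun i => abs_le_of_sq_le_sq (by linarith [hy i]) (by norm_num)
      obtain ⟨w, hwX, hw⟩ := hX (ι y) (hιn y fun i => (hy92 i).trans (by norm_num))
      have hιx : ι (fun i => (w - c) i / a) = w := by
        ext i
        simp only [hι, PiLp.add_apply, PiLp.smul_apply, PiLp.sub_apply, smul_eq_mul]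
        field_simp
        ring
      have hdist : ∀ i, |(w - c) i / a - y i| ≤ h / a := by
        intro i
        have h1 : (w - c) i / a - y i = (w - ι y) i / a := by
          have := hιi y i
          rw [eq_div_iff ha0.ne', sub_mul, div_mul_cancel₀ _ ha0.ne', mul_comm (y i), ← this]
          simp
        rw [h1, abs_div, abs_of_pos ha0]
        gcongr
        refine (abs_apply_le_norm _ i).trans ?_
        rwa [norm_sub_rev]
      refine ⟨fun i => (w - c) i / a, hdist, ?_⟩
      rw [hιx]
      refine hS w hwX ?_
      rw [← hιx]
      refine hιn _ fun i => ?_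
      have := abs_sub_abs_le_abs_sub ((w - c) i / a) (y i)
      linarith [hdist i, hy92 i]) hz
  -- the segment through `c` in the direction of `x`, within half the cube
  set s : ℝ := (2 * d * L)⁻¹ with hs
  have hs0 : 0 < s := by positivity
  obtain ⟨P, hPd, hPe⟩ := hf.2 c (s • (x - c))
  have hPM : ∀ t ∈ Icc (-1 : ℝ) 1, |P.eval t| ≤ 2 * S * ((4 / 3) ^ d) ^ m := by
    intro t ht
    set z : Fin d → ℝ := fun i => t * s * (x - c) i / a with hz
    have hz2 : ∀ i, |z i| ≤ 1 / 2 := by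
      intro i
      rw [hz]
      simp only
      rw [abs_div, abs_of_pos ha0, div_le_iff₀ ha0, abs_mul, abs_mul, abs_of_pos hs0]
      calc |t| * s * |(x - c) i| ≤ 1 * s * (L * r) := by
            gcongr
            · exact abs_le.mpr ht
            · exact (abs_apply_le_norm _ i).trans hx
        _ = 1 / 2 * a := by
            rw [hs, ha]; field_simp
    have h1 := hnorming z fun i => (hz2 i).trans (by norm_num)
    have h2 : ι z = c + t • s • (x - c) := by
      ext i
      simp only [hι, hz, PiLp.add_apply, PiLp.smul_apply, smul_eq_mul]
      field_simp
    rw [h2, hPe] at h1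
    have h3 : ((3 / 4 : ℝ) ^ d) ^ m ≤ ∏ i, (1 - z i ^ 2) ^ m := by
      rw [← pow_mul, mul_comm, pow_mul]
      calc ((3 / 4 : ℝ) ^ m) ^ d = ∏ _i : Fin d, (3 / 4 : ℝ) ^ m := by simp
        _ ≤ _ := by
          refine Finset.prod_le_prod (fun i _ => by positivity) fun i _ => ?_
          have : z i ^ 2 ≤ 1 / 4 := by
            rw [← sq_abs]
            nlinarith [hz2 i, abs_nonneg (z i)]
          gcongr
          linarith
    have h4 : ((3 / 4 : ℝ) ^ d) ^ m * ((4 / 3) ^ d) ^ m = 1 := by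
      rw [← mul_pow, ← mul_pow]; norm_num
    calc |P.eval t| = |P.eval t| * ((3 / 4 : ℝ) ^ d) ^ m * ((4 / 3) ^ d) ^ m := by
          rw [mul_assoc, h4, mul_one]
      _ ≤ 2 * S * ((4 / 3) ^ d) ^ m := by
          exact mul_le_mul_of_nonneg_right
            ((mul_le_mul_of_nonneg_left h3 (abs_nonneg _)).trans h1) (by positivity)
  have hsinv : s⁻¹ = 2 * d * L := by rw [hs, inv_inv]
  have hs1 : 1 ≤ |s⁻¹| := by
    rw [hsinv, abs_of_pos (by positivity)]
    nlinarith
  have hfin := abs_eval_le_mul_two_mul_pow hPd hPM hs1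
  rw [← hPe, smul_smul, inv_mul_cancel₀ hs0.ne', one_smul, add_sub_cancel, hsinv,
    abs_of_pos (by positivity : 0 < 2 * (d : ℝ) * L)] at hfin
  refine hfin.trans (le_of_eq ?_)
  rw [show 2 * (2 * (d : ℝ) * L) = 4 * d * L by ring, mul_pow]
  ring

/-! ### Polynomial approximation of the generalized multiquadric -/

/-- Polynomial approximation of the binomial series at a geometric rate. -/
theorem exists_poly_approx_one_add_rpow (e : ℝ) :
    ∃ C R : ℝ, 0 < C ∧ 0 < R ∧ ∀ n : ℕ, ∃ T : Polynomial ℝ, T.natDegree ≤ n ∧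
      ∀ s : ℝ, |s| < R → |(1 + s) ^ e - T.eval s| ≤ C * (|s| / R) ^ n := by
  have han : AnalyticAt ℝ (fun s : ℝ => s ^ e) 1 :=
    (Real.contDiffAt_rpow_const_of_ne one_ne_zero (n := ω)).analyticAt
  obtain ⟨p, r, hp⟩ := han
  obtain ⟨R, hR0, hR⟩ := ENNReal.lt_iff_exists_nnreal_btwn.mp hp.r_pos
  have hR0' : 0 < R := by exact_mod_cast hR0
  obtain ⟨a, ha, C, hC, happ⟩ := hp.uniform_geometric_approx' hR
  refine ⟨C, R, hC, by exact_mod_cast hR0', fun n =>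
    ⟨∑ k ∈ Finset.range n, Polynomial.monomial k (p.coeff k), ?_, fun s hs => ?_⟩⟩
  · refine Polynomial.natDegree_sum_le_of_forall_le _ _ fun k hk => ?_
    exact (Polynomial.natDegree_monomial_le _).trans (Finset.mem_range.mp hk).le
  · have h1 := happ s (by simpa using hs) n
    have h2 : p.partialSum n s =
        (∑ k ∈ Finset.range n, Polynomial.monomial k (p.coeff k)).eval s := by
      rw [FormalMultilinearSeries.partialSum, Polynomial.eval_finsetSum]
      refine Finset.sum_congr rfl fun k _ => ?_
      rw [FormalMultilinearSeries.apply_eq_pow_smul_coeff, Polynomial.eval_monomial, smul_eq_mul,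
        mul_comm]
    rw [h2, Real.norm_eq_abs] at h1
    refine h1.trans ?_
    rw [Real.norm_eq_abs]
    have ha0 := ha.1
    gcongr
    exact mul_le_of_le_one_left (by positivity) ha.2.le

open Polynomial in
/-- Near any centre, the translates of the generalized multiquadric are approximated by polynomials
of degree `2 k` with an error geometric in `k`, uniformly in the translate. -/
theorem exists_linePoly_approx_gmq {d : ℕ} {ε α : ℝ} (hε : 0 < ε) (hα : α < d) :
    ∃ A B ρ₀ : ℝ, 0 < A ∧ 0 < B ∧ 0 < ρ₀ ∧ ∀ (c z : Sp d) (ρ : ℝ), 0 < ρ → ρ ≤ ρ₀ → ∀ k : ℕ,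
      ∃ q ∈ linePoly d (2 * k), ∀ y, ‖y - c‖ ≤ ρ → |gmq ε α (y - z) - q y| ≤ A * (B * ρ) ^ k := by
  set e : ℝ := (α - d) / 2 with he
  have he0 : e < 0 := by rw [he]; linarith
  obtain ⟨C₁, R, hC, hR, hT⟩ := exists_poly_approx_one_add_rpow e
  refine ⟨(ε ^ 2) ^ e * C₁, 2 / (ε * R), min ε (ε * R / 4), by positivity, by positivity,
    by positivity, fun c z ρ hρ hρ₀ k => ?_⟩
  obtain ⟨T, hTd, hTe⟩ := hT k
  have hρε : ρ ≤ ε := hρ₀.trans (min_le_left _ _)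
  have hρR : ρ ≤ ε * R / 4 := hρ₀.trans (min_le_right _ _)
  set A₀ : ℝ := ε ^ 2 + ‖c - z‖ ^ 2 with hA₀
  have hA₀ε : ε ^ 2 ≤ A₀ := by rw [hA₀]; nlinarith [sq_nonneg ‖c - z‖]
  have hA₀p : 0 < A₀ := by positivity
  -- `ε² + |y - z|² = A₀ (1 + σ y)` with `σ` a quadratic polynomial, small near `c`
  set σ : Sp d → ℝ := fun y => (2 * inner ℝ (y - c) (c - z) + ‖y - c‖ ^ 2) / A₀ with hσ
  have hgmq : ∀ y, gmq ε α (y - z) = A₀ ^ e * (1 + σ y) ^ e := by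
    intro y
    have h1 : ε ^ 2 + ‖y - z‖ ^ 2 = A₀ * (1 + σ y) := by
      rw [hσ]
      simp only
      rw [mul_add, mul_div_cancel₀ _ hA₀p.ne', show y - z = (y - c) + (c - z) by abel,
        norm_add_sq_real, hA₀]
      ring
    have h2 : 0 ≤ 1 + σ y := by
      have : 0 < A₀ * (1 + σ y) := by rw [← h1]; positivity
      exact (pos_of_mul_pos_right this hA₀p.le).le
    rw [gmq, h1, Real.mul_rpow hA₀p.le h2]
  refine ⟨fun y => A₀ ^ e * T.eval (σ y), ⟨?_, ?_⟩, ?_⟩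
  · have : Continuous σ := by rw [hσ]; fun_prop
    exact continuous_const.mul (T.continuous.comp this)
  · intro a b
    set Q : ℝ[X] := C ((2 * inner ℝ (a - c) (c - z) + ‖a - c‖ ^ 2) / A₀) +
      C ((2 * inner ℝ b (c - z) + 2 * inner ℝ (a - c) b) / A₀) * X + C (‖b‖ ^ 2 / A₀) * X ^ 2 with hQ
    have hQd : Q.natDegree ≤ 2 := by rw [hQ]; compute_degree
    refine ⟨C (A₀ ^ e) * T.comp Q, ?_, fun t => ?_⟩
    · refine (natDegree_C_mul_le _ _).trans ?_
      rw [natDegree_comp, mul_comm]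
      exact Nat.mul_le_mul hQd hTd
    · have : σ (a + t • b) = Q.eval t := by
        rw [hσ, hQ]
        simp only [eval_add, eval_mul, eval_C, eval_X, eval_pow]
        rw [show a + t • b - c = (a - c) + t • b by abel, inner_add_left, norm_add_sq_real,
          inner_smul_left, inner_smul_right, norm_smul, mul_pow, Real.norm_eq_abs, sq_abs]
        simp only [conj_trivial]
        field_simp
        ring
      simp [this]
  · intro y hy
    have hσb : |σ y| ≤ 2 * ρ / ε := by
      rw [hσ]
      simp only
      rw [abs_div, abs_of_pos hA₀p, div_le_div_iff₀ hA₀p hε]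
      have h1 : |inner ℝ (y - c) (c - z)| ≤ ρ * ‖c - z‖ :=
        (abs_real_inner_le_norm _ _).trans (by gcongr)
      have h2 : |2 * inner ℝ (y - c) (c - z) + ‖y - c‖ ^ 2| ≤ 2 * (ρ * ‖c - z‖) + ρ ^ 2 := by
        refine (abs_add_le _ _).trans ?_
        rw [abs_mul, abs_of_pos two_pos, abs_of_nonneg (sq_nonneg ‖y - c‖)]
        gcongr
      have h3 : (2 * (ρ * ‖c - z‖) + ρ ^ 2) * ε ≤ 2 * ρ * A₀ := by
        have h4 : 2 * ε * ‖c - z‖ ≤ A₀ := by rw [hA₀]; nlinarith [sq_nonneg (ε - ‖c - z‖)]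
        have h5 : ρ * ε ≤ A₀ := by nlinarith
        nlinarith
      exact (mul_le_mul_of_nonneg_right h2 hε.le).trans h3
    have hσR : |σ y| < R := by
      refine hσb.trans_lt ?_
      rw [div_lt_iff₀ hε]
      nlinarith [mul_pos hε hR]
    have h1 := hTe _ hσR
    simp only
    rw [hgmq, ← mul_sub, abs_mul, abs_of_pos (by positivity), mul_assoc]
    have h2 : A₀ ^ e ≤ (ε ^ 2) ^ e := Real.rpow_le_rpow_of_nonpos (by positivity) hA₀ε he0.le
    have h3 : |σ y| / R ≤ 2 / (ε * R) * ρ := by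
      rw [div_le_iff₀ hR]
      refine hσb.trans (le_of_eq ?_)
      field_simp
    gcongr
    exact h1.trans (by gcongr)

/-! ### The sampling inequality in the native space -/

theorem gmq_neg {d : ℕ} (ε α : ℝ) (z : Sp d) : gmq ε α (-z) = gmq ε α z := by simp [gmq]

/-- The generalized multiquadric is maximal at the origin, with a quadratic decrease. -/
theorem gmq_zero_sub_gmq_le {d : ℕ} {ε α : ℝ} (hε : 0 < ε) (hα : α < d) (z : Sp d) :
    gmq ε α (0 : Sp d) - gmq ε α z ≤ (ε ^ 2) ^ ((α - d) / 2) * ((d - α) / 2 / ε ^ 2) * ‖z‖ ^ 2 := by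
  have hε2 : 0 < ε ^ 2 := by positivity
  set e : ℝ := (α - d) / 2 with he
  have he' : (d - α) / 2 = -e := by rw [he]; ring
  have he0 : e ≤ 0 := by rw [he]; linarith
  set s : ℝ := ‖z‖ ^ 2 / ε ^ 2 with hs
  have hs0 : 0 ≤ s := by positivity
  have h1 : ε ^ 2 + ‖z‖ ^ 2 = ε ^ 2 * (1 + s) := by rw [hs]; field_simp
  have h2 : 1 + e * s ≤ (1 + s) ^ e := by
    rw [Real.rpow_def_of_pos (by linarith)]
    have h3 := Real.log_le_sub_one_of_pos (show 0 < 1 + s by linarith)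
    have h4 := Real.add_one_le_exp (Real.log (1 + s) * e)
    nlinarith
  have h0 : gmq ε α (0 : Sp d) = (ε ^ 2) ^ e := by simp [gmq, he]
  rw [h0, gmq, h1, Real.mul_rpow hε2.le (by linarith), he']
  have h5 : 0 < (ε ^ 2) ^ e := by positivity
  have h6 : (ε ^ 2) ^ e * (-e / ε ^ 2) * ‖z‖ ^ 2 = (ε ^ 2) ^ e * (-e * s) := by rw [hs]; ring
  rw [h6]
  nlinarith

section RKHS

variable {d : ℕ} {Ω : Set (Sp d)} {ε α : ℝ} {H : Type*} [NormedAddCommGroup H]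
  [InnerProductSpace ℝ H] [CompleteSpace H] [RKHS ℝ H Ω ℝ]

open Classical in
/-- The representer of the evaluation at `z`, set to `0` for `z ∉ Ω`. -/
noncomputable def evalRep (H : Type*) [NormedAddCommGroup H] [InnerProductSpace ℝ H]
    [CompleteSpace H] [RKHS ℝ H Ω ℝ] (z : Sp d) : H :=
  if hz : z ∈ Ω then RKHS.kerFun H (⟨z, hz⟩ : Ω) (1 : ℝ) else 0

theorem inner_evalRep {z : Sp d} (hz : z ∈ Ω) (w : H) :
    inner ℝ (evalRep (Ω := Ω) H z) w = w ⟨z, hz⟩ := by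
  rw [evalRep, dif_pos hz, RKHS.kerFun_inner]
  simp

theorem evalRep_apply (hK : RKHS.kernel H = gmqKernel Ω ε α) {z : Sp d} (hz : z ∈ Ω) (x : Ω) :
    evalRep (Ω := Ω) H z x = gmq ε α ((x : Sp d) - z) := by
  rw [evalRep, dif_pos hz, RKHS.kerFun_apply, hK]
  simp [gmqKernel]

theorem inner_evalRep_evalRep (hK : RKHS.kernel H = gmqKernel Ω ε α) {z y : Sp d} (hz : z ∈ Ω)
    (hy : y ∈ Ω) :
    inner ℝ (evalRep (Ω := Ω) H z) (evalRep (Ω := Ω) H y) = gmq ε α (z - y) := by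
  rw [inner_evalRep hz, evalRep_apply hK hy]

theorem abs_apply_le_mul_norm (hK : RKHS.kernel H = gmqKernel Ω ε α) (w : H) (x : Ω) :
    |w x| ≤ Real.sqrt ((ε ^ 2) ^ ((α - d) / 2)) * ‖w‖ := by
  obtain ⟨x, hx⟩ := x
  rw [← inner_evalRep hx]
  refine (abs_real_inner_le_norm _ _).trans ?_
  gcongr
  refine Real.le_sqrt_of_sq_le ?_
  rw [← real_inner_self_eq_norm_sq, inner_evalRep_evalRep hK hx hx]
  simp [gmq]

/-- Elements of the native space are Lipschitz, since `‖Φ(· - x) - Φ(· - y)‖² = 2 (Φ 0 - Φ (x - y))`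
is `O(|x - y|²)`. -/
theorem abs_apply_sub_apply_le (hε : 0 < ε) (hα : α < d) (hK : RKHS.kernel H = gmqKernel Ω ε α)
    (w : H) (x y : Ω) :
    |w x - w y| ≤ Real.sqrt (2 * ((ε ^ 2) ^ ((α - d) / 2) * ((d - α) / 2 / ε ^ 2))) * ‖w‖ *
      ‖(x : Sp d) - y‖ := by
  obtain ⟨x, hx⟩ := x
  obtain ⟨y, hy⟩ := y
  rw [← inner_evalRep hx, ← inner_evalRep hy, ← inner_sub_left]
  refine (abs_real_inner_le_norm _ _).trans ?_
  rw [mul_right_comm]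
  gcongr
  have h := gmq_zero_sub_gmq_le hε hα (x - y)
  refine abs_le_of_sq_le_sq' ?_ (by positivity) |>.2
  rw [mul_pow, Real.sq_sqrt (by have : 0 < (d : ℝ) - α := by linarith
                                positivity), ← real_inner_self_eq_norm_sq, inner_sub_left,
    inner_sub_right, inner_sub_right, inner_evalRep_evalRep hK hx hx,
    inner_evalRep_evalRep hK hx hy, inner_evalRep_evalRep hK hy hx,
    inner_evalRep_evalRep hK hy hy, sub_self, sub_self, ← neg_sub x y, gmq_neg]
  linarith

/-- The power function estimate: a quadrature-like functional which is exact on `V` has small norm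
in the dual of the native space as soon as the kernel is close to `V`. -/
theorem abs_apply_le_of_exact (hK : RKHS.kernel H = gmqKernel Ω ε α) {V : Submodule ℝ (Sp d → ℝ)}
    {Y : Finset (Sp d)} (hY : (Y : Set (Sp d)) ⊆ Ω) {x : Sp d} (hx : x ∈ Ω) {b : Sp d → ℝ}
    {Λ E : ℝ} (hb : ∑ y ∈ Y, |b y| ≤ Λ) (hex : ∀ p ∈ V, p x = ∑ y ∈ Y, b y * p y) (hE : 0 ≤ E)
    (happ : ∀ z, ∃ q ∈ V, |gmq ε α (x - z) - q x| ≤ E ∧ ∀ y ∈ Y, |gmq ε α (y - z) - q y| ≤ E)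
    (w : H) (hw : ∀ y (hy : y ∈ Ω), y ∈ Y → w ⟨y, hy⟩ = 0) :
    |w ⟨x, hx⟩| ≤ (1 + Λ) * Real.sqrt E * ‖w‖ := by
  have hΛ : 0 ≤ Λ := (Finset.sum_nonneg fun y _ => abs_nonneg (b y)).trans hb
  have hsum : ∀ (g : Sp d → ℝ) (T : ℝ), 0 ≤ T → |g x| ≤ T → (∀ y ∈ Y, |g y| ≤ T) →
      |g x - ∑ y ∈ Y, b y * g y| ≤ (1 + Λ) * T := by
    intro g T hT hgx hgy
    calc |g x - ∑ y ∈ Y, b y * g y| ≤ |g x| + |∑ y ∈ Y, b y * g y| := abs_sub _ _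
      _ ≤ T + ∑ y ∈ Y, |b y| * T := by
        gcongr
        refine (Finset.abs_sum_le_sum_abs _ _).trans (Finset.sum_le_sum fun y hy => ?_)
        rw [abs_mul]
        gcongr
        exact hgy y hy
      _ ≤ (1 + Λ) * T := by
        rw [← Finset.sum_mul]
        nlinarith
  set D : Sp d → ℝ := fun z => gmq ε α (x - z) - ∑ y ∈ Y, b y * gmq ε α (y - z) with hD
  have hDz : ∀ z, |D z| ≤ (1 + Λ) * E := by
    intro z
    obtain ⟨q, hq, hqx, hqy⟩ := happ z
    have := hsum (fun y => gmq ε α (y - z) - q y) E hE hqx hqy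
    refine le_trans (le_of_eq ?_) this
    simp only [mul_sub, Finset.sum_sub_distrib, ← hex q hq, hD]
    congr 1
    ring
  -- the representer of the error functional, whose squared norm is a double difference of the kernel
  set v : H := evalRep (Ω := Ω) H x - ∑ y ∈ Y, b y • evalRep (Ω := Ω) H y with hv
  have hvz : ∀ z ∈ Ω, inner ℝ v (evalRep (Ω := Ω) H z) = D z := by
    intro z hz
    rw [hv, inner_sub_left, sum_inner, inner_evalRep_evalRep hK hx hz, hD]
    simp only
    congr 1
    refine Finset.sum_congr rfl fun y hy => ?_
    rw [real_inner_smul_left, inner_evalRep_evalRep hK (hY hy) hz]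
  have hvn : ‖v‖ ^ 2 ≤ ((1 + Λ) * Real.sqrt E) ^ 2 := by
    rw [← real_inner_self_eq_norm_sq]
    have h1 : inner ℝ v v = D x - ∑ y ∈ Y, b y * D y := by
      conv_lhs => rw [hv, inner_sub_right, inner_sum, ← hv, hvz x hx]
      congr 1
      refine Finset.sum_congr rfl fun y hy => ?_
      rw [real_inner_smul_right, hvz y (hY hy)]
    rw [h1, mul_pow, Real.sq_sqrt hE]
    refine (le_abs_self _).trans ((hsum D _ (by positivity) (hDz x) fun y _ => hDz y).trans
      (le_of_eq ?_))
    ring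
  have hvw : inner ℝ v w = w ⟨x, hx⟩ := by
    rw [hv, inner_sub_left, sum_inner, inner_evalRep hx, sub_eq_self]
    refine Finset.sum_eq_zero fun y hy => ?_
    rw [real_inner_smul_left, inner_evalRep (hY hy), hw y (hY hy) hy, mul_zero]
  rw [← hvw]
  refine (abs_real_inner_le_norm _ _).trans ?_
  gcongr
  exact abs_le_of_sq_le_sq' hvn (by positivity) |>.2

/-- The **sampling inequality**: an element of the native space which vanishes on a set of mesh
norm `h` is uniformly `O(exp (-c / h))`. The interior ball condition on `Ω` is what an interior
cone condition provides. -/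
theorem exists_abs_apply_le_exp (hd : 0 < d) (hε : 0 < ε) (hα : α < d)
    (hK : RKHS.kernel H = gmqKernel Ω ε α) {r₀ L : ℝ} (hr₀ : 0 < r₀) (hL : 1 ≤ L)
    (hball : ∀ x ∈ Ω, ∀ r, 0 < r → r ≤ r₀ → ∃ c, Metric.closedBall c r ⊆ Ω ∧ ‖x - c‖ ≤ L * r) :
    ∃ C c h₀ : ℝ, 0 < C ∧ 0 < c ∧ 0 < h₀ ∧ ∀ (X : Finset (Sp d)) (h : ℝ), (X : Set (Sp d)) ⊆ Ω →
      0 < h → h ≤ h₀ → (∀ y ∈ Ω, ∃ z ∈ X, ‖y - z‖ ≤ h) → ∀ w : H,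
        (∀ y (hy : y ∈ Ω), y ∈ X → w ⟨y, hy⟩ = 0) →
        ∀ x, |w x| ≤ C * Real.exp (-c / h) * ‖w‖ := by
  classical
  obtain ⟨A, B, ρ₀, hA, hB, hρ₀, happ⟩ := exists_linePoly_approx_gmq hε hα
  have hd1 : (1 : ℝ) ≤ d := by exact_mod_cast hd
  -- the norming constant is of order `G ^ m`
  set G : ℝ := (4 / 3) ^ d * (4 * d * L) with hG
  have hG1 : 1 ≤ G := by
    have h1 : (1 : ℝ) ≤ (4 / 3) ^ d := one_le_pow₀ (by norm_num)
    have h2 : (1 : ℝ) ≤ 4 * d * L := by nlinarith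
    rw [hG]
    nlinarith
  -- with this radius the approximation error beats the norming constant
  set r : ℝ := min r₀ (min (ρ₀ / L) (Real.exp (-2) / (G ^ 4 * B * L))) with hr
  have hr0 : 0 < r := by positivity
  have hr1 : r ≤ r₀ := min_le_left _ _
  have hr2 : L * r ≤ ρ₀ := by
    have : r ≤ ρ₀ / L := (min_le_right _ _).trans (min_le_left _ _)
    rwa [le_div_iff₀ (by linarith), mul_comm] at this
  have hr3 : G ^ 4 * (B * (L * r)) ≤ Real.exp (-2) := by
    have : r ≤ Real.exp (-2) / (G ^ 4 * B * L) := (min_le_right _ _).trans (min_le_right _ _)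
    rw [le_div_iff₀ (by positivity)] at this
    linarith
  refine ⟨3 * Real.sqrt A * Real.exp 1, r / (144 * d ^ 2), r / (144 * d ^ 2), by positivity,
    by positivity, by positivity, fun X h hX hh hh₀ hdense w hw x => ?_⟩
  obtain ⟨x, hx⟩ := x
  obtain ⟨c, hcΩ, hxc⟩ := hball x hx r hr0 hr1
  -- the largest degree `2 k` for which points of density `h` are norming
  set k : ℕ := ⌊r / (144 * d ^ 2) / h⌋₊ with hk
  have hk1 : 1 ≤ k := by
    rw [hk, Nat.one_le_floor_iff, one_le_div hh]
    exact hh₀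
  have hkle : (k : ℝ) ≤ r / (144 * d ^ 2) / h := Nat.floor_le (by positivity)
  have hkgt : r / (144 * d ^ 2) / h < k + 1 := Nat.lt_floor_add_one _
  have hmh : 72 * (d : ℝ) ^ 2 * ((2 * k : ℕ) : ℝ) * h ≤ r := by
    push_cast
    rw [le_div_iff₀ hh, le_div_iff₀ (by positivity)] at hkle
    linarith
  set Y : Finset (Sp d) := X.filter fun z => ‖z - c‖ ≤ r with hY
  have hLr : r ≤ L * r := by nlinarith
  obtain ⟨b, hb, hbex⟩ := exists_coeff_of_abs_le (linePoly d (2 * k)) Y x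
    (Λ := 2 * G ^ (2 * k)) (by positivity) (fun p hp S _ hS =>
      abs_le_of_mem_linePoly (X := X) hd (by omega) hp hr0 hL hh.le hxc hmh
        (fun y hy => hdense y (hcΩ (by rwa [Metric.mem_closedBall, dist_eq_norm])))
        fun z hz hzc => hS z (by rw [hY, Finset.mem_filter]; exact ⟨hz, hzc⟩))
  have hmain := abs_apply_le_of_exact hK (V := linePoly d (2 * k)) (Y := Y)
    (E := A * (B * (L * r)) ^ k)
    (fun y hy => hX (Finset.mem_of_mem_filter y hy)) hx hb hbex (by positivity)
    (fun z => by
      obtain ⟨q, hq, hqe⟩ := happ c z (L * r) (by positivity) hr2 k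
      exact ⟨q, hq, hqe x hxc, fun y hy => hqe y ((Finset.mem_filter.mp hy).2.trans hLr)⟩)
    w (fun y hy hyY => hw y hy (Finset.mem_of_mem_filter y hyY))
  refine hmain.trans (mul_le_mul_of_nonneg_right ?_ (norm_nonneg w))
  have h1 : 1 + 2 * G ^ (2 * k) ≤ 3 * G ^ (2 * k) := by
    have : 1 ≤ G ^ (2 * k) := one_le_pow₀ hG1
    linarith
  have h2 : (1 + 2 * G ^ (2 * k)) * Real.sqrt (A * (B * (L * r)) ^ k) ≤
      3 * Real.sqrt A * Real.exp (-k) := by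
    calc _ ≤ 3 * G ^ (2 * k) * Real.sqrt (A * (B * (L * r)) ^ k) := by gcongr
      _ = 3 * Real.sqrt A * Real.sqrt ((G ^ 4 * (B * (L * r))) ^ k) := by
        rw [Real.sqrt_mul hA.le, mul_pow (G ^ 4), Real.sqrt_mul (by positivity : 0 ≤ (G ^ 4) ^ k)]
        have : (G ^ 4) ^ k = (G ^ (2 * k)) ^ 2 := by rw [← pow_mul, ← pow_mul]; congr 1; ring
        rw [this, Real.sqrt_sq (by positivity)]
        ring
      _ ≤ 3 * Real.sqrt A * Real.exp (-k) := by
        gcongr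
        refine Real.sqrt_le_iff.mpr ⟨by positivity, ?_⟩
        calc (G ^ 4 * (B * (L * r))) ^ k ≤ Real.exp (-2) ^ k := by gcongr
          _ = Real.exp (-k) ^ 2 := by
            rw [← Real.exp_nat_mul, ← Real.exp_nat_mul]; congr 1; push_cast; ring
  refine h2.trans ?_
  rw [mul_assoc _ (Real.exp 1), ← Real.exp_add]
  gcongr
  rw [neg_div]
  linarith

theorem exists_eq_of_mem_trialSpace (hK : RKHS.kernel H = gmqKernel Ω ε α) {X : Finset (Sp d)}
    (hX : (X : Set (Sp d)) ⊆ Ω) {v : Sp d → ℝ} (hv : v ∈ trialSpace ε α X) :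
    ∃ s : H, ∀ x : Ω, s x = v x := by
  induction hv using Submodule.span_induction with
  | mem v hv =>
    obtain ⟨z, hz, rfl⟩ := hv
    exact ⟨evalRep (Ω := Ω) H z, fun x => evalRep_apply hK (hX hz) x⟩
  | zero => exact ⟨0, fun x => by simp⟩
  | add v w _ _ hv hw =>
    obtain ⟨s, hs⟩ := hv
    obtain ⟨t, ht⟩ := hw
    exact ⟨s + t, fun x => by simp [hs, ht]⟩
  | smul a v _ hv =>
    obtain ⟨s, hs⟩ := hv
    exact ⟨a • s, fun x => by simp [hs]⟩

/-- The orthogonal projection of `g` onto the span of the translates of the kernel: it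
interpolates `g` on `X`. -/
theorem exists_trialSpace_interpolant (hK : RKHS.kernel H = gmqKernel Ω ε α) {X : Finset (Sp d)}
    (hX : (X : Set (Sp d)) ⊆ Ω) (g : H) :
    ∃ v ∈ trialSpace ε α X, ∃ w : H, ‖w‖ ≤ ‖g‖ ∧ (∀ x, w x = g x - v x) ∧
      ∀ y (hy : y ∈ Ω), y ∈ X → w ⟨y, hy⟩ = 0 := by
  set U : Submodule ℝ H := Submodule.span ℝ (evalRep (Ω := Ω) H '' (X : Set (Sp d))) with hU
  have : FiniteDimensional ℝ U := FiniteDimensional.span_of_finite ℝ (X.finite_toSet.image _)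
  have hrep : ∀ s ∈ U, ∃ v ∈ trialSpace ε α X, ∀ x : Ω, s x = v x := by
    intro s hs
    induction hs using Submodule.span_induction with
    | mem s hs =>
      obtain ⟨z, hz, rfl⟩ := hs
      exact ⟨_, Submodule.subset_span ⟨z, hz, rfl⟩, fun x => evalRep_apply hK (hX hz) x⟩
    | zero => exact ⟨0, Submodule.zero_mem _, fun x => by simp⟩
    | add s t _ _ hs ht =>
      obtain ⟨v, hv, hv'⟩ := hs
      obtain ⟨w, hw, hw'⟩ := ht
      exact ⟨v + w, Submodule.add_mem _ hv hw, fun x => by simp [hv', hw']⟩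
    | smul a s _ hs =>
      obtain ⟨v, hv, hv'⟩ := hs
      exact ⟨a • v, Submodule.smul_mem _ _ hv, fun x => by simp [hv']⟩
  obtain ⟨v, hv, hv'⟩ := hrep (U.starProjection g) (U.starProjection_apply_mem g)
  refine ⟨v, hv, g - U.starProjection g, ?_, fun x => by simp [hv'], fun y hy hyX => ?_⟩
  · have h1 := U.norm_sq_eq_add_norm_sq_starProjection g
    have h2 : g - U.starProjection g = Uᗮ.starProjection g := by
      rw [Submodule.starProjection_orthogonal]; rfl
    rw [h2]
    nlinarith [norm_nonneg (Uᗮ.starProjection g), norm_nonneg g, norm_nonneg (U.starProjection g)]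
  · rw [← inner_evalRep hy]
    have hyU : evalRep (Ω := Ω) H y ∈ U := Submodule.subset_span ⟨y, hyX, rfl⟩
    exact Submodule.inner_right_of_mem_orthogonal hyU
      (U.sub_starProjection_mem_orthogonal g)

end RKHS

/-! ### Boundary charts of a Lipschitz domain -/

/-- Uniform boundary charts for `Ω`: finitely many functions `ψ i`, Lipschitz with constant `M` and
increasing with unit speed in the direction `n i`, such that `Ω` is `{ψ i > 0}` within distance
`ρ` of any point of `U i`, and such that the sets `U i` cover the part of `Ω` within distance `ρ` of
the complement. -/
structure BoundaryCharts {d : ℕ} (Ω : Set (Sp d)) where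
  /-- The index set of the charts. -/
  S : Finset (Sp d)
  /-- The region covered by a chart. -/
  U : Sp d → Set (Sp d)
  /-- The inward direction of a chart. -/
  n : Sp d → Sp d
  /-- The height above the boundary. -/
  ψ : Sp d → Sp d → ℝ
  /-- The Lipschitz constant of the heights. -/
  M : ℝ
  /-- The distance up to which the charts are valid. -/
  ρ : ℝ
  one_le_M : 1 ≤ M
  ρ_pos : 0 < ρ
  isOpen_U : ∀ i ∈ S, IsOpen (U i)
  norm_n : ∀ i ∈ S, ‖n i‖ = 1
  ψ_add : ∀ i ∈ S, ∀ y s, ψ i (y + s • n i) = ψ i y + s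
  abs_ψ_sub_le : ∀ i ∈ S, ∀ y z, |ψ i y - ψ i z| ≤ M * ‖y - z‖
  mem_iff : ∀ i ∈ S, ∀ x ∈ U i, ∀ y, ‖y - x‖ < ρ → (y ∈ Ω ↔ 0 < ψ i y)
  cover : ∀ x ∈ Ω, Metric.infDist x Ωᶜ < ρ → ∃ i ∈ S, x ∈ U i

/-- A local chart: `ψ` is the signed height above the graph, in the direction of the graph. -/
theorem IsLipschitzDomain.exists_chart {d : ℕ} {Ω : Set (Sp d)} (hΩ : IsLipschitzDomain Ω)
    {x : Sp d} (hx : x ∈ frontier Ω) :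
    ∃ (n : Sp d) (ψ : Sp d → ℝ) (M r : ℝ), ‖n‖ = 1 ∧ 0 < r ∧
      (∀ y s, ψ (y + s • n) = ψ y + s) ∧ (∀ y z, |ψ y - ψ z| ≤ M * ‖y - z‖) ∧
      ∀ y, ‖y - x‖ < r → (y ∈ Ω ↔ 0 < ψ y) := by
  obtain ⟨n, φ, L, r, hn, hφ, hr, hgraph⟩ := hΩ.exists_graph x hx
  have hnn : inner ℝ n n = (1 : ℝ) := by rw [real_inner_self_eq_norm_sq, hn, one_pow]
  refine ⟨n, fun y => inner ℝ n y - φ (y - inner ℝ n y • n), 1 + L * 2, r, hn, hr, ?_, ?_, ?_⟩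
  · intro y s
    simp only [inner_add_right, inner_smul_right, hnn]
    rw [show y + s • n - (inner ℝ n y + s * 1) • n = y - inner ℝ n y • n by module]
    ring
  · intro y z
    have h1 : |inner ℝ n y - inner ℝ n z| ≤ ‖y - z‖ := by
      rw [← inner_sub_right]
      refine (abs_real_inner_le_norm _ _).trans ?_
      rw [hn, one_mul]
    have h2 := hφ.dist_le_mul (y - inner ℝ n y • n) (z - inner ℝ n z • n)
    rw [Real.dist_eq, dist_eq_norm] at h2
    have h3 : ‖y - inner ℝ n y • n - (z - inner ℝ n z • n)‖ ≤ 2 * ‖y - z‖ := by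
      rw [show y - inner ℝ n y • n - (z - inner ℝ n z • n) =
        (y - z) - (inner ℝ n y - inner ℝ n z) • n by module]
      refine (norm_sub_le _ _).trans ?_
      rw [norm_smul, hn, mul_one, Real.norm_eq_abs]
      linarith
    have h4 : (L : ℝ) * ‖y - inner ℝ n y • n - (z - inner ℝ n z • n)‖ ≤ L * (2 * ‖y - z‖) := by
      gcongr
    rw [show inner ℝ n y - φ (y - inner ℝ n y • n) - (inner ℝ n z - φ (z - inner ℝ n z • n)) =
      (inner ℝ n y - inner ℝ n z) - (φ (y - inner ℝ n y • n) - φ (z - inner ℝ n z • n)) by ring]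
    refine (abs_sub _ _).trans ?_
    linarith
  · intro y hy
    have hyb : y ∈ Metric.ball x r := by rwa [Metric.mem_ball, dist_eq_norm]
    have h1 : y ∈ Ω ∩ Metric.ball x r ↔
        y ∈ {y ∈ Metric.ball x r | φ (y - inner ℝ n y • n) < inner ℝ n y} := by rw [hgraph]
    simp only [mem_inter_iff, hyb, and_true, mem_ofPred_eq, true_and] at h1
    rw [h1, sub_pos]

/-- The boundary is compact, hence covered by finitely many local charts. -/
theorem IsLipschitzDomain.nonempty_boundaryCharts {d : ℕ} {Ω : Set (Sp d)}
    (hΩ : IsLipschitzDomain Ω) (huniv : Ω ≠ univ) : Nonempty (BoundaryCharts Ω) := by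
  choose! n ψ M r hn hr hadd hlip hmem using fun x (hx : x ∈ frontier Ω) => hΩ.exists_chart hx
  have hcomp : IsCompact (frontier Ω) :=
    Metric.isCompact_of_isClosed_isBounded isClosed_frontier
      (hΩ.isBounded.closure.subset frontier_subset_closure)
  obtain ⟨S, hS, hcov⟩ := hcomp.elim_nhds_subcover (fun x => Metric.ball x (r x / 4))
    fun x hx => Metric.ball_mem_nhds x (by have := hr x hx; positivity)
  obtain ⟨M₀, hM₀⟩ := (S.image M).exists_le
  obtain ⟨R₀, hR₀⟩ := (S.image fun x => (r x / 4)⁻¹).exists_le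
  set ρ : ℝ := (max R₀ 1)⁻¹ with hρ
  have hρ0 : 0 < ρ := by positivity
  have hρr : ∀ i ∈ S, ρ ≤ r i / 4 := by
    intro i hi
    have h1 := hR₀ _ (Finset.mem_image_of_mem _ hi)
    have h2 := hr i (hS i hi)
    rw [hρ, inv_le_comm₀ (by positivity) (by positivity)]
    exact h1.trans (le_max_left _ _)
  refine ⟨⟨S, fun i => Metric.ball i (r i / 2), n, ψ, max M₀ 1, ρ, le_max_right _ _, hρ0,
    fun i _ => Metric.isOpen_ball, fun i hi => hn i (hS i hi), fun i hi => hadd i (hS i hi),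
    fun i hi y z => ?_, fun i hi x hx y hy => ?_, fun x hx hxd => ?_⟩⟩
  · refine (hlip i (hS i hi) y z).trans ?_
    gcongr
    exact (hM₀ _ (Finset.mem_image_of_mem _ hi)).trans (le_max_left _ _)
  · refine hmem i (hS i hi) y ?_
    rw [Metric.mem_ball, dist_eq_norm] at hx
    have h2 := hr i (hS i hi)
    have := norm_add_le (y - x) (x - i)
    rw [sub_add_sub_cancel] at this
    linarith [hρr i hi]
  · obtain ⟨z, hz, hxz⟩ := exists_mem_frontier_infDist_compl_eq_dist hx huniv
    obtain ⟨i, hi, hzi⟩ := mem_iUnion₂.mp (hcov hz)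
    refine ⟨i, hi, ?_⟩
    rw [Metric.mem_ball] at hzi ⊢
    have := dist_triangle x z i
    linarith [hρr i hi]

namespace BoundaryCharts

variable {d : ℕ} {Ω : Set (Sp d)} (K : BoundaryCharts Ω)

/-- The interior ball condition: every point of `Ω` is within distance `2 M r` of the centre of a
ball of radius `r` contained in `Ω`. -/
theorem exists_closedBall_subset {x : Sp d} (hx : x ∈ Ω) {r : ℝ} (hr : 0 < r)
    (hr' : r ≤ K.ρ / (4 * K.M)) :
    ∃ c, Metric.closedBall c r ⊆ Ω ∧ ‖x - c‖ ≤ 2 * K.M * r := by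
  have hM := K.one_le_M
  have hMr : 4 * (K.M * r) ≤ K.ρ := by
    rw [le_div_iff₀ (by positivity)] at hr'
    linarith
  have hrM : r ≤ K.M * r := by nlinarith
  rcases lt_or_ge (Metric.infDist x Ωᶜ) K.ρ with h | h
  · obtain ⟨i, hi, hxi⟩ := K.cover x hx h
    refine ⟨x + (2 * K.M * r) • K.n i, fun y hy => ?_, ?_⟩
    · rw [Metric.mem_closedBall, dist_eq_norm] at hy
      have hψx : 0 < K.ψ i x := (K.mem_iff i hi x hxi x (by simpa using K.ρ_pos)).mp hx
      have h1 := K.abs_ψ_sub_le i hi y (x + (2 * K.M * r) • K.n i)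
      rw [K.ψ_add i hi] at h1
      have h2 : K.M * ‖y - (x + (2 * K.M * r) • K.n i)‖ ≤ K.M * r := by gcongr
      have h3 := (abs_le.mp (h1.trans h2)).1
      refine (K.mem_iff i hi x hxi y ?_).mpr (by nlinarith)
      have h4 := norm_add_le (y - (x + (2 * K.M * r) • K.n i)) ((2 * K.M * r) • K.n i)
      rw [show y - (x + (2 * K.M * r) • K.n i) + (2 * K.M * r) • K.n i = y - x by abel, norm_smul,
        K.norm_n i hi, mul_one, Real.norm_eq_abs, abs_of_pos (by positivity)] at h4
      have := K.ρ_pos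
      nlinarith
    · rw [sub_add_cancel_left, norm_neg, norm_smul, K.norm_n i hi, mul_one, Real.norm_eq_abs,
        abs_of_pos (by positivity)]
  · refine ⟨x, fun y hy => ?_, by simp; positivity⟩
    by_contra hyΩ
    have h1 := Metric.infDist_le_dist_of_mem (x := x) (show y ∈ Ωᶜ from hyΩ)
    rw [Metric.mem_closedBall, dist_comm] at hy
    nlinarith [K.ρ_pos]

/-- The part of `Ω` within distance `t` of the complement. -/
def layer {d : ℕ} (Ω : Set (Sp d)) (t : ℝ) : Set (Sp d) := {x ∈ Ω | Metric.infDist x Ωᶜ ≤ t}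

theorem measurableSet_layer (hΩ : IsOpen Ω) (t : ℝ) : MeasurableSet (layer Ω t) :=
  hΩ.measurableSet.inter
    (isClosed_le (Metric.continuous_infDist_pt _) continuous_const).measurableSet

/-- A layer of height `t` occupies heights at most `M t`, so that its translates by multiples of `M t`
in the inward direction are disjoint. -/
theorem height_mem_Ioc (hΩ : IsOpen Ω) (huniv : Ω ≠ univ) {i : Sp d} (hi : i ∈ K.S) {x : Sp d}
    {t : ℝ} (hx : x ∈ layer Ω t) (hxi : x ∈ K.U i) (ht : t < K.ρ) :
    K.ψ i x ∈ Ioc 0 (K.M * t) := by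
  refine ⟨(K.mem_iff i hi x hxi x (by simpa using K.ρ_pos)).mp hx.1, ?_⟩
  obtain ⟨z, hz, hxz⟩ := hΩ.isClosed_compl.exists_infDist_eq_dist (nonempty_compl.2 huniv) x
  have hzx : ‖z - x‖ ≤ t := by
    rw [← dist_eq_norm, dist_comm, ← hxz]; exact hx.2
  have h1 : ¬ 0 < K.ψ i z := fun h => hz ((K.mem_iff i hi x hxi z (hzx.trans_lt ht)).mpr h)
  have h2 := (abs_le.mp (K.abs_ψ_sub_le i hi z x)).1
  have h3 : K.M * ‖z - x‖ ≤ K.M * t := by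
    have := K.one_le_M
    gcongr
  linarith

/-- Inward translates of a boundary layer, perturbed by a vector `τ` shorter than the height of the
layer, remain in `Ω`. -/
theorem shift_mem_layer {i : Sp d} (hi : i ∈ K.S) {x τ : Sp d} {t : ℝ} {N k : ℕ} (ht : 0 < t)
    (hx : x ∈ layer Ω t) (hxi : x ∈ K.U i) (hN : (N + 2) * (K.M * t) ≤ K.ρ) (hτ : ‖τ‖ < t)
    (hk1 : 1 ≤ k) (hk : k ≤ N) :
    x + (τ + (k * (K.M * t)) • K.n i) ∈ layer Ω ((N + 2) * (K.M * t)) := by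
  have hM := K.one_le_M
  have hMt : 0 < K.M * t := by positivity
  have htM : t ≤ K.M * t := by nlinarith
  have hk1' : (1 : ℝ) ≤ k := by exact_mod_cast hk1
  have hk' : (k : ℝ) ≤ N := by exact_mod_cast hk
  have hv : ‖τ + (k * (K.M * t)) • K.n i‖ ≤ (N + 1) * (K.M * t) := by
    refine (norm_add_le _ _).trans ?_
    rw [norm_smul, K.norm_n i hi, mul_one, Real.norm_eq_abs, abs_of_nonneg (by positivity)]
    nlinarith
  refine ⟨(K.mem_iff i hi x hxi _ ?_).mpr ?_, ?_⟩
  · rw [add_sub_cancel_left]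
    nlinarith
  · have hψx : 0 < K.ψ i x := (K.mem_iff i hi x hxi x (by simpa using K.ρ_pos)).mp hx.1
    rw [← add_assoc, K.ψ_add i hi]
    have h1 := (abs_le.mp (K.abs_ψ_sub_le i hi (x + τ) x)).1
    rw [add_sub_cancel_left] at h1
    have h2 : K.M * ‖τ‖ ≤ K.M * t := by gcongr
    nlinarith
  · have h1 := Metric.infDist_le_infDist_add_dist (s := Ωᶜ)
      (x := x + (τ + (k * (K.M * t)) • K.n i)) (y := x)
    rw [dist_eq_norm, add_sub_cancel_left] at h1
    have := hx.2
    linarith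

end BoundaryCharts

/-! ### The mass of a function on a boundary layer -/

theorem ofReal_sq_le_two_mul (a b : ℝ) :
    ENNReal.ofReal (a ^ 2) ≤ 2 * ENNReal.ofReal (b ^ 2) + 2 * ENNReal.ofReal ((a - b) ^ 2) := by
  rw [← ENNReal.ofReal_ofNat, ← ENNReal.ofReal_mul (by norm_num), ← ENNReal.ofReal_mul (by norm_num),
    ← ENNReal.ofReal_add (by positivity) (by positivity)]
  refine ENNReal.ofReal_le_ofReal ?_
  nlinarith [sq_nonneg (a - 2 * b)]

theorem lintegral_biUnion_finset_le {X ι : Type*} [MeasurableSpace X] {μ : Measure X}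
    (S : Finset ι) (t : ι → Set X) (f : X → ℝ≥0∞) :
    ∫⁻ x in ⋃ i ∈ S, t i, f x ∂μ ≤ ∑ i ∈ S, ∫⁻ x in t i, f x ∂μ := by
  classical
  induction S using Finset.induction_on with
  | empty => simp
  | insert i S hi ih =>
    rw [Finset.set_biUnion_insert, Finset.sum_insert hi]
    exact (lintegral_union_le _ _ _).trans (by gcongr)

namespace BoundaryCharts

variable {d : ℕ} {Ω : Set (Sp d)} (K : BoundaryCharts Ω)

/-- The inward translates of a boundary layer by multiples of its height are disjoint, so that the
mass of `f` on the layer, averaged over these translates, is at most `1 / N` times the mass on a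
layer which is about `N` times thicker. -/
theorem sum_lintegral_shift_le (hΩ : IsOpen Ω) (huniv : Ω ≠ univ) {i : Sp d} (hi : i ∈ K.S)
    {t : ℝ} (ht : 0 < t) {N : ℕ} (hN : (N + 2) * (K.M * t) ≤ K.ρ) {τ : Sp d} (hτ : ‖τ‖ < t)
    {f : Sp d → ℝ≥0∞} (hf : Measurable f) :
    ∑ k ∈ Finset.Icc 1 N, ∫⁻ x in layer Ω t ∩ K.U i, f (x + (τ + (k * (K.M * t)) • K.n i)) ≤
      ∫⁻ y in layer Ω ((N + 2) * (K.M * t)), f y := by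
  have hM := K.one_le_M
  have hMt : 0 < K.M * t := by positivity
  have hA : MeasurableSet (layer Ω t ∩ K.U i) :=
    (measurableSet_layer hΩ t).inter (K.isOpen_U i hi).measurableSet
  have htρ : t < K.ρ := by nlinarith [(Nat.cast_nonneg N : (0 : ℝ) ≤ N)]
  set v : ℕ → Sp d := fun k => τ + (k * (K.M * t)) • K.n i with hv
  have h1 : ∀ k ∈ Finset.Icc 1 N, ∫⁻ x in layer Ω t ∩ K.U i, f (x + v k) =
      ∫⁻ y, (layer Ω t ∩ K.U i).indicator (fun _ => f y) (y - v k) := by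
    intro k _
    rw [← lintegral_indicator hA, ← lintegral_sub_right_eq_self _ (v k)]
    refine lintegral_congr fun y => ?_
    simp only [indicator]
    simp
  rw [Finset.sum_congr rfl h1, ← lintegral_finsetSum']
  · rw [← lintegral_indicator (measurableSet_layer hΩ _)]
    refine lintegral_mono fun y => ?_
    by_cases hex : ∃ k ∈ Finset.Icc 1 N, y - v k ∈ layer Ω t ∩ K.U i
    · obtain ⟨k, hk, hyk⟩ := hex
      have hyL : y ∈ layer Ω ((N + 2) * (K.M * t)) := by
        have := K.shift_mem_layer hi ht hyk.1 hyk.2 hN hτ (Finset.mem_Icc.mp hk).1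
          (Finset.mem_Icc.mp hk).2
        simpa [hv] using this
      rw [indicator_of_mem hyL, Finset.sum_eq_single_of_mem k hk]
      · exact indicator_le_self' (fun _ _ => zero_le) _
      · intro l _ hlk
        refine indicator_of_notMem (fun hyl => hlk ?_) _
        have hψ : ∀ j, K.ψ i (y - v j) = K.ψ i (y - τ) - j * (K.M * t) := by
          intro j
          have := K.ψ_add i hi (y - v j) (j * (K.M * t))
          rw [show y - v j + (j * (K.M * t)) • K.n i = y - τ by rw [hv]; simp; abel] at this
          linarith
        have h2 := K.height_mem_Ioc hΩ huniv hi hyk.1 hyk.2 htρ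
        have h3 := K.height_mem_Ioc hΩ huniv hi hyl.1 hyl.2 htρ
        rw [hψ] at h2 h3
        have h4 : ((l : ℝ) - k) * (K.M * t) < 1 * (K.M * t) := by linarith [h2.2, h3.1]
        have h5 : ((k : ℝ) - l) * (K.M * t) < 1 * (K.M * t) := by linarith [h3.2, h2.1]
        have h6 := lt_of_mul_lt_mul_right h4 hMt.le
        have h7 := lt_of_mul_lt_mul_right h5 hMt.le
        have h8 : (l : ℝ) < k + 1 := by linarith
        have h9 : (k : ℝ) < l + 1 := by linarith
        have h8' : l < k + 1 := by exact_mod_cast h8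
        have h9' : k < l + 1 := by exact_mod_cast h9
        omega
    · push Not at hex
      rw [Finset.sum_eq_zero fun k hk => indicator_of_notMem (hex k hk) _]
      exact zero_le
  · intro k _
    refine Measurable.aemeasurable ?_
    simp only [indicator]
    exact Measurable.ite (hA.preimage (measurable_id.sub_const _)) hf measurable_const

/-- The mass of `w²` on a boundary layer of height `t`, in one chart. The comparison with the
translates of the layer is averaged over perturbations `τ` of the translation with `|τ| < t`, which
turns differences along a fixed direction into a double integral of differences. -/
theorem lintegral_layer_inter_le (hΩ : IsOpen Ω) (huniv : Ω ≠ univ) {i : Sp d} (hi : i ∈ K.S)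
    {t : ℝ} (ht : 0 < t) {N : ℕ} (hN1 : 1 ≤ N) (hN : (N + 2) * (K.M * t) ≤ K.ρ) {w : Sp d → ℝ}
    (hw : Measurable w) :
    ∫⁻ x in layer Ω t ∩ K.U i, ENNReal.ofReal (w x ^ 2) ≤
      2 / N * (∫⁻ x in layer Ω ((N + 2) * (K.M * t)), ENNReal.ofReal (w x ^ 2)) +
      2 / volume (Metric.ball (0 : Sp d) t) *
        ∫⁻ x in Ω, ∫⁻ y in Ω, (Metric.ball x ((N + 2) * (K.M * t))).indicator
          (fun y => ENNReal.ofReal ((w x - w y) ^ 2)) y := by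
  set A := layer Ω t ∩ K.U i with hAdef
  set R := (N + 2) * (K.M * t) with hR
  set F := ∫⁻ x in layer Ω R, ENNReal.ofReal (w x ^ 2) with hF
  set I := ∫⁻ x in A, ENNReal.ofReal (w x ^ 2) with hI
  set G := ∫⁻ x in Ω, ∫⁻ y in Ω, (Metric.ball x R).indicator
          (fun y => ENNReal.ofReal ((w x - w y) ^ 2)) y with hG
  have hM := K.one_le_M
  have hMt : 0 < K.M * t := by positivity
  have hA : MeasurableSet A :=
    (measurableSet_layer hΩ t).inter (K.isOpen_U i hi).measurableSet
  set v : ℕ → Sp d → Sp d := fun k τ => τ + (k * (K.M * t)) • K.n i with hv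
  set D : ℕ → Sp d → ℝ≥0∞ := fun k τ =>
    ∫⁻ x in A, ENNReal.ofReal ((w x - w (x + v k τ)) ^ 2) with hD
  have hmeas : ∀ k, Measurable fun p : Sp d × Sp d =>
      ENNReal.ofReal ((w p.2 - w (p.2 + v k p.1)) ^ 2) := by
    intro k
    have : Measurable fun p : Sp d × Sp d => p.2 + v k p.1 := by
      simp only [hv]; fun_prop
    exact (((hw.comp measurable_snd).sub (hw.comp this)).pow_const 2).ennreal_ofReal
  have hDm : ∀ k, Measurable (D k) := fun k => (hmeas k).lintegral_prod_right'
  -- the estimate for one small perturbation `τ` of the translations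
  have hstep : ∀ τ, ‖τ‖ < t → N * I ≤ 2 * F + 2 * ∑ k ∈ Finset.Icc 1 N, D k τ := by
    intro τ hτ
    have h1 : ∀ k ∈ Finset.Icc 1 N, I ≤
        2 * (∫⁻ x in A, ENNReal.ofReal (w (x + v k τ) ^ 2)) + 2 * D k τ := by
      intro k _
      have hmx : Measurable fun x => w (x + v k τ) := hw.comp (measurable_id.add_const _)
      rw [hI, hD]
      simp only
      have hmx' : Measurable fun x => w x - w (x + v k τ) := hw.sub hmx
      rw [← lintegral_const_mul _ (hmx.pow_const 2).ennreal_ofReal,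
        ← lintegral_const_mul _ (hmx'.pow_const 2).ennreal_ofReal,
        ← lintegral_add_left ((hmx.pow_const 2).ennreal_ofReal.const_mul 2)]
      exact lintegral_mono fun x => ofReal_sq_le_two_mul _ _
    have h2 := Finset.sum_le_sum h1
    rw [Finset.sum_const, Nat.card_Icc, Nat.add_sub_cancel, nsmul_eq_mul, Finset.sum_add_distrib,
      ← Finset.mul_sum, ← Finset.mul_sum] at h2
    refine h2.trans ?_
    gcongr
    exact K.sum_lintegral_shift_le hΩ huniv hi ht hN hτ (hw.pow_const 2).ennreal_ofReal
  -- averaging over `τ` turns the differences into a double integral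
  have hDint : ∀ k ∈ Finset.Icc 1 N, ∫⁻ τ in Metric.ball 0 t, D k τ ≤ G := by
    intro k hk
    obtain ⟨hk1, hkN⟩ := Finset.mem_Icc.mp hk
    rw [hD]
    simp only
    rw [lintegral_lintegral_swap (hmeas k).aemeasurable]
    have hAΩ : A ⊆ Ω := fun x hx => hx.1.1
    refine le_trans ?_ (lintegral_mono_set hAΩ)
    refine setLIntegral_mono' hA fun x hx => ?_
    rw [← lintegral_indicator measurableSet_ball, ← lintegral_indicator hΩ.measurableSet]
    refine le_trans ?_ (lintegral_add_right_eq_self (Ω.indicator _)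
      (x + (k * (K.M * t)) • K.n i)).le
    refine lintegral_mono fun τ => ?_
    by_cases hτ : τ ∈ Metric.ball 0 t
    · rw [mem_ball_zero_iff] at hτ
      have hmem := K.shift_mem_layer hi ht hx.1 hx.2 hN hτ hk1 hkN
      have heq : τ + (x + (k * (K.M * t)) • K.n i) = x + v k τ := by simp only [hv]; abel
      rw [heq, indicator_of_mem (by rwa [mem_ball_zero_iff]), indicator_of_mem hmem.1,
        indicator_of_mem]
      rw [Metric.mem_ball, dist_eq_norm, add_sub_cancel_left]
      refine (norm_add_le _ _).trans_lt ?_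
      rw [norm_smul, K.norm_n i hi, mul_one, Real.norm_eq_abs, abs_of_nonneg (by positivity)]
      have hk' : (k : ℝ) ≤ N := by exact_mod_cast hkN
      nlinarith
    · rw [indicator_of_notMem hτ]
      exact zero_le
  set V := volume (Metric.ball (0 : Sp d) t) with hV
  have hV0 : V ≠ 0 := (Metric.measure_ball_pos _ _ ht).ne'
  have hVt : V ≠ ⊤ := measure_ball_lt_top.ne
  have hN0 : (N : ℝ≥0∞) ≠ 0 := by exact_mod_cast (by omega : N ≠ 0)
  have hNt : (N : ℝ≥0∞) ≠ ⊤ := ENNReal.natCast_ne_top N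
  have havg : V * (N * I) ≤ 2 * F * V + 2 * (N * G) := by
    calc V * (N * I) = ∫⁻ _τ in Metric.ball (0 : Sp d) t, N * I := by
          rw [setLIntegral_const, mul_comm]
      _ ≤ ∫⁻ τ in Metric.ball (0 : Sp d) t, (2 * F + 2 * ∑ k ∈ Finset.Icc 1 N, D k τ) :=
          setLIntegral_mono' measurableSet_ball fun τ hτ =>
            hstep τ (by rwa [mem_ball_zero_iff] at hτ)
      _ = 2 * F * V + 2 * ∑ k ∈ Finset.Icc 1 N, ∫⁻ τ in Metric.ball (0 : Sp d) t, D k τ := by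
          rw [lintegral_add_left measurable_const, setLIntegral_const, lintegral_const_mul,
            lintegral_finsetSum]
          · exact fun k _ => hDm k
          · exact Finset.measurable_sum _ fun k _ => hDm k
      _ ≤ 2 * F * V + 2 * (N * G) := by
          gcongr
          refine (Finset.sum_le_sum hDint).trans ?_
          simp
  have hVN : V * N ≠ 0 := mul_ne_zero hV0 hN0
  have hVNt : V * N ≠ ⊤ := ENNReal.mul_ne_top hVt hNt
  rw [← mul_assoc, mul_comm, ← ENNReal.le_div_iff_mul_le (Or.inl hVN) (Or.inl hVNt)] at havg
  refine havg.trans (le_of_eq ?_)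
  rw [ENNReal.add_div]
  congr 1
  · rw [mul_comm V, ENNReal.mul_div_mul_right _ _ hV0 hVt, ENNReal.mul_div_right_comm]
  · rw [mul_comm (N : ℝ≥0∞), ← mul_assoc, ENNReal.mul_div_mul_right _ _ hN0 hNt,
      ENNReal.mul_div_right_comm]

/-- The mass of `w²` on a boundary layer: up to differences of `w` at comparable distances, it is a
small fraction of the mass on a thicker layer. -/
theorem lintegral_layer_le (hΩ : IsOpen Ω) (huniv : Ω ≠ univ)
    {t : ℝ} (ht : 0 < t) {N : ℕ} (hN1 : 1 ≤ N) (hN : (N + 2) * (K.M * t) ≤ K.ρ) {w : Sp d → ℝ}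
    (hw : Measurable w) :
    ∫⁻ x in layer Ω t, ENNReal.ofReal (w x ^ 2) ≤
      K.S.card * (2 / N) * (∫⁻ x in layer Ω ((N + 2) * (K.M * t)), ENNReal.ofReal (w x ^ 2)) +
      K.S.card * (2 / volume (Metric.ball (0 : Sp d) t)) *
        ∫⁻ x in Ω, ∫⁻ y in Ω, (Metric.ball x ((N + 2) * (K.M * t))).indicator
          (fun y => ENNReal.ofReal ((w x - w y) ^ 2)) y := by
  have hM := K.one_le_M
  have htρ : t < K.ρ := by
    have hMt : 0 < K.M * t := by positivity
    nlinarith [(Nat.cast_nonneg N : (0 : ℝ) ≤ N)]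
  have hcov : layer Ω t ⊆ ⋃ i ∈ K.S, layer Ω t ∩ K.U i := by
    intro x hx
    obtain ⟨i, hi, hxi⟩ := K.cover x hx.1 (hx.2.trans_lt htρ)
    exact mem_iUnion₂.mpr ⟨i, hi, hx, hxi⟩
  calc _ ≤ ∑ i ∈ K.S, ∫⁻ x in layer Ω t ∩ K.U i, ENNReal.ofReal (w x ^ 2) :=
        (lintegral_mono_set hcov).trans (lintegral_biUnion_finset_le _ _ _)
    _ ≤ _ := Finset.sum_le_sum fun i hi =>
      K.lintegral_layer_inter_le hΩ huniv hi ht hN1 hN hw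
    _ = _ := by
      rw [Finset.sum_const, nsmul_eq_mul, mul_add, mul_assoc, mul_assoc]

end BoundaryCharts

/-! ### The fractional Hardy inequality -/

/-- Absorption: a sequence which is at most half of its predecessor `m` steps before, up to a
summable error, is summable. -/
theorem tsum_le_of_le_half_add {b c : ℕ → ℝ≥0∞} {n m : ℕ} (hb : ∀ i, b i ≠ ⊤)
    (h : ∀ i, n ≤ i → b (i + m) ≤ b i / 2 + c (i + m)) :
    ∑' i, b i ≤ 2 * (∑ i ∈ Finset.range (n + m), b i + ∑' i, c i) := by
  refine ENNReal.tsum_le_of_sum_range_le fun J => ?_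
  set S := ∑ i ∈ Finset.range (n + m + J), b i with hS
  have hSt : S ≠ ⊤ := ENNReal.sum_ne_top.mpr fun i _ => hb i
  have h1 : S ≤ ∑ i ∈ Finset.range (n + m), b i + (S / 2 + ∑' i, c i) := by
    conv_lhs => rw [hS, Finset.sum_range_add]
    gcongr
    calc ∑ i ∈ Finset.range J, b (n + m + i)
        ≤ ∑ i ∈ Finset.range J, (b (n + i) / 2 + c (n + i + m)) := by
          refine Finset.sum_le_sum fun i _ => ?_
          have := h (n + i) (Nat.le_add_right _ _)
          rwa [show n + m + i = n + i + m by ring]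
      _ = (∑ i ∈ Finset.range J, b (n + i)) / 2 + ∑ i ∈ Finset.range J, c (n + i + m) := by
          rw [Finset.sum_add_distrib]
          simp only [div_eq_mul_inv, Finset.sum_mul]
      _ ≤ S / 2 + ∑' i, c i := by
          gcongr
          · rw [hS, show n + m + J = n + (J + m) by ring, Finset.sum_range_add _ n]
            refine le_trans ?_ le_add_self
            exact Finset.sum_le_sum_of_subset (Finset.range_mono (Nat.le_add_right _ _))
          · refine (ENNReal.sum_le_tsum _).trans ?_
            refine ENNReal.tsum_comp_le_tsum_of_injective (f := fun i => n + i + m) ?_ c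
            intro i j hij
            simpa using hij
  have h2 : S / 2 ≤ ∑ i ∈ Finset.range (n + m), b i + ∑' i, c i := by
    have h3 : S / 2 ≠ ⊤ := ENNReal.div_ne_top hSt (by norm_num)
    have h4 : S / 2 + S / 2 ≤ ∑ i ∈ Finset.range (n + m), b i + ∑' i, c i + S / 2 := by
      rw [ENNReal.add_halves, add_assoc, add_comm (∑' i, c i)]
      exact h1
    exact (ENNReal.add_le_add_iff_right h3).mp h4
  calc ∑ i ∈ Finset.range J, b i ≤ S :=
        Finset.sum_le_sum_of_subset (Finset.range_mono (Nat.le_add_left _ _))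
    _ = 2 * (S / 2) := (ENNReal.mul_div_cancel (by norm_num) (by norm_num)).symm
    _ ≤ _ := by gcongr

/-- A geometric sum truncated at `2 ^ j < T` is of the order of its last term. -/
theorem tsum_ite_two_pow_lt_le {β T : ℝ} (hβ : 0 < β) (hT : 0 < T) :
    ∑' j : ℕ, (if (2 : ℝ) ^ j < T then ENNReal.ofReal ((2 ^ β) ^ j) else 0) ≤
      ENNReal.ofReal (2 ^ β / (2 ^ β - 1) * T ^ β) := by
  set q : ℝ := 2 ^ β with hq
  have hq1 : 1 < q := Real.one_lt_rpow (by norm_num) hβ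
  have hq1' : 0 < q - 1 := by linarith
  refine ENNReal.tsum_le_of_sum_range_le fun n => ?_
  have key : ∑ j ∈ Finset.range n, (if (2 : ℝ) ^ j < T then q ^ j else 0) ≤ q / (q - 1) * T ^ β ∧
      ∑ j ∈ Finset.range n, (if (2 : ℝ) ^ j < T then q ^ j else 0) ≤ q ^ n / (q - 1) := by
    induction n with
    | zero => simp only [Finset.range_zero, Finset.sum_empty]; exact ⟨by positivity, by positivity⟩
    | succ n ih =>
      rw [Finset.sum_range_succ]
      have hle : ∑ j ∈ Finset.range n, (if (2 : ℝ) ^ j < T then q ^ j else 0) + q ^ n ≤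
          q ^ (n + 1) / (q - 1) := by
        have h1 := ih.2
        rw [le_div_iff₀ hq1'] at h1 ⊢
        rw [pow_succ]
        linarith
      split_ifs with h
      · refine ⟨hle.trans ?_, hle⟩
        have h2 : q ^ n ≤ T ^ β := by
          rw [hq, ← Real.rpow_natCast, ← Real.rpow_mul (by norm_num), mul_comm,
            Real.rpow_mul (by norm_num), Real.rpow_natCast]
          gcongr
        rw [pow_succ, mul_div_assoc, mul_comm]
        gcongr
      · rw [add_zero]
        refine ⟨ih.1, ?_⟩
        have : (0 : ℝ) ≤ q ^ n := by positivity
        linarith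
  calc ∑ j ∈ Finset.range n, (if (2 : ℝ) ^ j < T then ENNReal.ofReal (q ^ j) else 0)
      = ENNReal.ofReal (∑ j ∈ Finset.range n, (if (2 : ℝ) ^ j < T then q ^ j else 0)) := by
        rw [ENNReal.ofReal_sum_of_nonneg]
        · refine Finset.sum_congr rfl fun j _ => ?_
          split_ifs <;> simp
        · intro j _
          split_ifs <;> positivity
    _ ≤ _ := ENNReal.ofReal_le_ofReal key.1

theorem measurable_ball_indicator_sq {d : ℕ} {w : Sp d → ℝ} (hw : Measurable w) (R : ℝ) :
    Measurable fun p : Sp d × Sp d =>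
      (Metric.ball p.1 R).indicator (fun y => ENNReal.ofReal ((w p.1 - w y) ^ 2)) p.2 := by
  have hset : MeasurableSet {p : Sp d × Sp d | dist p.2 p.1 < R} :=
    measurableSet_lt (measurable_snd.dist measurable_fst) measurable_const
  have hfun : Measurable fun p : Sp d × Sp d => ENNReal.ofReal ((w p.1 - w p.2) ^ 2) :=
    (((hw.comp measurable_fst).sub (hw.comp measurable_snd)).pow_const 2).ennreal_ofReal
  exact hfun.indicator hset

theorem measurable_ball_indicator_sq_right {d : ℕ} {w : Sp d → ℝ} (hw : Measurable w) (R : ℝ)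
    (x : Sp d) :
    Measurable fun y =>
      (Metric.ball x R).indicator (fun y => ENNReal.ofReal ((w x - w y) ^ 2)) y :=
  ((hw.const_sub (w x)).pow_const 2).ennreal_ofReal.indicator measurableSet_ball

/-- Differences at scales `2 ^ m / 2 ^ j`, weighted and summed over `j`, are controlled by the
Gagliardo seminorm. -/
theorem tsum_mul_lintegral_ball_le {d : ℕ} {Ω : Set (Sp d)} {α : ℝ}
    (hα0 : 0 < α) (m : ℕ) {w : Sp d → ℝ} (hw : Measurable w) :
    ∑' j : ℕ, ENNReal.ofReal ((2 ^ ((d : ℝ) + α)) ^ j) *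
      (∫⁻ x in Ω, ∫⁻ y in Ω, (Metric.ball x (2 ^ m * (1 / 2) ^ j)).indicator
        (fun y => ENNReal.ofReal ((w x - w y) ^ 2)) y) ≤
    ENNReal.ofReal (2 ^ ((d : ℝ) + α) / (2 ^ ((d : ℝ) + α) - 1) * (2 ^ m) ^ ((d : ℝ) + α)) *
      gagliardoSq Ω (α / 2) w := by
  set β : ℝ := (d : ℝ) + α with hβ
  have hβ0 : 0 < β := by positivity
  have hq1 : (1 : ℝ) < 2 ^ β := Real.one_lt_rpow (by norm_num) hβ0
  have hq1' : (0 : ℝ) < 2 ^ β - 1 := by linarith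
  set g : ℕ → Sp d → Sp d → ℝ≥0∞ := fun j x y => ENNReal.ofReal ((2 ^ β) ^ j) *
    (Metric.ball x (2 ^ m * (1 / 2) ^ j)).indicator
        (fun y => ENNReal.ofReal ((w x - w y) ^ 2)) y with hg
  have hind := fun j : ℕ => measurable_ball_indicator_sq hw (2 ^ m * (1 / 2) ^ j)
  have hindx := fun (j : ℕ) (x : Sp d) =>
    measurable_ball_indicator_sq_right hw (2 ^ m * (1 / 2) ^ j) x
  have h1 : ∀ j : ℕ, ENNReal.ofReal ((2 ^ β) ^ j) *
      (∫⁻ x in Ω, ∫⁻ y in Ω, (Metric.ball x (2 ^ m * (1 / 2) ^ j)).indicator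
        (fun y => ENNReal.ofReal ((w x - w y) ^ 2)) y) = ∫⁻ x in Ω, ∫⁻ y in Ω, g j x y := by
    intro j
    rw [← lintegral_const_mul _ (hind j).lintegral_prod_right']
    refine lintegral_congr fun x => ?_
    rw [← lintegral_const_mul _ (hindx j x)]
  have hgm : ∀ j, Measurable fun x => ∫⁻ y in Ω, g j x y :=
    fun j => ((hind j).const_mul _).lintegral_prod_right'
  have hgmx : ∀ j x, Measurable fun y => g j x y := fun j x => (hindx j x).const_mul _
  rw [tsum_congr h1, ← lintegral_tsum fun j => (hgm j).aemeasurable, gagliardoSq,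
    ← lintegral_const_mul' _ _ ENNReal.ofReal_ne_top]
  refine lintegral_mono fun x => ?_
  simp only
  rw [← lintegral_tsum fun j => (hgmx j x).aemeasurable,
    ← lintegral_const_mul' _ _ ENNReal.ofReal_ne_top]
  refine lintegral_mono fun y => ?_
  simp only [hg]
  rcases eq_or_ne x y with rfl | hxy
  · simp [indicator]
  · have hδ : 0 < ‖x - y‖ := norm_pos_iff.mpr (sub_ne_zero.mpr hxy)
    have h2 : ∀ j : ℕ, ENNReal.ofReal ((2 ^ β) ^ j) *
        (Metric.ball x (2 ^ m * (1 / 2) ^ j)).indicator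
          (fun y => ENNReal.ofReal ((w x - w y) ^ 2)) y =
        (if (2 : ℝ) ^ j < 2 ^ m / ‖x - y‖ then ENNReal.ofReal ((2 ^ β) ^ j) else 0) *
          ENNReal.ofReal ((w x - w y) ^ 2) := by
      intro j
      have : y ∈ Metric.ball x (2 ^ m * (1 / 2) ^ j) ↔ (2 : ℝ) ^ j < 2 ^ m / ‖x - y‖ := by
        rw [Metric.mem_ball, dist_comm, dist_eq_norm, lt_div_iff₀ hδ, one_div, inv_pow,
          ← div_eq_mul_inv, lt_div_iff₀ (by positivity), mul_comm]
      simp only [indicator, this]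
      split_ifs <;> simp
    rw [tsum_congr h2, ENNReal.tsum_mul_right]
    refine (mul_le_mul_left (tsum_ite_two_pow_lt_le hβ0 (by positivity)) _).trans ?_
    rw [← ENNReal.ofReal_mul (by positivity), ← ENNReal.ofReal_mul (by positivity)]
    refine ENNReal.ofReal_le_ofReal (le_of_eq ?_)
    rw [Real.div_rpow (by positivity) (by positivity), show (d : ℝ) + 2 * (α / 2) = β by
      rw [hβ]; ring]
    field_simp

namespace BoundaryCharts

variable {d : ℕ} {Ω : Set (Sp d)}

/-- The mass of `w²` on the dyadic boundary layers is summable against the weights `2 ^ (α j)`. The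
estimate for one layer loses a factor `2 ^ (α m)` and gains a factor `2 ^ m`, so that it can be
absorbed for large `m` because `α < 1`. -/
theorem exists_tsum_layer_le (K : BoundaryCharts Ω) (hΩ : IsOpen Ω) (huniv : Ω ≠ univ) {α : ℝ}
    (hα0 : 0 < α) (hα1 : α < 1) :
    ∃ C : ℝ≥0∞, C ≠ ⊤ ∧ ∀ w : Sp d → ℝ, Measurable w →
      ∫⁻ x in Ω, ENNReal.ofReal (w x ^ 2) ≠ ⊤ →
      ∑' j : ℕ, ENNReal.ofReal ((2 ^ α) ^ j) *
        (∫⁻ x in layer Ω ((1 / 2) ^ j), ENNReal.ofReal (w x ^ 2)) ≤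
      C * ((∫⁻ x in Ω, ENNReal.ofReal (w x ^ 2)) + gagliardoSq Ω (α / 2) w) := by
  have hM := K.one_le_M
  set κ : ℝ := (K.S.card : ℝ) with hκ
  obtain ⟨μ, hμ⟩ := pow_unbounded_of_one_lt K.M (by norm_num : (1 : ℝ) < 2)
  set lam : ℝ := 2 ^ α with hlam
  have hlam0 : 0 < lam := by positivity
  have hlam2 : lam / 2 < 1 := by
    rw [div_lt_one two_pos, hlam]
    calc (2 : ℝ) ^ α < 2 ^ (1 : ℝ) := Real.rpow_lt_rpow_of_exponent_lt (by norm_num) hα1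
      _ = 2 := Real.rpow_one 2
  obtain ⟨n, hn⟩ : ∃ n : ℕ, κ * 2 * lam ^ (2 + μ) * (lam / 2) ^ n ≤ 1 / 2 := by
    obtain ⟨n, hn⟩ := exists_pow_lt_of_lt_one
      (show 0 < 1 / 2 / (κ * 2 * lam ^ (2 + μ) + 1) by positivity) hlam2
    refine ⟨n, ?_⟩
    rw [lt_div_iff₀ (by positivity)] at hn
    have : 0 < (lam / 2) ^ n := by positivity
    nlinarith
  -- `N` translates, and a layer thicker by the factor `2 ^ m ≥ (N + 2) M`
  set N : ℕ := 2 ^ (n + 1) with hN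
  set m : ℕ := n + 2 + μ with hm
  have hN1 : 1 ≤ N := Nat.one_le_two_pow
  have hNr : (N : ℝ) = 2 ^ (n + 1) := by rw [hN]; push_cast; rfl
  have hNM : ((N : ℝ) + 2) * K.M ≤ 2 ^ m := by
    have h1 : (2 : ℝ) ≤ 2 ^ (n + 1) := by
      rw [pow_succ]
      have : (1 : ℝ) ≤ 2 ^ n := one_le_pow₀ (by norm_num)
      linarith
    calc ((N : ℝ) + 2) * K.M ≤ (2 ^ (n + 1) + 2 ^ (n + 1)) * 2 ^ μ := by rw [hNr]; gcongr
      _ = 2 ^ m := by rw [hm]; ring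
  obtain ⟨n₀, hn₀⟩ := exists_pow_lt_of_lt_one K.ρ_pos (by norm_num : (1 / 2 : ℝ) < 1)
  set V₁ := volume (Metric.ball (0 : Sp d) 1) with hV₁
  have hV₁0 : V₁ ≠ 0 := (Metric.measure_ball_pos _ _ one_pos).ne'
  have hV₁t : V₁ ≠ ⊤ := measure_ball_lt_top.ne
  set D : ℝ≥0∞ := K.S.card * (2 / V₁) with hD
  have hDt : D ≠ ⊤ := ENNReal.mul_ne_top (ENNReal.natCast_ne_top _)
    (ENNReal.div_ne_top (by norm_num) hV₁0)
  set E : ℝ≥0∞ := ENNReal.ofReal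
    (2 ^ ((d : ℝ) + α) / (2 ^ ((d : ℝ) + α) - 1) * (2 ^ m) ^ ((d : ℝ) + α)) with hE
  set B : ℝ≥0∞ := ∑ j ∈ Finset.range (n₀ + m), ENNReal.ofReal (lam ^ j) with hB
  have hBt : B ≠ ⊤ := ENNReal.sum_ne_top.mpr fun _ _ => ENNReal.ofReal_ne_top
  refine ⟨2 * (B + D * E), ENNReal.mul_ne_top (by norm_num) (ENNReal.add_ne_top.mpr
    ⟨hBt, ENNReal.mul_ne_top hDt ENNReal.ofReal_ne_top⟩), fun w hw hwt => ?_⟩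
  set W := ∫⁻ x in Ω, ENNReal.ofReal (w x ^ 2) with hW
  have hsub : ∀ t, layer Ω t ⊆ Ω := fun t x hx => hx.1
  set F : ℝ → ℝ≥0∞ := fun t => ∫⁻ x in layer Ω t, ENNReal.ofReal (w x ^ 2) with hF
  have hFW : ∀ t, F t ≤ W := fun t => lintegral_mono_set (hsub t)
  set G : ℕ → ℝ≥0∞ := fun j => ∫⁻ x in Ω, ∫⁻ y in Ω,
    (Metric.ball x (2 ^ m * (1 / 2) ^ j)).indicator
        (fun y => ENNReal.ofReal ((w x - w y) ^ 2)) y with hG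
  set c : ℕ → ℝ≥0∞ := fun j => D * (ENNReal.ofReal ((2 ^ ((d : ℝ) + α)) ^ j) * G j) with hc
  have hcsum : ∑' j, c j ≤ D * (E * gagliardoSq Ω (α / 2) w) := by
    rw [hc, ENNReal.tsum_mul_left]
    gcongr
    exact tsum_mul_lintegral_ball_le hα0 m hw
  have hrec : ∀ i, n₀ ≤ i → ENNReal.ofReal (lam ^ (i + m)) * F ((1 / 2) ^ (i + m)) ≤
      ENNReal.ofReal (lam ^ i) * F ((1 / 2) ^ i) / 2 + c (i + m) := by
    intro i hi
    set t : ℝ := (1 / 2) ^ (i + m) with ht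
    have ht0 : 0 < t := by positivity
    have ht2 : 2 ^ m * t = (1 / 2) ^ i := by
      rw [ht, pow_add _ i, mul_left_comm, ← mul_pow]; norm_num
    have hR : (N + 2) * (K.M * t) ≤ 2 ^ m * t := by
      rw [← mul_assoc]; gcongr
    have hRρ : (N + 2) * (K.M * t) ≤ K.ρ := by
      refine hR.trans ?_
      rw [ht2]
      exact (pow_le_pow_of_le_one (by norm_num) (by norm_num) hi).trans hn₀.le
    have hmain := K.lintegral_layer_le hΩ huniv ht0 hN1 hRρ hw
    have hF2 : (∫⁻ x in layer Ω ((N + 2) * (K.M * t)), ENNReal.ofReal (w x ^ 2)) ≤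
        F ((1 / 2) ^ i) := by
      refine lintegral_mono_set fun x hx => ⟨hx.1, hx.2.trans ?_⟩
      rw [← ht2]; exact hR
    have hG2 : (∫⁻ x in Ω, ∫⁻ y in Ω, (Metric.ball x ((N + 2) * (K.M * t))).indicator
          (fun y => ENNReal.ofReal ((w x - w y) ^ 2)) y) ≤ G (i + m) := by
      refine lintegral_mono fun x => lintegral_mono fun y => ?_
      exact indicator_le_indicator_of_subset (Metric.ball_subset_ball hR) (fun _ => zero_le) y
    have hball : volume (Metric.ball (0 : Sp d) t) = ENNReal.ofReal (t ^ d) * V₁ := by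
      rw [Measure.addHaar_ball_of_pos _ _ ht0]
      simp [hV₁]
    have hθ : ENNReal.ofReal (lam ^ (i + m)) * (K.S.card * (2 / N)) ≤
        ENNReal.ofReal (lam ^ i) / 2 := by
      have e1 : (K.S.card : ℝ≥0∞) * (2 / N) = ENNReal.ofReal (κ * (2 / N)) := by
        rw [ENNReal.ofReal_mul (by positivity), ENNReal.ofReal_div_of_pos (by positivity), hκ,
          ENNReal.ofReal_natCast, ENNReal.ofReal_natCast, ENNReal.ofReal_ofNat]
      have e2 : ENNReal.ofReal (lam ^ i) / 2 = ENNReal.ofReal (lam ^ i / 2) := by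
        rw [ENNReal.ofReal_div_of_pos two_pos, ENNReal.ofReal_ofNat]
      rw [e1, e2, ← ENNReal.ofReal_mul (by positivity)]
      refine ENNReal.ofReal_le_ofReal ?_
      calc lam ^ (i + m) * (κ * (2 / N))
          = lam ^ i * (κ * 2 * lam ^ (2 + μ) * (lam / 2) ^ n) / 2 := by
            rw [hNr, hm, div_pow]
            field_simp
            ring
        _ ≤ lam ^ i * (1 / 2) / 2 := by gcongr
        _ ≤ lam ^ i / 2 := by
            have : 0 < lam ^ i := by positivity
            linarith
    have hqq : ENNReal.ofReal (lam ^ (i + m)) *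
        (K.S.card * (2 / volume (Metric.ball (0 : Sp d) t))) =
        D * ENNReal.ofReal ((2 ^ ((d : ℝ) + α)) ^ (i + m)) := by
      have e1 : ENNReal.ofReal ((2 ^ ((d : ℝ) + α)) ^ (i + m)) =
          ENNReal.ofReal (lam ^ (i + m)) * (ENNReal.ofReal (t ^ d))⁻¹ := by
        rw [← ENNReal.ofReal_inv_of_pos (by positivity), ← ENNReal.ofReal_mul (by positivity)]
        congr 1
        rw [Real.rpow_add two_pos, Real.rpow_natCast, mul_pow, ht, mul_comm, one_div, inv_pow,
          inv_pow, inv_inv, ← pow_mul, ← pow_mul, mul_comm d]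
      rw [e1, hball, hD, div_eq_mul_inv, div_eq_mul_inv,
        ENNReal.mul_inv (Or.inr hV₁t) (Or.inr hV₁0)]
      ring
    calc ENNReal.ofReal (lam ^ (i + m)) * F t
        ≤ ENNReal.ofReal (lam ^ (i + m)) * (K.S.card * (2 / N) * F ((1 / 2) ^ i) +
          K.S.card * (2 / volume (Metric.ball (0 : Sp d) t)) * G (i + m)) := by
          gcongr
          refine hmain.trans ?_
          gcongr
      _ = ENNReal.ofReal (lam ^ (i + m)) * (K.S.card * (2 / N)) * F ((1 / 2) ^ i) +
          ENNReal.ofReal (lam ^ (i + m)) *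
            (K.S.card * (2 / volume (Metric.ball (0 : Sp d) t))) * G (i + m) := by ring
      _ ≤ ENNReal.ofReal (lam ^ i) / 2 * F ((1 / 2) ^ i) +
          D * ENNReal.ofReal ((2 ^ ((d : ℝ) + α)) ^ (i + m)) * G (i + m) := by
          rw [hqq]
          gcongr
      _ = ENNReal.ofReal (lam ^ i) * F ((1 / 2) ^ i) / 2 + c (i + m) := by
          rw [hc, ENNReal.mul_div_right_comm, mul_assoc D]
  have habs := tsum_le_of_le_half_add (b := fun j => ENNReal.ofReal (lam ^ j) * F ((1 / 2) ^ j))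
    (c := c) (n := n₀) (m := m)
    (fun j => ENNReal.mul_ne_top ENNReal.ofReal_ne_top (ne_top_of_le_ne_top hwt (hFW _))) hrec
  refine habs.trans ?_
  rw [mul_assoc]
  gcongr
  calc _ ≤ B * W + D * (E * gagliardoSq Ω (α / 2) w) := by
        gcongr
        rw [hB, Finset.sum_mul]
        exact Finset.sum_le_sum fun j _ => by gcongr; exact hFW _
    _ ≤ (B + D * E) * (W + gagliardoSq Ω (α / 2) w) := by
        rw [mul_add, add_mul, add_mul, ← mul_assoc D]
        refine add_le_add le_self_add le_add_self

/-- The **fractional Hardy inequality** of order `α / 2 < 1 / 2` on a Lipschitz domain. No boundary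
values are imposed on `w`. -/
theorem exists_hardy (K : BoundaryCharts Ω) (hΩ : IsOpen Ω) (huniv : Ω ≠ univ) {α : ℝ}
    (hα0 : 0 < α) (hα1 : α < 1) :
    ∃ C : ℝ≥0∞, C ≠ ⊤ ∧ ∀ w : Sp d → ℝ, Measurable w →
      ∫⁻ x in Ω, ENNReal.ofReal (w x ^ 2) ≠ ⊤ →
      ∫⁻ x in Ω, ENNReal.ofReal (w x ^ 2) * ENNReal.ofReal (Metric.infDist x Ωᶜ ^ (-α)) ≤
      C * ((∫⁻ x in Ω, ENNReal.ofReal (w x ^ 2)) + gagliardoSq Ω (α / 2) w) := by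
  obtain ⟨C, hC, hCw⟩ := K.exists_tsum_layer_le hΩ huniv hα0 hα1
  set lam : ℝ := 2 ^ α with hlam
  have hlam0 : 0 < lam := by positivity
  refine ⟨1 + ENNReal.ofReal lam * C, ENNReal.add_ne_top.mpr ⟨ENNReal.one_ne_top,
    ENNReal.mul_ne_top ENNReal.ofReal_ne_top hC⟩, fun w hw hwt => ?_⟩
  have hwm : Measurable fun x => ENNReal.ofReal (w x ^ 2) := (hw.pow_const 2).ennreal_ofReal
  have hpt : ∀ x ∈ Ω, ENNReal.ofReal (Metric.infDist x Ωᶜ ^ (-α)) ≤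
      1 + ENNReal.ofReal lam * ∑' j : ℕ, ENNReal.ofReal (lam ^ j) *
        (layer Ω ((1 / 2) ^ j)).indicator 1 x := by
    intro x hx
    set δ := Metric.infDist x Ωᶜ with hδ
    have hδ0 : 0 < δ := (hΩ.isClosed_compl.notMem_iff_infDist_pos (nonempty_compl.2 huniv)).mp
      (fun h => h hx)
    rcases le_or_gt 1 δ with h1 | h1
    · refine le_trans ?_ le_self_add
      rw [← ENNReal.ofReal_one]
      exact ENNReal.ofReal_le_ofReal (Real.rpow_le_one_of_one_le_of_nonpos h1 (by linarith))
    · refine le_trans ?_ le_add_self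
      obtain ⟨j, hj1, hj2⟩ := exists_nat_pow_near_of_lt_one hδ0 h1.le
        (by norm_num : (0 : ℝ) < 1 / 2) (by norm_num)
      refine le_trans ?_ (mul_le_mul_right (ENNReal.le_tsum j) _)
      rw [indicator_of_mem (show x ∈ layer Ω ((1 / 2) ^ j) from ⟨hx, hj2⟩), Pi.one_apply, mul_one,
        ← ENNReal.ofReal_mul hlam0.le, ← pow_succ']
      refine ENNReal.ofReal_le_ofReal ?_
      calc δ ^ (-α) ≤ ((1 / 2 : ℝ) ^ (j + 1)) ^ (-α) :=
            Real.rpow_le_rpow_of_nonpos (by positivity) hj1.le (by linarith)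
        _ = lam ^ (j + 1) := by
            rw [one_div, inv_pow, Real.inv_rpow (by positivity), Real.rpow_neg (by positivity),
              inv_inv, hlam, ← Real.rpow_natCast, ← Real.rpow_natCast,
              ← Real.rpow_mul (by norm_num), ← Real.rpow_mul (by norm_num), mul_comm]
  calc _ ≤ ∫⁻ x in Ω, (ENNReal.ofReal (w x ^ 2) + ENNReal.ofReal lam * ∑' j : ℕ,
          ENNReal.ofReal (lam ^ j) *
            (layer Ω ((1 / 2) ^ j)).indicator (fun x => ENNReal.ofReal (w x ^ 2)) x) := by
        refine setLIntegral_mono' hΩ.measurableSet fun x hx => ?_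
        refine (mul_le_mul_right (hpt x hx) _).trans (le_of_eq ?_)
        rw [mul_add, mul_one, mul_left_comm, ← ENNReal.tsum_mul_left]
        congr 3
        funext j
        by_cases hxj : x ∈ layer Ω ((1 / 2) ^ j)
        · rw [indicator_of_mem hxj, indicator_of_mem hxj, Pi.one_apply, mul_one, mul_comm]
        · rw [indicator_of_notMem hxj, indicator_of_notMem hxj, mul_zero, mul_zero]
    _ = (∫⁻ x in Ω, ENNReal.ofReal (w x ^ 2)) + ENNReal.ofReal lam * ∑' j : ℕ,
          ENNReal.ofReal (lam ^ j) * (∫⁻ x in layer Ω ((1 / 2) ^ j), ENNReal.ofReal (w x ^ 2)) := by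
        rw [lintegral_add_left hwm, lintegral_const_mul' _ _ ENNReal.ofReal_ne_top, lintegral_tsum]
        · congr 3
          funext j
          rw [lintegral_const_mul' _ _ ENNReal.ofReal_ne_top,
            lintegral_indicator (measurableSet_layer hΩ _),
            Measure.restrict_restrict (measurableSet_layer hΩ _),
            inter_eq_left.mpr fun x hx => hx.1]
        · exact fun j => ((hwm.indicator (measurableSet_layer hΩ _)).const_mul _).aemeasurable
    _ ≤ (∫⁻ x in Ω, ENNReal.ofReal (w x ^ 2)) + ENNReal.ofReal lam *
          (C * ((∫⁻ x in Ω, ENNReal.ofReal (w x ^ 2)) + gagliardoSq Ω (α / 2) w)) := by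
        gcongr
        exact hCw w hw hwt
    _ ≤ _ := by
        rw [add_mul, one_mul, ← mul_assoc]
        gcongr
        exact le_self_add

end BoundaryCharts

/-! ### Sobolev spaces of order less than one -/

theorem multiDeriv_zero {d : ℕ} (φ : Sp d → ℝ) : multiDeriv 0 φ = φ := by
  simp [multiDeriv]

theorem hasWeakDeriv_zero {d : ℕ} (Ω : Set (Sp d)) (v : Sp d → ℝ) : HasWeakDeriv Ω 0 v v := by
  intro φ _ _ _
  simp [multiDeriv_zero]

/-- A weak derivative of order zero is the function itself, by the fundamental lemma of the calculus
of variations. -/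
theorem HasWeakDeriv.ae_eq_of_zero {d : ℕ} {Ω : Set (Sp d)} (hΩ : IsOpen Ω) {v g : Sp d → ℝ}
    (hv : MemLp v 2 (volume.restrict Ω)) (hg : MemLp g 2 (volume.restrict Ω))
    (h : HasWeakDeriv Ω 0 v g) : g =ᵐ[volume.restrict Ω] v := by
  have hgv : LocallyIntegrableOn (g - v) Ω volume :=
    locallyIntegrableOn_of_locallyIntegrable_restrict ((hg.sub hv).locallyIntegrable one_le_two)
  have h0 := hΩ.ae_eq_zero_of_integral_contDiff_smul_eq_zero (f := g - v) hgv fun φ hφ hc hs => by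
    have hφ0 : ∀ x ∉ Ω, φ x = 0 := fun x hx => by
      by_contra hne
      exact hx (hs (subset_tsupport _ hne))
    have hmem : MemLp φ 2 (volume.restrict Ω) :=
      (hφ.continuous.memLp_of_hasCompactSupport hc).restrict Ω
    have key := h φ hφ hc hs
    rw [multiDeriv_zero] at key
    simp only [Pi.zero_apply, Finset.sum_const_zero, pow_zero, one_mul] at key
    rw [← setIntegral_eq_integral_of_forall_compl_eq_zero (s := Ω)
      (fun x hx => by simp [hφ0 x hx])]
    have i1 : Integrable (fun x => g x * φ x) (volume.restrict Ω) := hg.integrable_mul hmem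
    have i2 : Integrable (fun x => v x * φ x) (volume.restrict Ω) := hv.integrable_mul hmem
    have : ∀ x, φ x • (g - v) x = g x * φ x - v x * φ x := fun x => by
      simp only [smul_eq_mul, Pi.sub_apply]; ring
    simp only [this]
    rw [integral_sub i1 i2, key, sub_self]
  have h1 : ∀ᵐ x ∂(volume.restrict Ω), x ∈ Ω := ae_restrict_mem hΩ.measurableSet
  filter_upwards [ae_restrict_of_ae h0, h1] with x hx hx'
  have := hx hx'
  simp only [Pi.sub_apply] at this
  linarith

theorem gagliardoSq_congr {d : ℕ} {Ω : Set (Sp d)} {σ : ℝ} {v w : Sp d → ℝ}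
    (h : v =ᵐ[volume.restrict Ω] w) : gagliardoSq Ω σ v = gagliardoSq Ω σ w := by
  refine lintegral_congr_ae ?_
  filter_upwards [h] with x hx
  refine lintegral_congr_ae ?_
  filter_upwards [h] with y hy
  rw [hx, hy]

theorem eLpNorm_two_sq {X : Type*} [MeasurableSpace X] (μ : Measure X) (v : X → ℝ) :
    eLpNorm v 2 μ ^ 2 = ∫⁻ x, ENNReal.ofReal (v x ^ 2) ∂μ := by
  have := eLpNorm_nnreal_pow_eq_lintegral (μ := μ) (f := v) (p := 2) two_ne_zero
  have e : ((2 : ℝ≥0) : ℝ≥0∞) = 2 := rfl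
  rw [e] at this
  have h2 : ((2 : ℝ≥0) : ℝ) = (2 : ℕ) := by norm_num
  rw [h2, ENNReal.rpow_natCast] at this
  rw [this]
  refine lintegral_congr fun x => ?_
  rw [ENNReal.rpow_natCast, ← ofReal_norm, ← ENNReal.ofReal_pow (norm_nonneg _),
    Real.norm_eq_abs, sq_abs]

/-- The squared norm of `H^σ(Ω)`, `0 < σ < 1`, for functions in `L²(Ω)`. -/
noncomputable def energySq {d : ℕ} (Ω : Set (Sp d)) (σ : ℝ) (v : Sp d → ℝ) : ℝ≥0∞ :=
  (∫⁻ x in Ω, ENNReal.ofReal (v x ^ 2)) + gagliardoSq Ω σ v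

theorem energySq_congr {d : ℕ} {Ω : Set (Sp d)} {σ : ℝ} {v w : Sp d → ℝ}
    (h : v =ᵐ[volume.restrict Ω] w) : energySq Ω σ v = energySq Ω σ w := by
  rw [energySq, energySq, gagliardoSq_congr h]
  congr 1
  refine lintegral_congr_ae ?_
  filter_upwards [h] with x hx
  rw [hx]

theorem sobolevNorm_eq {d : ℕ} {Ω : Set (Sp d)} (hΩ : IsOpen Ω) {σ : ℝ} (h0 : 0 < σ) (h1 : σ < 1)
    {v : Sp d → ℝ} (hv : MemLp v 2 (volume.restrict Ω)) :
    sobolevNorm Ω σ v = energySq Ω σ v ^ (1 / 2 : ℝ) := by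
  have hfl : ⌊σ⌋₊ = 0 := Nat.floor_eq_zero.mpr h1
  have hfr : Int.fract σ = σ := Int.fract_eq_self.mpr ⟨h0.le, h1⟩
  have key : ∀ g : (Fin d → ℕ) → Sp d → ℝ, g 0 =ᵐ[volume.restrict Ω] v →
      ((∑ k ∈ Finset.range (⌊σ⌋₊ + 1), ∑ β ∈ Finset.piAntidiag Finset.univ k,
          eLpNorm (g β) 2 (volume.restrict Ω) ^ 2) +
        (if Int.fract σ = 0 then 0 else
          ∑ β ∈ Finset.piAntidiag Finset.univ ⌊σ⌋₊, gagliardoSq Ω (Int.fract σ) (g β))) =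
      energySq Ω σ v := by
    intro g hg
    rw [← energySq_congr hg, hfl, hfr, if_neg h0.ne']
    simp only [zero_add, Finset.range_one, Finset.sum_singleton, Finset.piAntidiag_zero,
      eLpNorm_two_sq, energySq]
  refine le_antisymm ?_ ?_
  · refine iInf₂_le_of_le (fun _ => v) ⟨hv, fun β hβ => ?_⟩ ?_
    · have hβ0 : β = 0 := by
        rw [hfl] at hβ
        ext i
        exact Nat.le_zero.mp ((Finset.single_le_sum (f := β) (fun _ _ => Nat.zero_le _)
          (Finset.mem_univ i)).trans hβ)
      exact ⟨hv, hβ0 ▸ hasWeakDeriv_zero Ω v⟩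
    · rw [key _ Filter.EventuallyEq.rfl]
  · refine le_iInf₂ fun g hg => ?_
    obtain ⟨hg1, hg2⟩ := hg.2 0 (by simp)
    rw [key g (hg2.ae_eq_of_zero hΩ hv hg1)]

/-- The energy space: `v ∈ L²(Ω)` with finite Gagliardo seminorm. -/
structure FiniteEnergy {d : ℕ} (Ω : Set (Sp d)) (σ : ℝ) (v : Sp d → ℝ) : Prop where
  memLp : MemLp v 2 (volume.restrict Ω)
  gagliardoSq_lt_top : gagliardoSq Ω σ v < ⊤

theorem MemSobolev.memLp {d : ℕ} {Ω : Set (Sp d)} {s : ℝ} {v : Sp d → ℝ}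
    (h : MemSobolev Ω s v) : MemLp v 2 (volume.restrict Ω) := by
  by_contra hv
  have : sobolevNorm Ω s v = ⊤ := by
    rw [sobolevNorm]
    simp [hv]
  exact absurd h (by simp [MemSobolev, this])

theorem lintegral_sq_lt_top {d : ℕ} {Ω : Set (Sp d)} {v : Sp d → ℝ}
    (hv : MemLp v 2 (volume.restrict Ω)) : ∫⁻ x in Ω, ENNReal.ofReal (v x ^ 2) < ⊤ := by
  rw [← eLpNorm_two_sq]
  exact ENNReal.pow_lt_top hv.2

theorem memSobolev_iff {d : ℕ} {Ω : Set (Sp d)} (hΩ : IsOpen Ω) {σ : ℝ} (h0 : 0 < σ) (h1 : σ < 1)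
    {v : Sp d → ℝ} : MemSobolev Ω σ v ↔ FiniteEnergy Ω σ v := by
  constructor
  · intro h
    have hv := h.memLp
    refine ⟨hv, ?_⟩
    rw [MemSobolev, sobolevNorm_eq hΩ h0 h1 hv, ENNReal.rpow_lt_top_iff_of_pos (by norm_num)] at h
    exact lt_of_le_of_lt le_add_self h
  · intro h
    rw [MemSobolev, sobolevNorm_eq hΩ h0 h1 h.memLp, ENNReal.rpow_lt_top_iff_of_pos (by norm_num)]
    exact ENNReal.add_lt_top.mpr ⟨lintegral_sq_lt_top h.memLp, h.gagliardoSq_lt_top⟩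

theorem FiniteEnergy.energySq_lt_top {d : ℕ} {Ω : Set (Sp d)} {σ : ℝ} {v : Sp d → ℝ}
    (h : FiniteEnergy Ω σ v) : energySq Ω σ v < ⊤ :=
  ENNReal.add_lt_top.mpr ⟨lintegral_sq_lt_top h.memLp, h.gagliardoSq_lt_top⟩

/-- The normalized difference `(v(x) - v(y)) / |x - y|^{d/2+σ}`, whose `L²(Ω × Ω)` norm is the
Gagliardo seminorm. -/
noncomputable def diffQuot {d : ℕ} (σ : ℝ) (v : Sp d → ℝ) (p : Sp d × Sp d) : ℝ :=
  (v p.1 - v p.2) / ‖p.1 - p.2‖ ^ ((d : ℝ) / 2 + σ)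

theorem diffQuot_mul {d : ℕ} (σ : ℝ) (u v : Sp d → ℝ) (p : Sp d × Sp d) :
    diffQuot σ u p * diffQuot σ v p =
      (u p.1 - u p.2) * (v p.1 - v p.2) / ‖p.1 - p.2‖ ^ ((d : ℝ) + 2 * σ) := by
  by_cases hp : p.1 = p.2
  · simp [diffQuot, hp]
  · have : 0 < ‖p.1 - p.2‖ := norm_sub_pos_iff.mpr hp
    rw [diffQuot, diffQuot, div_mul_div_comm, ← Real.rpow_add this]
    congr 2
    ring

theorem diffQuot_add {d : ℕ} (σ : ℝ) (u v : Sp d → ℝ) :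
    diffQuot σ (u + v) = diffQuot σ u + diffQuot σ v := by
  ext p
  simp only [diffQuot, Pi.add_apply]
  ring

theorem diffQuot_smul {d : ℕ} (σ a : ℝ) (v : Sp d → ℝ) :
    diffQuot σ (a • v) = a • diffQuot σ v := by
  ext p
  simp only [diffQuot, Pi.smul_apply, smul_eq_mul]
  ring

theorem aestronglyMeasurable_diffQuot {d : ℕ} {Ω : Set (Sp d)} (σ : ℝ) {v : Sp d → ℝ}
    (hv : AEStronglyMeasurable v (volume.restrict Ω)) :
    AEStronglyMeasurable (diffQuot σ v)
      ((volume.restrict Ω).prod (volume.restrict Ω)) := by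
  have h1 : Measurable fun p : Sp d × Sp d => ‖p.1 - p.2‖ ^ ((d : ℝ) / 2 + σ) := by fun_prop
  have h2 := (hv.comp_fst (ν := volume.restrict Ω)).sub (hv.comp_snd (μ := volume.restrict Ω))
  exact (h2.aemeasurable.div h1.aemeasurable).aestronglyMeasurable

theorem eLpNorm_diffQuot_sq {d : ℕ} {Ω : Set (Sp d)} (σ : ℝ) {v : Sp d → ℝ}
    (hv : AEStronglyMeasurable v (volume.restrict Ω)) :
    eLpNorm (diffQuot σ v) 2 ((volume.restrict Ω).prod (volume.restrict Ω)) ^ 2 =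
      gagliardoSq Ω σ v := by
  rw [eLpNorm_two_sq, lintegral_prod _
    ((aestronglyMeasurable_diffQuot σ hv).aemeasurable.pow_const 2).ennreal_ofReal, gagliardoSq]
  refine lintegral_congr fun x => lintegral_congr fun y => ?_
  rw [sq, diffQuot_mul, ← sq]

theorem FiniteEnergy.memLp_diffQuot {d : ℕ} {Ω : Set (Sp d)} {σ : ℝ} {v : Sp d → ℝ}
    (h : FiniteEnergy Ω σ v) :
    MemLp (diffQuot σ v) 2 ((volume.restrict Ω).prod (volume.restrict Ω)) := by
  refine ⟨aestronglyMeasurable_diffQuot σ h.memLp.1, ?_⟩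
  have := eLpNorm_diffQuot_sq σ h.memLp.1
  by_contra hc
  rw [not_lt, top_le_iff] at hc
  rw [hc, ENNReal.top_pow two_ne_zero] at this
  exact h.gagliardoSq_lt_top.ne this.symm

theorem finiteEnergy_of_memLp_diffQuot {d : ℕ} {Ω : Set (Sp d)} {σ : ℝ} {v : Sp d → ℝ}
    (hv : MemLp v 2 (volume.restrict Ω))
    (h : MemLp (diffQuot σ v) 2 ((volume.restrict Ω).prod (volume.restrict Ω))) :
    FiniteEnergy Ω σ v :=
  ⟨hv, by rw [← eLpNorm_diffQuot_sq σ hv.1]; exact ENNReal.pow_lt_top h.2⟩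

theorem FiniteEnergy.add {d : ℕ} {Ω : Set (Sp d)} {σ : ℝ} {u v : Sp d → ℝ}
    (hu : FiniteEnergy Ω σ u) (hv : FiniteEnergy Ω σ v) : FiniteEnergy Ω σ (u + v) :=
  finiteEnergy_of_memLp_diffQuot (hu.memLp.add hv.memLp)
    (diffQuot_add σ u v ▸ hu.memLp_diffQuot.add hv.memLp_diffQuot)

theorem FiniteEnergy.smul {d : ℕ} {Ω : Set (Sp d)} {σ : ℝ} {v : Sp d → ℝ}
    (hv : FiniteEnergy Ω σ v) (a : ℝ) : FiniteEnergy Ω σ (a • v) :=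
  finiteEnergy_of_memLp_diffQuot (hv.memLp.const_smul a)
    (diffQuot_smul σ a v ▸ hv.memLp_diffQuot.const_smul a)

theorem FiniteEnergy.sub {d : ℕ} {Ω : Set (Sp d)} {σ : ℝ} {u v : Sp d → ℝ}
    (hu : FiniteEnergy Ω σ u) (hv : FiniteEnergy Ω σ v) : FiniteEnergy Ω σ (u - v) := by
  have := hu.add (hv.smul (-1))
  rwa [neg_one_smul, ← sub_eq_add_neg] at this

/-! ### The exterior potential -/

/-- The integral `∫_{Ω^c} |x - y|^{-d-α} dy`, with values in `[0, ∞]`. -/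
noncomputable def extPotential {d : ℕ} (Ω : Set (Sp d)) (α : ℝ) (x : Sp d) : ℝ≥0∞ :=
  ∫⁻ y in Ωᶜ, ENNReal.ofReal (1 / ‖x - y‖ ^ ((d : ℝ) + α))

theorem measurable_extPotential {d : ℕ} (Ω : Set (Sp d)) (α : ℝ) :
    Measurable (extPotential Ω α) := by
  have : Measurable fun p : Sp d × Sp d =>
      ENNReal.ofReal (1 / ‖p.1 - p.2‖ ^ ((d : ℝ) + α)) := by fun_prop
  exact this.lintegral_prod_right'

theorem lintegral_comp_smul {d : ℕ} {F : Sp d → ℝ≥0∞} (hF : Measurable F) {r : ℝ} (hr : 0 < r) :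
    ∫⁻ z, F (r • z) = ENNReal.ofReal (r ^ (-(d : ℝ))) * ∫⁻ z, F z := by
  have h := Measure.map_addHaar_smul (volume : Measure (Sp d)) hr.ne'
  rw [← lintegral_map hF (measurable_const_smul r), h, lintegral_smul_measure, smul_eq_mul]
  congr 2
  rw [finrank_euclideanSpace_fin, Real.rpow_neg hr.le, Real.rpow_natCast,
    abs_of_pos (inv_pos.mpr (pow_pos hr d))]

/-- On the complement of the ball of radius `δ = dist(x, Ω^c)` the kernel is at most a multiple of
`δ^{-d-α} (1 + |(x - y) / δ|)^{-d-α}`, whose integral scales like `δ^{-α}`. -/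
theorem exists_extPotential_le {d : ℕ} {Ω : Set (Sp d)} (hΩ : IsOpen Ω) {α : ℝ} (hα0 : 0 < α) :
    ∃ C : ℝ, 0 ≤ C ∧ ∀ x, 0 < Metric.infDist x Ωᶜ →
      extPotential Ω α x ≤ ENNReal.ofReal (C * Metric.infDist x Ωᶜ ^ (-α)) := by
  set p : ℝ := d + α with hp
  have hp0 : 0 < p := by positivity
  have hJ : ∫⁻ z : Sp d, ENNReal.ofReal ((1 + ‖z‖) ^ (-p)) < ⊤ :=
    finite_integral_one_add_norm (by rw [finrank_euclideanSpace_fin]; linarith)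
  set J := ∫⁻ z : Sp d, ENNReal.ofReal ((1 + ‖z‖) ^ (-p)) with hJd
  refine ⟨2 ^ p * J.toReal, by positivity, fun x hx => ?_⟩
  set δ := Metric.infDist x Ωᶜ with hδ
  have hpt : ∀ y ∈ Ωᶜ, ENNReal.ofReal (1 / ‖x - y‖ ^ p) ≤
      ENNReal.ofReal (δ ^ (-p) * 2 ^ p) * ENNReal.ofReal ((1 + ‖δ⁻¹ • (x - y)‖) ^ (-p)) := by
    intro y hy
    have hle : δ ≤ ‖x - y‖ := by
      rw [← dist_eq_norm]; exact Metric.infDist_le_dist_of_mem hy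
    rw [← ENNReal.ofReal_mul (by positivity)]
    refine ENNReal.ofReal_le_ofReal ?_
    rw [norm_smul, norm_inv, Real.norm_of_nonneg hx.le]
    have hpos : 0 < ‖x - y‖ := hx.trans_le hle
    rw [one_div, ← Real.rpow_neg hpos.le, Real.rpow_neg hx.le, Real.rpow_neg hpos.le,
      Real.rpow_neg (by positivity), ← Real.inv_rpow (by positivity), ← Real.inv_rpow hx.le,
      ← Real.inv_rpow (by positivity), ← Real.mul_rpow (by positivity) (by positivity),
      ← Real.mul_rpow (by positivity) (by positivity)]
    refine Real.rpow_le_rpow (by positivity) ?_ hp0.le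
    have e : δ⁻¹ * 2 * (1 + δ⁻¹ * ‖x - y‖)⁻¹ = 2 / (δ + ‖x - y‖) := by
      field_simp
    rw [e, inv_eq_one_div, div_le_div_iff₀ hpos (by positivity)]
    linarith
  have hF : Measurable fun z : Sp d => ENNReal.ofReal ((1 + ‖z‖) ^ (-p)) := by fun_prop
  calc extPotential Ω α x
      ≤ ∫⁻ y in Ωᶜ, ENNReal.ofReal (δ ^ (-p) * 2 ^ p) *
          ENNReal.ofReal ((1 + ‖δ⁻¹ • (x - y)‖) ^ (-p)) :=
        setLIntegral_mono' hΩ.measurableSet.compl hpt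
    _ ≤ ∫⁻ y, ENNReal.ofReal (δ ^ (-p) * 2 ^ p) *
          ENNReal.ofReal ((1 + ‖δ⁻¹ • (x - y)‖) ^ (-p)) := setLIntegral_le_lintegral _ _
    _ = ENNReal.ofReal (δ ^ (-p) * 2 ^ p) *
          (ENNReal.ofReal (δ⁻¹ ^ (-(d : ℝ))) * J) := by
        rw [lintegral_const_mul _ (by fun_prop),
          lintegral_sub_left_eq_self (fun z : Sp d =>
            ENNReal.ofReal ((1 + ‖δ⁻¹ • z‖) ^ (-p))) x,
          lintegral_comp_smul hF (inv_pos.mpr hx)]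
    _ = ENNReal.ofReal (2 ^ p * J.toReal * δ ^ (-α)) := by
        rw [← ENNReal.ofReal_toReal hJ.ne, ← ENNReal.ofReal_mul (by positivity),
          ← ENNReal.ofReal_mul (by positivity)]
        congr 1
        rw [Real.inv_rpow hx.le, Real.rpow_neg hx.le (d : ℝ), inv_inv,
          show -α = -p + d by rw [hp]; ring, Real.rpow_add hx, ENNReal.toReal_ofReal (by positivity)]
        ring

theorem fracConst_pos {d : ℕ} {α : ℝ} (hα0 : 0 < α) (hα1 : α < 1) : 0 < fracConst d α := by
  -- `-α / 2` is not a pole, where the junk value `0` would make the constant vanish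
  have h1 : Real.Gamma (-α / 2) ≠ 0 := by
    refine Real.Gamma_ne_zero fun m hm => ?_
    rcases Nat.eq_zero_or_pos m with rfl | h
    · simp at hm; linarith
    · have : (1 : ℝ) ≤ m := by exact_mod_cast h
      linarith
  have h2 := Real.Gamma_pos_of_pos (s := (α + d) / 2) (by positivity)
  have := abs_pos.mpr h1
  rw [fracConst]
  positivity

theorem rho_eq {d : ℕ} (Ω : Set (Sp d)) (α : ℝ) (x : Sp d) :
    rho Ω α x = fracConst d α * (extPotential Ω α x).toReal := by
  rw [rho, extPotential, integral_eq_lintegral_of_nonneg_ae (ae_of_all _ fun y => by positivity)]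
  have : Measurable fun y : Sp d => 1 / ‖x - y‖ ^ ((d : ℝ) + α) := by fun_prop
  exact this.aestronglyMeasurable

theorem rho_nonneg {d : ℕ} {Ω : Set (Sp d)} {α : ℝ} (hα0 : 0 < α) (hα1 : α < 1) (x : Sp d) :
    0 ≤ rho Ω α x := by
  rw [rho_eq]
  exact mul_nonneg (fracConst_pos hα0 hα1).le ENNReal.toReal_nonneg

theorem measurable_rho {d : ℕ} (Ω : Set (Sp d)) (α : ℝ) : Measurable (rho Ω α) := by
  have : rho Ω α = fun x => fracConst d α * (extPotential Ω α x).toReal := funext (rho_eq Ω α)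
  rw [this]
  exact (measurable_extPotential Ω α).ennreal_toReal.const_mul _

/-- The exterior potential of a bounded set is bounded below on the set, since the complement
contains a ball at bounded distance. -/
theorem exists_le_extPotential {d : ℕ} (hd : 0 < d) {Ω : Set (Sp d)} (hb : Bornology.IsBounded Ω)
    {α : ℝ} (hα0 : 0 < α) : ∃ c : ℝ≥0∞, c ≠ 0 ∧ ∀ x ∈ Ω, c ≤ extPotential Ω α x := by
  obtain ⟨R, hR0, hR⟩ := hb.exists_pos_norm_le
  have : Nonempty (Fin d) := ⟨⟨0, hd⟩⟩
  obtain ⟨y₀, hy₀⟩ : ∃ y : Sp d, ‖y‖ = R + 2 := by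
    refine ⟨EuclideanSpace.single ⟨0, hd⟩ (R + 2), ?_⟩
    rw [PiLp.norm_single, Real.norm_eq_abs]
    exact abs_of_pos (by linarith)
  have hsub : Metric.ball y₀ 1 ⊆ Ωᶜ := by
    intro y hy hyΩ
    have h1 := hR y hyΩ
    rw [mem_ball_iff_norm, ← norm_neg, neg_sub] at hy
    have := norm_sub_norm_le y₀ y
    linarith
  refine ⟨∫⁻ y in Metric.ball y₀ 1, ENNReal.ofReal (1 / (2 * R + 3) ^ ((d : ℝ) + α)), ?_,
    fun x hx => ?_⟩
  · rw [setLIntegral_const]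
    refine mul_ne_zero ?_ (Metric.measure_ball_pos _ _ one_pos).ne'
    simp only [ne_eq, ENNReal.ofReal_eq_zero, not_le]
    positivity
  · refine (setLIntegral_mono' measurableSet_ball fun y hy => ?_).trans (lintegral_mono_set hsub)
    refine ENNReal.ofReal_le_ofReal ?_
    have hxy : x ≠ y := fun h => hsub hy (h ▸ hx)
    have h0 : 0 < ‖x - y‖ := norm_sub_pos_iff.mpr hxy
    refine one_div_le_one_div_of_le (by positivity) ?_
    refine Real.rpow_le_rpow h0.le ?_ (by positivity)
    have h1 := hR x hx
    rw [mem_ball_iff_norm] at hy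
    calc ‖x - y‖ = ‖x - y₀ - (y - y₀)‖ := by congr 1; abel
      _ ≤ ‖x - y₀‖ + ‖y - y₀‖ := norm_sub_le _ _
      _ ≤ (‖x‖ + ‖y₀‖) + 1 := add_le_add (norm_sub_le _ _) hy.le
      _ ≤ _ := by linarith

/-- The fractional Hardy inequality in terms of the exterior potential. -/
theorem BoundaryCharts.exists_lintegral_extPotential_le {d : ℕ} {Ω : Set (Sp d)}
    (K : BoundaryCharts Ω) (hΩ : IsOpen Ω) (huniv : Ω ≠ univ) {α : ℝ} (hα0 : 0 < α) (hα1 : α < 1) :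
    ∃ C : ℝ≥0∞, C ≠ ⊤ ∧ ∀ w, MemLp w 2 (volume.restrict Ω) →
      ∫⁻ x in Ω, ENNReal.ofReal (w x ^ 2) * extPotential Ω α x ≤ C * energySq Ω (α / 2) w := by
  obtain ⟨C, hC, hHardy⟩ := K.exists_hardy hΩ huniv hα0 hα1
  obtain ⟨D, hD0, hD⟩ := exists_extPotential_le hΩ hα0
  have hne : (Ωᶜ).Nonempty := nonempty_compl.mpr huniv
  refine ⟨ENNReal.ofReal D * C, ENNReal.mul_ne_top ENNReal.ofReal_ne_top hC, fun w hw => ?_⟩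
  set w' := hw.1.mk w with hw'
  have hae : w =ᵐ[volume.restrict Ω] w' := hw.1.ae_eq_mk
  have hm : Measurable w' := hw.1.stronglyMeasurable_mk.measurable
  have hlt := lintegral_sq_lt_top ((memLp_congr_ae hae).mp hw)
  have h1 : ∫⁻ x in Ω, ENNReal.ofReal (w x ^ 2) * extPotential Ω α x =
      ∫⁻ x in Ω, ENNReal.ofReal (w' x ^ 2) * extPotential Ω α x := by
    refine lintegral_congr_ae ?_
    filter_upwards [hae] with x hx
    rw [hx]
  rw [h1, energySq_congr hae]
  calc _ ≤ ∫⁻ x in Ω, ENNReal.ofReal D *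
        (ENNReal.ofReal (w' x ^ 2) * ENNReal.ofReal (Metric.infDist x Ωᶜ ^ (-α))) := by
        refine setLIntegral_mono' hΩ.measurableSet fun x hx => ?_
        have hpos : 0 < Metric.infDist x Ωᶜ :=
          (hΩ.isClosed_compl.notMem_iff_infDist_pos hne).mp (by simpa using hx)
        refine (mul_le_mul_right (hD x hpos) _).trans_eq ?_
        rw [ENNReal.ofReal_mul hD0]
        ring
    _ = ENNReal.ofReal D * (∫⁻ x in Ω, ENNReal.ofReal (w' x ^ 2) *
          ENNReal.ofReal (Metric.infDist x Ωᶜ ^ (-α))) := by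
        rw [lintegral_const_mul' _ _ ENNReal.ofReal_ne_top]
    _ ≤ ENNReal.ofReal D * (C * energySq Ω (α / 2) w') :=
        mul_le_mul_right (hHardy w' hm hlt.ne) _
    _ = _ := by ring

/-! ### The energy form and Céa's lemma -/

/-- The function `√ρ_Ω v`, whose `L²(Ω)` norm is the potential part of the energy of `v`. -/
noncomputable def weighted {d : ℕ} (Ω : Set (Sp d)) (α : ℝ) (v : Sp d → ℝ) (x : Sp d) : ℝ :=
  √(rho Ω α x) * v x

theorem weighted_add {d : ℕ} (Ω : Set (Sp d)) (α : ℝ) (u v : Sp d → ℝ) :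
    weighted Ω α (u + v) = weighted Ω α u + weighted Ω α v := by
  ext x
  simp only [weighted, Pi.add_apply, mul_add]

theorem weighted_smul {d : ℕ} (Ω : Set (Sp d)) (α a : ℝ) (v : Sp d → ℝ) :
    weighted Ω α (a • v) = a • weighted Ω α v := by
  ext x
  simp only [weighted, Pi.smul_apply, smul_eq_mul]
  ring

theorem weighted_mul {d : ℕ} {Ω : Set (Sp d)} {α : ℝ} (hα0 : 0 < α) (hα1 : α < 1)
    (u v : Sp d → ℝ) (x : Sp d) :
    weighted Ω α u x * weighted Ω α v x = rho Ω α x * u x * v x := by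
  have := Real.mul_self_sqrt (rho_nonneg (Ω := Ω) hα0 hα1 x)
  rw [weighted, weighted]
  linear_combination (u x * v x) * this

/-- The form `a(u,v)` is a combination of two `L²` inner products. -/
theorem bilin_eq {d : ℕ} {Ω : Set (Sp d)} {α : ℝ} (hα0 : 0 < α) (hα1 : α < 1) (u v : Sp d → ℝ) :
    bilin Ω α u v = fracConst d α / 2 *
      (∫ p, diffQuot (α / 2) u p * diffQuot (α / 2) v p
        ∂((volume.restrict Ω).prod (volume.restrict Ω))) +
      ∫ x in Ω, weighted Ω α u x * weighted Ω α v x := by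
  simp only [bilin, diffQuot_mul, weighted_mul hα0 hα1, mul_div_cancel₀ α two_ne_zero]

/-- Functions of finite energy whose potential energy is finite too. -/
structure FormDomain {d : ℕ} (Ω : Set (Sp d)) (α : ℝ) (v : Sp d → ℝ) : Prop where
  finiteEnergy : FiniteEnergy Ω (α / 2) v
  memLp_weighted : MemLp (weighted Ω α v) 2 (volume.restrict Ω)

theorem FormDomain.add {d : ℕ} {Ω : Set (Sp d)} {α : ℝ} {u v : Sp d → ℝ}
    (hu : FormDomain Ω α u) (hv : FormDomain Ω α v) : FormDomain Ω α (u + v) :=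
  ⟨hu.1.add hv.1, weighted_add Ω α u v ▸ hu.2.add hv.2⟩

theorem FormDomain.smul {d : ℕ} {Ω : Set (Sp d)} {α : ℝ} {v : Sp d → ℝ}
    (hv : FormDomain Ω α v) (a : ℝ) : FormDomain Ω α (a • v) :=
  ⟨hv.1.smul a, weighted_smul Ω α a v ▸ hv.2.const_smul a⟩

theorem FormDomain.bilin_add_right {d : ℕ} {Ω : Set (Sp d)} {α : ℝ} (hα0 : 0 < α) (hα1 : α < 1)
    {u v w : Sp d → ℝ} (hu : FormDomain Ω α u) (hv : FormDomain Ω α v) (hw : FormDomain Ω α w) :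
    bilin Ω α u (v + w) = bilin Ω α u v + bilin Ω α u w := by
  simp only [bilin_eq hα0 hα1, diffQuot_add, weighted_add, Pi.add_apply, mul_add]
  have h1 := integral_add (hu.1.memLp_diffQuot.integrable_mul hv.1.memLp_diffQuot)
    (hu.1.memLp_diffQuot.integrable_mul hw.1.memLp_diffQuot)
  have h2 := integral_add (hu.2.integrable_mul hv.2) (hu.2.integrable_mul hw.2)
  simp only [Pi.mul_apply] at h1 h2
  rw [h1, h2]
  ring

theorem bilin_smul_right {d : ℕ} {Ω : Set (Sp d)} {α : ℝ} (hα0 : 0 < α) (hα1 : α < 1)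
    (a : ℝ) (u v : Sp d → ℝ) : bilin Ω α u (a • v) = a * bilin Ω α u v := by
  simp only [bilin_eq hα0 hα1, diffQuot_smul, weighted_smul, Pi.smul_apply, smul_eq_mul,
    mul_left_comm _ a, integral_const_mul]
  ring

theorem bilin_comm {d : ℕ} {Ω : Set (Sp d)} {α : ℝ} (hα0 : 0 < α) (hα1 : α < 1)
    (u v : Sp d → ℝ) : bilin Ω α u v = bilin Ω α v u := by
  rw [bilin_eq hα0 hα1, bilin_eq hα0 hα1]
  simp only [mul_comm]

theorem bilin_self_nonneg {d : ℕ} {Ω : Set (Sp d)} {α : ℝ} (hα0 : 0 < α) (hα1 : α < 1)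
    (v : Sp d → ℝ) : 0 ≤ bilin Ω α v v := by
  rw [bilin_eq hα0 hα1]
  have := fracConst_pos (d := d) hα0 hα1
  exact add_nonneg (mul_nonneg (by positivity) (integral_nonneg fun _ => mul_self_nonneg _))
    (integral_nonneg fun _ => mul_self_nonneg _)

theorem FormDomain.sub {d : ℕ} {Ω : Set (Sp d)} {α : ℝ} {u v : Sp d → ℝ}
    (hu : FormDomain Ω α u) (hv : FormDomain Ω α v) : FormDomain Ω α (u - v) := by
  have := hu.add (hv.smul (-1))
  rwa [neg_one_smul, ← sub_eq_add_neg] at this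

theorem FormDomain.bilin_sub_left {d : ℕ} {Ω : Set (Sp d)} {α : ℝ} (hα0 : 0 < α) (hα1 : α < 1)
    {u v w : Sp d → ℝ} (hu : FormDomain Ω α u) (hv : FormDomain Ω α v) (hw : FormDomain Ω α w) :
    bilin Ω α (u - v) w = bilin Ω α u w - bilin Ω α v w := by
  have h : u - v = u + (-1 : ℝ) • v := by rw [neg_one_smul, sub_eq_add_neg]
  rw [h, bilin_comm hα0 hα1, hw.bilin_add_right hα0 hα1 hu (hv.smul (-1)),
    bilin_smul_right hα0 hα1, bilin_comm hα0 hα1 w u, bilin_comm hα0 hα1 w v]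
  ring

/-- The Pythagorean estimate behind quasi-optimality. -/
theorem FormDomain.bilin_self_le {d : ℕ} {Ω : Set (Sp d)} {α : ℝ} (hα0 : 0 < α) (hα1 : α < 1)
    {e z : Sp d → ℝ} (he : FormDomain Ω α e) (hz : FormDomain Ω α z) (h : bilin Ω α e z = 0) :
    bilin Ω α e e ≤ bilin Ω α (e + z) (e + z) := by
  rw [(he.add hz).bilin_add_right hα0 hα1 he hz, bilin_comm hα0 hα1 (e + z) e,
    bilin_comm hα0 hα1 (e + z) z, he.bilin_add_right hα0 hα1 he hz,
    hz.bilin_add_right hα0 hα1 he hz, bilin_comm hα0 hα1 z e, h]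
  linarith [bilin_self_nonneg (Ω := Ω) hα0 hα1 z]

theorem ofReal_integral_mul_self {X : Type*} [MeasurableSpace X] {μ : Measure X} {v : X → ℝ}
    (hv : MemLp v 2 μ) : ENNReal.ofReal (∫ x, v x * v x ∂μ) = eLpNorm v 2 μ ^ 2 := by
  have hi : Integrable (fun x => v x * v x) μ := hv.integrable_mul hv
  rw [eLpNorm_two_sq, ofReal_integral_eq_lintegral_ofReal hi
    (ae_of_all _ fun x => mul_self_nonneg _)]
  simp only [sq]

theorem FormDomain.ofReal_bilin_self {d : ℕ} {Ω : Set (Sp d)} {α : ℝ} (hα0 : 0 < α) (hα1 : α < 1)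
    {v : Sp d → ℝ} (hv : FormDomain Ω α v) :
    ENNReal.ofReal (bilin Ω α v v) = ENNReal.ofReal (fracConst d α / 2) * gagliardoSq Ω (α / 2) v +
      eLpNorm (weighted Ω α v) 2 (volume.restrict Ω) ^ 2 := by
  have := fracConst_pos (d := d) hα0 hα1
  rw [bilin_eq hα0 hα1, ENNReal.ofReal_add (mul_nonneg (by positivity)
      (integral_nonneg fun _ => mul_self_nonneg _)) (integral_nonneg fun _ => mul_self_nonneg _),
    ENNReal.ofReal_mul (by positivity), ofReal_integral_mul_self hv.1.memLp_diffQuot,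
    ofReal_integral_mul_self hv.2, eLpNorm_diffQuot_sq _ hv.1.memLp.1]

theorem eLpNorm_weighted_sq_le {d : ℕ} {Ω : Set (Sp d)} {α : ℝ} (hα0 : 0 < α) (hα1 : α < 1)
    (v : Sp d → ℝ) : eLpNorm (weighted Ω α v) 2 (volume.restrict Ω) ^ 2 ≤
      ENNReal.ofReal (fracConst d α) *
        (∫⁻ x in Ω, ENNReal.ofReal (v x ^ 2) * extPotential Ω α x) := by
  rw [eLpNorm_two_sq, ← lintegral_const_mul' _ _ ENNReal.ofReal_ne_top]
  refine lintegral_mono fun x => ?_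
  rw [sq, weighted_mul hα0 hα1, rho_eq, mul_assoc, ← sq, mul_assoc,
    ENNReal.ofReal_mul (fracConst_pos hα0 hα1).le, ENNReal.ofReal_mul ENNReal.toReal_nonneg,
    mul_comm (ENNReal.ofReal (v x ^ 2))]
  gcongr
  exact ENNReal.ofReal_toReal_le

theorem le_eLpNorm_weighted_sq {d : ℕ} {Ω : Set (Sp d)} (hΩ : IsOpen Ω) {α : ℝ} (hα0 : 0 < α)
    (hα1 : α < 1) {c : ℝ≥0∞} (hc : ∀ x ∈ Ω, c ≤ extPotential Ω α x)
    (hfin : ∀ x ∈ Ω, extPotential Ω α x ≠ ⊤) {v : Sp d → ℝ}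
    (hv : MemLp v 2 (volume.restrict Ω)) :
    ENNReal.ofReal (fracConst d α) * c * (∫⁻ x in Ω, ENNReal.ofReal (v x ^ 2)) ≤
      eLpNorm (weighted Ω α v) 2 (volume.restrict Ω) ^ 2 := by
  rw [eLpNorm_two_sq, ← lintegral_const_mul'' _ (hv.1.aemeasurable.pow_const 2).ennreal_ofReal]
  refine setLIntegral_mono' hΩ.measurableSet fun x hx => ?_
  rw [sq (weighted Ω α v x), weighted_mul hα0 hα1, rho_eq,
    mul_assoc (fracConst d α * (extPotential Ω α x).toReal), ← sq, mul_assoc, mul_assoc,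
    ENNReal.ofReal_mul (fracConst_pos hα0 hα1).le, ENNReal.ofReal_mul ENNReal.toReal_nonneg,
    ENNReal.ofReal_toReal (hfin x hx)]
  gcongr
  exact hc x hx

theorem extPotential_ne_top {d : ℕ} {Ω : Set (Sp d)} (hΩ : IsOpen Ω) (huniv : Ω ≠ univ) {α : ℝ}
    (hα0 : 0 < α) : ∀ x ∈ Ω, extPotential Ω α x ≠ ⊤ := by
  intro x hx
  obtain ⟨D, -, hD⟩ := exists_extPotential_le hΩ hα0
  have hpos : 0 < Metric.infDist x Ωᶜ :=
    (hΩ.isClosed_compl.notMem_iff_infDist_pos (nonempty_compl.mpr huniv)).mp (by simpa using hx)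
  exact ((hD x hpos).trans_lt ENNReal.ofReal_lt_top).ne

/-- By the fractional Hardy inequality the potential energy is controlled by the energy. -/
theorem BoundaryCharts.formDomain {d : ℕ} {Ω : Set (Sp d)} (K : BoundaryCharts Ω) (hΩ : IsOpen Ω)
    (huniv : Ω ≠ univ) {α : ℝ} (hα0 : 0 < α) (hα1 : α < 1) {v : Sp d → ℝ}
    (hv : FiniteEnergy Ω (α / 2) v) : FormDomain Ω α v := by
  obtain ⟨C, hC, hle⟩ := K.exists_lintegral_extPotential_le hΩ huniv hα0 hα1
  refine ⟨hv, ?_, ?_⟩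
  · exact ((measurable_rho Ω α).sqrt.aestronglyMeasurable).mul hv.memLp.1
  · have h1 := (eLpNorm_weighted_sq_le hα0 hα1 v).trans (mul_le_mul_right (hle v hv.memLp) _)
    have h2 := h1.trans_lt (ENNReal.mul_lt_top ENNReal.ofReal_lt_top
      (ENNReal.mul_lt_top hC.lt_top hv.energySq_lt_top))
    by_contra hc
    rw [not_lt, top_le_iff] at hc
    rw [hc, ENNReal.top_pow two_ne_zero] at h2
    exact lt_irrefl _ h2

/-- Céa's lemma for the form `a`, which is bounded by the fractional Hardy inequality and coercive
because `ρ_Ω` is bounded below. -/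
theorem BoundaryCharts.exists_sobolevNorm_le_of_bilin_eq_zero {d : ℕ} (hd : 0 < d) {Ω : Set (Sp d)}
    (K : BoundaryCharts Ω) (hΩ : IsOpen Ω) (hb : Bornology.IsBounded Ω) (huniv : Ω ≠ univ) {α : ℝ}
    (hα0 : 0 < α) (hα1 : α < 1) :
    ∃ C : ℝ, 0 < C ∧ ∀ e z, FiniteEnergy Ω (α / 2) e → FiniteEnergy Ω (α / 2) z →
      bilin Ω α e z = 0 →
        sobolevNorm Ω (α / 2) e ≤ ENNReal.ofReal C * sobolevNorm Ω (α / 2) (e + z) := by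
  obtain ⟨C, hC, hle⟩ := K.exists_lintegral_extPotential_le hΩ huniv hα0 hα1
  obtain ⟨c, hc0, hc⟩ := exists_le_extPotential hd hb hα0
  have hF := fracConst_pos (d := d) hα0 hα1
  set F := fracConst d α with hFd
  have hfin := extPotential_ne_top hΩ huniv hα0
  -- the lower and upper constants of the form
  set m : ℝ≥0∞ := min (ENNReal.ofReal (F / 2)) (min (ENNReal.ofReal F * c) 1) with hm
  have hm0 : m ≠ 0 := by
    have h1 : 0 < ENNReal.ofReal (F / 2) := ENNReal.ofReal_pos.mpr (by positivity)
    have h2 : 0 < ENNReal.ofReal F * c :=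
      ENNReal.mul_pos (ENNReal.ofReal_pos.mpr hF).ne' hc0
    exact (lt_min h1 (lt_min h2 one_pos)).ne'
  have hmtop : m ≠ ⊤ :=
    ((min_le_right _ _).trans ((min_le_right _ _).trans le_rfl)).trans_lt ENNReal.one_lt_top |>.ne
  set M : ℝ≥0∞ := ENNReal.ofReal (F / 2) + ENNReal.ofReal F * C with hM
  have hMtop : M ≠ ⊤ := by simp [hM, ENNReal.mul_eq_top, hC]
  have hMm : (m⁻¹ * M) ^ (1 / 2 : ℝ) ≠ ⊤ :=
    (ENNReal.rpow_lt_top_of_nonneg (by norm_num)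
      (ENNReal.mul_ne_top (ENNReal.inv_ne_top.mpr hm0) hMtop)).ne
  refine ⟨((m⁻¹ * M) ^ (1 / 2 : ℝ)).toReal + 1, by positivity, fun e z he hz h => ?_⟩
  have he' := K.formDomain hΩ huniv hα0 hα1 he
  have hz' := K.formDomain hΩ huniv hα0 hα1 hz
  have hlow : m * energySq Ω (α / 2) e ≤ ENNReal.ofReal (bilin Ω α e e) := by
    rw [he'.ofReal_bilin_self hα0 hα1, energySq, mul_add, add_comm]
    refine add_le_add (mul_le_mul_left (min_le_left _ _) _) ?_
    refine le_trans ?_ (le_eLpNorm_weighted_sq hΩ hα0 hα1 hc hfin he.memLp)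
    exact mul_le_mul_left ((min_le_right _ _).trans (min_le_left _ _)) _
  have hup : ENNReal.ofReal (bilin Ω α (e + z) (e + z)) ≤ M * energySq Ω (α / 2) (e + z) := by
    rw [(he'.add hz').ofReal_bilin_self hα0 hα1, hM, add_mul]
    refine add_le_add (mul_le_mul_right le_add_self _) ?_
    refine (eLpNorm_weighted_sq_le hα0 hα1 _).trans ?_
    rw [mul_assoc]
    exact mul_le_mul_right (hle _ (he.add hz).memLp) _
  have hmain : energySq Ω (α / 2) e ≤ m⁻¹ * M * energySq Ω (α / 2) (e + z) := by
    rw [mul_assoc, ← ENNReal.mul_le_iff_le_inv hm0 hmtop]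
    exact hlow.trans ((ENNReal.ofReal_le_ofReal (he'.bilin_self_le hα0 hα1 hz' h)).trans hup)
  rw [sobolevNorm_eq hΩ (by linarith) (by linarith) he.memLp,
    sobolevNorm_eq hΩ (by linarith) (by linarith) (he.add hz).memLp]
  refine (ENNReal.rpow_le_rpow hmain (by norm_num)).trans ?_
  rw [ENNReal.mul_rpow_of_nonneg _ _ (by norm_num)]
  refine mul_le_mul_left ?_ _
  rw [← ENNReal.ofReal_toReal hMm]
  exact ENNReal.ofReal_le_ofReal (by simp)

/-- Extension by zero maps the energy space on `Ω` to the one on `ℝ^d`, by the fractional Hardy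
inequality. -/
theorem BoundaryCharts.memTilde {d : ℕ} {Ω : Set (Sp d)} (K : BoundaryCharts Ω) (hΩ : IsOpen Ω)
    (huniv : Ω ≠ univ) {α : ℝ} (hα0 : 0 < α) (hα1 : α < 1) {v : Sp d → ℝ}
    (hv : FiniteEnergy Ω (α / 2) v) : MemTilde Ω (α / 2) v := by
  refine ⟨(memSobolev_iff hΩ (by linarith) (by linarith)).mpr hv,
    (memSobolev_iff isOpen_univ (by linarith) (by linarith)).mpr ⟨?_, ?_⟩⟩
  · rw [Measure.restrict_univ, memLp_indicator_iff_restrict hΩ.measurableSet]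
    exact hv.memLp
  obtain ⟨C, hC, hle⟩ := K.exists_lintegral_extPotential_le hΩ huniv hα0 hα1
  have hP : ∫⁻ x in Ω, ENNReal.ofReal (v x ^ 2) * extPotential Ω α x < ⊤ :=
    (hle v hv.memLp).trans_lt (ENNReal.mul_lt_top hC.lt_top hv.energySq_lt_top)
  have hα2 : (d : ℝ) + 2 * (α / 2) = d + α := by ring
  have h1 : ∀ x ∈ Ω, ∀ y ∈ Ωᶜ, ENNReal.ofReal ((Ω.indicator v x - Ω.indicator v y) ^ 2 /
      ‖x - y‖ ^ ((d : ℝ) + 2 * (α / 2))) =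
        ENNReal.ofReal (v x ^ 2) * ENNReal.ofReal (1 / ‖x - y‖ ^ ((d : ℝ) + α)) := by
    intro x hx y hy
    rw [indicator_of_mem hx, indicator_of_notMem hy, sub_zero, hα2,
      ← ENNReal.ofReal_mul (sq_nonneg _), mul_one_div]
  have hin : ∀ x ∈ Ω, ∫⁻ y, ENNReal.ofReal ((Ω.indicator v x - Ω.indicator v y) ^ 2 /
      ‖x - y‖ ^ ((d : ℝ) + 2 * (α / 2))) =
      (∫⁻ y in Ω, ENNReal.ofReal ((v x - v y) ^ 2 / ‖x - y‖ ^ ((d : ℝ) + 2 * (α / 2)))) +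
        ENNReal.ofReal (v x ^ 2) * extPotential Ω α x := by
    intro x hx
    rw [← lintegral_add_compl _ hΩ.measurableSet]
    congr 1
    · refine setLIntegral_congr_fun hΩ.measurableSet fun y hy => ?_
      simp only [indicator_of_mem hx, indicator_of_mem hy]
    · rw [setLIntegral_congr_fun hΩ.measurableSet.compl (h1 x hx), extPotential,
        lintegral_const_mul' _ _ ENNReal.ofReal_ne_top]
  have hout : ∀ x ∈ Ωᶜ, ∫⁻ y, ENNReal.ofReal ((Ω.indicator v x - Ω.indicator v y) ^ 2 /
      ‖x - y‖ ^ ((d : ℝ) + 2 * (α / 2))) =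
      ∫⁻ y in Ω, ENNReal.ofReal (v y ^ 2) * ENNReal.ofReal (1 / ‖x - y‖ ^ ((d : ℝ) + α)) := by
    intro x hx
    rw [← lintegral_add_compl _ hΩ.measurableSet]
    have h0 : ∫⁻ y in Ωᶜ, ENNReal.ofReal ((Ω.indicator v x - Ω.indicator v y) ^ 2 /
        ‖x - y‖ ^ ((d : ℝ) + 2 * (α / 2))) = 0 := by
      rw [setLIntegral_congr_fun hΩ.measurableSet.compl (g := fun _ => 0) fun y hy => ?_]
      · exact lintegral_zero
      · simp [indicator_of_notMem hx, indicator_of_notMem hy]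
    rw [h0, add_zero]
    refine setLIntegral_congr_fun hΩ.measurableSet fun y hy => ?_
    rw [norm_sub_rev x y, ← h1 y hy x hx, sub_sq_comm]
  have hswap : ∫⁻ x in Ωᶜ, (∫⁻ y in Ω, ENNReal.ofReal (v y ^ 2) *
      ENNReal.ofReal (1 / ‖x - y‖ ^ ((d : ℝ) + α))) =
      ∫⁻ x in Ω, ENNReal.ofReal (v x ^ 2) * extPotential Ω α x := by
    rw [lintegral_lintegral_swap]
    · refine lintegral_congr fun x => ?_
      rw [lintegral_const_mul' _ _ ENNReal.ofReal_ne_top, extPotential]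
      simp only [norm_sub_rev]
    · have hm : Measurable fun p : Sp d × Sp d =>
        ENNReal.ofReal (1 / ‖p.1 - p.2‖ ^ ((d : ℝ) + α)) := by fun_prop
      exact ((hv.memLp.1.comp_snd (μ := volume.restrict Ωᶜ)).aemeasurable.pow_const
        2).ennreal_ofReal.mul hm.aemeasurable
  rw [gagliardoSq]
  simp only [Measure.restrict_univ]
  rw [← lintegral_add_compl _ hΩ.measurableSet, setLIntegral_congr_fun hΩ.measurableSet hin,
    setLIntegral_congr_fun hΩ.measurableSet.compl hout, hswap]
  have hadd := lintegral_add_right' (μ := volume.restrict Ω)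
    (fun x => ∫⁻ y in Ω, ENNReal.ofReal ((v x - v y) ^ 2 / ‖x - y‖ ^ ((d : ℝ) + 2 * (α / 2))))
    (((hv.memLp.1.aemeasurable.pow_const 2).ennreal_ofReal).mul
      (measurable_extPotential Ω α).aemeasurable)
  simp only [Pi.mul_apply] at hadd
  rw [hadd]
  exact ENNReal.add_lt_top.mpr ⟨ENNReal.add_lt_top.mpr ⟨hv.gagliardoSq_lt_top, hP⟩, hP⟩

/-! ### Approximation from the trial space in the energy norm -/

/-- Interpolation between sup norm and Lipschitz constant: since `α < 1`, the kernel
`|x - y|^{1-d-α}` is integrable near the diagonal. -/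
theorem exists_gagliardoSq_le {d : ℕ} (hd : 0 < d) {Ω : Set (Sp d)} (hΩ : IsOpen Ω)
    (hb : Bornology.IsBounded Ω) {α : ℝ} (hα1 : α < 1) :
    ∃ I : ℝ, 0 ≤ I ∧ ∀ (w : Sp d → ℝ) (τ Λ : ℝ), 0 ≤ τ → 0 ≤ Λ → (∀ x ∈ Ω, |w x| ≤ τ) →
      (∀ x ∈ Ω, ∀ y ∈ Ω, |w x - w y| ≤ Λ * ‖x - y‖) →
        gagliardoSq Ω (α / 2) w ≤ ENNReal.ofReal (τ * Λ * I) := by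
  obtain ⟨R, hR0, hR⟩ := hb.exists_pos_norm_le
  set q : ℝ := d + α - 1 with hq
  have hint : IntegrableOn (fun z : Sp d => ‖z‖ ^ (-q)) (Metric.ball 0 (2 * R + 1)) := by
    refine integrableOn_ball_of_norm_le_rpow (C := 1) (α := q) ?_ ?_ (ae_of_all _ fun z => ?_) ?_
    · rwa [finrank_euclideanSpace_fin]
    · rw [finrank_euclideanSpace_fin]; linarith
    · rw [one_mul, Real.norm_of_nonneg (by positivity)]
    · have : Measurable fun z : Sp d => ‖z‖ ^ (-q) := by fun_prop
      exact this.aestronglyMeasurable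
  set J : ℝ≥0∞ := ∫⁻ z in Metric.ball (0 : Sp d) (2 * R + 1), ENNReal.ofReal (‖z‖ ^ (-q)) with hJ
  have hJtop : J ≠ ⊤ := by
    rw [hJ, ← ofReal_integral_eq_lintegral_ofReal hint (ae_of_all _ fun z => by positivity)]
    exact ENNReal.ofReal_ne_top
  have hV : volume Ω ≠ ⊤ := hb.measure_lt_top.ne
  refine ⟨2 * J.toReal * (volume Ω).toReal, by positivity, fun w τ Λ hτ hΛ hw hL => ?_⟩
  have hpt : ∀ x ∈ Ω, ∀ y ∈ Ω, ENNReal.ofReal ((w x - w y) ^ 2 /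
      ‖x - y‖ ^ ((d : ℝ) + 2 * (α / 2))) ≤ ENNReal.ofReal (2 * τ * Λ) *
        (Metric.ball (0 : Sp d) (2 * R + 1)).indicator
          (fun z => ENNReal.ofReal (‖z‖ ^ (-q))) (x - y) := by
    intro x hx y hy
    rcases eq_or_ne x y with rfl | hne
    · simp
    have hpos : 0 < ‖x - y‖ := norm_sub_pos_iff.mpr hne
    have hmem : x - y ∈ Metric.ball (0 : Sp d) (2 * R + 1) := by
      rw [mem_ball_zero_iff]
      linarith [norm_sub_le x y, hR x hx, hR y hy]
    rw [indicator_of_mem hmem, ← ENNReal.ofReal_mul (by positivity)]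
    refine ENNReal.ofReal_le_ofReal ?_
    rw [div_le_iff₀ (by positivity), mul_assoc, ← Real.rpow_add hpos,
      show -q + ((d : ℝ) + 2 * (α / 2)) = 1 by rw [hq]; ring, Real.rpow_one, ← sq_abs, sq]
    calc |w x - w y| * |w x - w y| ≤ (2 * τ) * (Λ * ‖x - y‖) := by
          refine mul_le_mul ?_ (hL x hx y hy) (abs_nonneg _) (by positivity)
          linarith [abs_sub (w x) (w y), hw x hx, hw y hy]
      _ = _ := by ring
  have hmeas : Measurable ((Metric.ball (0 : Sp d) (2 * R + 1)).indicator
      (fun z => ENNReal.ofReal (‖z‖ ^ (-q)))) :=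
    Measurable.indicator (by fun_prop) measurableSet_ball
  calc gagliardoSq Ω (α / 2) w ≤ ∫⁻ _ in Ω, ENNReal.ofReal (2 * τ * Λ) * J := by
        refine setLIntegral_mono' hΩ.measurableSet fun x hx => ?_
        refine (setLIntegral_mono' hΩ.measurableSet (hpt x hx)).trans ?_
        refine (setLIntegral_le_lintegral _ _).trans_eq ?_
        rw [lintegral_const_mul' _ _ ENNReal.ofReal_ne_top,
          lintegral_sub_left_eq_self ((Metric.ball (0 : Sp d) (2 * R + 1)).indicator
            (fun z => ENNReal.ofReal (‖z‖ ^ (-q)))) x, lintegral_indicator measurableSet_ball]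
    _ = ENNReal.ofReal (τ * Λ * (2 * J.toReal * (volume Ω).toReal)) := by
        rw [setLIntegral_const, ← ENNReal.ofReal_toReal hJtop, ← ENNReal.ofReal_toReal hV,
          ← ENNReal.ofReal_mul (by positivity), ← ENNReal.ofReal_mul (by positivity),
          ENNReal.toReal_ofReal (by positivity), ENNReal.toReal_ofReal (by positivity)]
        congr 1
        ring

theorem lintegral_sq_le_of_abs_le {d : ℕ} {Ω : Set (Sp d)} (hΩ : IsOpen Ω)
    (hb : Bornology.IsBounded Ω) {w : Sp d → ℝ} {τ : ℝ} (hw : ∀ x ∈ Ω, |w x| ≤ τ) :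
    ∫⁻ x in Ω, ENNReal.ofReal (w x ^ 2) ≤ ENNReal.ofReal (τ ^ 2 * (volume Ω).toReal) := by
  rw [ENNReal.ofReal_mul (sq_nonneg τ), ENNReal.ofReal_toReal hb.measure_lt_top.ne,
    ← setLIntegral_const]
  refine setLIntegral_mono' hΩ.measurableSet fun x hx => ENNReal.ofReal_le_ofReal ?_
  exact sq_le_sq.mpr ((hw x hx).trans (le_abs_self τ))

theorem continuous_of_mem_trialSpace {d : ℕ} {ε α : ℝ} (hε : 0 < ε) {X : Finset (Sp d)}
    {v : Sp d → ℝ} (hv : v ∈ trialSpace ε α X) : Continuous v := by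
  induction hv using Submodule.span_induction with
  | mem v hv =>
    obtain ⟨z, -, rfl⟩ := hv
    refine Continuous.rpow_const (by fun_prop) fun x => Or.inl ?_
    positivity
  | zero => exact continuous_const
  | add v w _ _ hv hw => exact hv.add hw
  | smul a v _ hv => exact hv.const_smul a

theorem kernel_nativeSpace {d : ℕ} (Ω : Set (Sp d)) {ε α : ℝ} (hε : 0 < ε) (hα : α < d) :
    RKHS.kernel (NativeSpace Ω hε hα) = gmqKernel Ω ε α := by
  have : Fact (gmqKernel Ω ε α).PosSemidef := ⟨gmqKernel_posSemidef Ω hε hα⟩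
  exact RKHS.OfKernel.kernel_ofKernel

/-- Trial functions have finite energy: on `Ω` they belong to the native space, whose elements are
bounded and Lipschitz. -/
theorem finiteEnergy_of_mem_trialSpace {d : ℕ} (hd : 0 < d) {Ω : Set (Sp d)} (hΩ : IsOpen Ω)
    (hb : Bornology.IsBounded Ω) {ε α : ℝ} (hε : 0 < ε) (hα1 : α < 1) {X : Finset (Sp d)}
    (hX : (X : Set (Sp d)) ⊆ Ω) {v : Sp d → ℝ} (hv : v ∈ trialSpace ε α X) :
    FiniteEnergy Ω (α / 2) v := by
  have hα : α < d := lt_dim hd hα1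
  have hK := kernel_nativeSpace Ω hε hα
  obtain ⟨s, hs⟩ := exists_eq_of_mem_trialSpace hK hX hv
  obtain ⟨I, -, hI⟩ := exists_gagliardoSq_le hd hΩ hb hα1
  have h1 : ∀ x ∈ Ω, |v x| ≤ Real.sqrt ((ε ^ 2) ^ ((α - d) / 2)) * ‖s‖ := fun x hx => by
    have := abs_apply_le_mul_norm hK s ⟨x, hx⟩
    rwa [hs] at this
  have h2 : ∀ x ∈ Ω, ∀ y ∈ Ω, |v x - v y| ≤
      Real.sqrt (2 * ((ε ^ 2) ^ ((α - d) / 2) * ((d - α) / 2 / ε ^ 2))) * ‖s‖ * ‖x - y‖ :=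
    fun x hx y hy => by
      have := abs_apply_sub_apply_le hε hα hK s ⟨x, hx⟩ ⟨y, hy⟩
      rwa [hs, hs] at this
  refine ⟨?_, (hI v _ _ (by positivity) (by positivity) h1 h2).trans_lt ENNReal.ofReal_lt_top⟩
  have : IsFiniteMeasure (volume.restrict Ω) := ⟨by simpa using hb.measure_lt_top⟩
  refine MemLp.of_bound (continuous_of_mem_trialSpace hε hv).aestronglyMeasurable
    (Real.sqrt ((ε ^ 2) ^ ((α - d) / 2)) * ‖s‖) ?_
  filter_upwards [ae_restrict_mem hΩ.measurableSet] with x hx using h1 x hx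

theorem fillDistance_pos_and_exists_norm_sub_le {d : ℕ} (hd : 0 < d) {Ω : Set (Sp d)} (hΩ : IsOpen Ω)
    (hb : Bornology.IsBounded Ω) {X : Finset (Sp d)} (hX0 : X.Nonempty)
    (hX : (X : Set (Sp d)) ⊆ Ω) :
    0 < fillDistance Ω X ∧ ∀ y ∈ Ω, ∃ z ∈ X, ‖y - z‖ ≤ fillDistance Ω X := by
  obtain ⟨z₀, hz₀⟩ := hX0
  obtain ⟨R, hR0, hR⟩ := hb.exists_pos_norm_le
  have hbdd : BddAbove ((fun x => Metric.infDist x (X : Set (Sp d))) '' Ω) := by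
    refine ⟨2 * R, ?_⟩
    rintro _ ⟨x, hx, rfl⟩
    refine (Metric.infDist_le_dist_of_mem (Finset.mem_coe.mpr hz₀)).trans ?_
    rw [dist_eq_norm]
    linarith [norm_sub_le x z₀, hR x hx, hR z₀ (hX hz₀)]
  have hle : ∀ y ∈ Ω, Metric.infDist y (X : Set (Sp d)) ≤ fillDistance Ω X := fun y hy =>
    le_csSup hbdd ⟨y, hy, rfl⟩
  constructor
  · have : Nonempty (Fin d) := ⟨⟨0, hd⟩⟩
    obtain ⟨y, hy, hyX⟩ := ((infinite_of_mem_nhds z₀ (hΩ.mem_nhds (hX hz₀))).sdiff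
      X.finite_toSet).nonempty
    refine lt_of_lt_of_le ?_ (hle y hy)
    exact (X.finite_toSet.isClosed.notMem_iff_infDist_pos ⟨z₀, hz₀⟩).mp hyX
  · intro y hy
    obtain ⟨z, hz, h⟩ := X.finite_toSet.isCompact.exists_infDist_eq_dist ⟨z₀, hz₀⟩ y
    refine ⟨z, hz, ?_⟩
    rw [← dist_eq_norm, ← h]
    exact hle y hy

/-- Spectral convergence: the kernel interpolant of `g` is exponentially close to `g` in the sup
norm and has a bounded Lipschitz constant, hence is exponentially close in the energy norm. -/
theorem BoundaryCharts.exists_bestApprox_le_exp {d : ℕ} (hd : 0 < d) {Ω : Set (Sp d)}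
    (K : BoundaryCharts Ω) (hΩ : IsOpen Ω) (hb : Bornology.IsBounded Ω) {ε α : ℝ} (hε : 0 < ε)
    (hα0 : 0 < α) (hα1 : α < 1) :
    ∃ c h₀ : ℝ, 0 < c ∧ 0 < h₀ ∧ ∀ X : Finset (Sp d), X.Nonempty → (X : Set (Sp d)) ⊆ Ω →
      fillDistance Ω X ≤ h₀ → ∀ (u : Sp d → ℝ) (g : NativeSpace Ω hε (lt_dim hd hα1)),
        FiniteEnergy Ω (α / 2) u →
        (∀ᵐ x ∂(volume : Measure (Sp d)), ∀ hx : x ∈ Ω, u x = g ⟨x, hx⟩) →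
          bestApprox Ω ε α X u ≤
            ENNReal.ofReal (Real.exp (-c / fillDistance Ω X) * ‖g‖) := by
  classical
  have hα : α < d := lt_dim hd hα1
  have hK := kernel_nativeSpace Ω hε hα
  have hM := K.one_le_M
  have hρ := K.ρ_pos
  obtain ⟨C, c, h₀, hC, hc, hh₀, hsamp⟩ := exists_abs_apply_le_exp hd hε hα hK
    (r₀ := K.ρ / (4 * K.M)) (L := 2 * K.M) (by positivity) (by linarith)
    fun x hx r hr hr' => K.exists_closedBall_subset hx hr hr'
  obtain ⟨I, hI0, hI⟩ := exists_gagliardoSq_le hd hΩ hb hα1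
  set B : ℝ := Real.sqrt (2 * ((ε ^ 2) ^ ((α - d) / 2) * ((d - α) / 2 / ε ^ 2))) with hB
  have hB0 : 0 ≤ B := Real.sqrt_nonneg _
  set D : ℝ := C ^ 2 * (volume Ω).toReal + C * B * I with hD
  have hD0 : 0 ≤ D := by positivity
  refine ⟨c / 4, min h₀ (c / (2 * (D + 1))), by positivity, by positivity,
    fun X hX0 hX hh u g hu hug => ?_⟩
  obtain ⟨hpos, hdense⟩ := fillDistance_pos_and_exists_norm_sub_le hd hΩ hb hX0 hX
  set h := fillDistance Ω X with hhd
  obtain ⟨v, hv, w, hwg, hwv, hw0⟩ := exists_trialSpace_interpolant hK hX g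
  have hsup := hsamp X h hX hpos (hh.trans (min_le_left _ _)) hdense w hw0
  set W : Sp d → ℝ := fun x => if hx : x ∈ Ω then w ⟨x, hx⟩ else 0 with hW
  have hWx : ∀ x (hx : x ∈ Ω), W x = w ⟨x, hx⟩ := fun x hx => dif_pos hx
  have hae : u - v =ᵐ[volume.restrict Ω] W := by
    filter_upwards [ae_restrict_mem hΩ.measurableSet, ae_restrict_of_ae hug] with x hx hx'
    rw [hWx x hx, hwv, Pi.sub_apply, hx' hx]
  set E := Real.exp (-c / h) with hE
  have hE0 : 0 < E := Real.exp_pos _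
  have hE1 : E ≤ 1 := by
    rw [hE, Real.exp_le_one_iff, neg_div]
    have : 0 < c / h := by positivity
    linarith
  have h1 : ∀ x ∈ Ω, |W x| ≤ C * E * ‖g‖ := fun x hx => by
    rw [hWx x hx]
    exact (hsup ⟨x, hx⟩).trans (mul_le_mul_of_nonneg_left hwg (by positivity))
  have h2 : ∀ x ∈ Ω, ∀ y ∈ Ω, |W x - W y| ≤ B * ‖g‖ * ‖x - y‖ := fun x hx y hy => by
    rw [hWx x hx, hWx y hy]
    refine (abs_apply_sub_apply_le hε hα hK w ⟨x, hx⟩ ⟨y, hy⟩).trans ?_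
    gcongr
  have henergy : energySq Ω (α / 2) (u - v) ≤ ENNReal.ofReal (D * E * ‖g‖ ^ 2) := by
    rw [energySq_congr hae, energySq]
    refine (add_le_add (lintegral_sq_le_of_abs_le hΩ hb h1)
      (hI W _ _ (by positivity) (by positivity) h1 h2)).trans ?_
    rw [← ENNReal.ofReal_add (by positivity) (by positivity)]
    refine ENNReal.ofReal_le_ofReal ?_
    have hsq : (C * E * ‖g‖) ^ 2 * (volume Ω).toReal ≤
        C ^ 2 * (volume Ω).toReal * E * ‖g‖ ^ 2 := by
      calc (C * E * ‖g‖) ^ 2 * (volume Ω).toReal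
          = C ^ 2 * (volume Ω).toReal * (E * E) * ‖g‖ ^ 2 := by ring
        _ ≤ C ^ 2 * (volume Ω).toReal * (E * 1) * ‖g‖ ^ 2 := by gcongr
        _ = _ := by rw [mul_one]
    calc _ ≤ C ^ 2 * (volume Ω).toReal * E * ‖g‖ ^ 2 + C * E * ‖g‖ * (B * ‖g‖) * I :=
          add_le_add_left hsq _
      _ = _ := by rw [hD]; ring
  -- half of the decay rate absorbs the constant `D`
  have hDE : D * E ≤ Real.exp (-(c / 4) / h) ^ 2 := by
    have hDexp : D ≤ Real.exp (c / (2 * h)) := by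
      have h3 : D + 1 ≤ c / (2 * h) := by
        have h4 := hh.trans (min_le_right _ _)
        rw [le_div_iff₀ (by positivity)] at h4 ⊢
        linarith
      linarith [Real.add_one_le_exp (c / (2 * h))]
    calc D * E ≤ Real.exp (c / (2 * h)) * E := by gcongr
      _ = Real.exp (-(c / 4) / h) ^ 2 := by
        rw [hE, ← Real.exp_add, ← Real.exp_nat_mul]
        congr 1
        push_cast
        field_simp
        ring
  have hv' := finiteEnergy_of_mem_trialSpace hd hΩ hb hε hα1 hX hv
  refine iInf₂_le_of_le v hv ?_
  rw [sobolevNorm_eq hΩ (by linarith) (by linarith) (hu.sub hv').memLp]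
  have hle : D * E * ‖g‖ ^ 2 ≤ (Real.exp (-(c / 4) / h) * ‖g‖) ^ 2 := by
    rw [mul_pow]
    gcongr
  refine (ENNReal.rpow_le_rpow (henergy.trans (ENNReal.ofReal_le_ofReal hle))
    (by norm_num)).trans_eq ?_
  rw [ENNReal.ofReal_rpow_of_nonneg (by positivity) (by norm_num), ← Real.sqrt_eq_rpow,
    Real.sqrt_sq (by positivity)]

/-- Quasi-optimality of the Galerkin solution. -/
theorem BoundaryCharts.exists_galerkin_le {d : ℕ} (hd : 0 < d) {Ω : Set (Sp d)}
    (K : BoundaryCharts Ω) (hΩ : IsOpen Ω) (hb : Bornology.IsBounded Ω) (huniv : Ω ≠ univ) {α : ℝ}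
    (hα0 : 0 < α) (hα1 : α < 1) :
    ∃ C : ℝ, 0 < C ∧ ∀ ε : ℝ, 0 < ε → ∀ X : Finset (Sp d), (X : Set (Sp d)) ⊆ Ω →
      ∀ (f : (Sp d → ℝ) → ℝ) (u uN : Sp d → ℝ), IsWeakSolution Ω α f u →
        IsGalerkinSolution Ω ε α X f uN →
          sobolevNorm Ω (α / 2) (u - uN) ≤ ENNReal.ofReal C * bestApprox Ω ε α X u := by
  obtain ⟨C, hC, hcea⟩ := K.exists_sobolevNorm_le_of_bilin_eq_zero hd hΩ hb huniv hα0 hα1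
  refine ⟨C, hC, fun ε hε X hX f u uN hu huN => ?_⟩
  have hE : ∀ v ∈ trialSpace ε α X, FiniteEnergy Ω (α / 2) v := fun v hv =>
    finiteEnergy_of_mem_trialSpace hd hΩ hb hε hα1 hX hv
  have huE : FiniteEnergy Ω (α / 2) u :=
    (memSobolev_iff hΩ (by linarith) (by linarith)).mp hu.mem.1
  have hform : ∀ v, FiniteEnergy Ω (α / 2) v → FormDomain Ω α v := fun v hv =>
    K.formDomain hΩ huniv hα0 hα1 hv
  rw [bestApprox]
  simp only [ENNReal.mul_iInf_of_ne (ENNReal.ofReal_pos.mpr hC).ne' ENNReal.ofReal_ne_top]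
  refine le_iInf₂ fun v hv => ?_
  have hz : uN - v ∈ trialSpace ε α X := Submodule.sub_mem _ huN.mem hv
  have horth : bilin Ω α (u - uN) (uN - v) = 0 := by
    rw [(hform u huE).bilin_sub_left hα0 hα1 (hform _ (hE _ huN.mem)) (hform _ (hE _ hz)),
      hu.eq _ (K.memTilde hΩ huniv hα0 hα1 (hE _ hz)), huN.eq _ hz, sub_self]
  have := hcea _ _ (huE.sub (hE _ huN.mem)) (hE _ hz) horth
  rwa [sub_add_sub_cancel] at this

end FracRBF

theorem mainTheorem2 {d : ℕ} (hd : 0 < d) {α : ℝ} (hα0 : 0 < α) (hα1 : α < 1)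
    {Ω : Set (Sp d)} (hΩ : IsLipschitzDomain Ω) :
    (∃ K : ℝ, 0 < K ∧ ∀ ε : ℝ, 0 < ε → ∀ X : Finset (Sp d), X.Nonempty → (X : Set (Sp d)) ⊆ Ω →
      ∀ (f : (Sp d → ℝ) → ℝ) (u uN : Sp d → ℝ), IsDualElement Ω (α / 2) f →
        IsWeakSolution Ω α f u → IsGalerkinSolution Ω ε α X f uN →
        ∀ s C : ℝ, 0 ≤ s → 0 ≤ C → MemSobolev Ω s u →
          bestApprox Ω ε α X u ≤
            ENNReal.ofReal (C * fillDistance Ω X ^ (s - α / 2)) * sobolevNorm Ω s u →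
          sobolevNorm Ω (α / 2) (u - uN) ≤
            ENNReal.ofReal (K * C * fillDistance Ω X ^ (s - α / 2)) * sobolevNorm Ω s u) ∧
    (∀ (ε : ℝ) (hε : 0 < ε), ∃ c h₀ : ℝ, 0 < c ∧ 0 < h₀ ∧
      ∀ X : Finset (Sp d), X.Nonempty → (X : Set (Sp d)) ⊆ Ω → fillDistance Ω X ≤ h₀ →
        ∀ (f : (Sp d → ℝ) → ℝ) (u : Sp d → ℝ), IsDualElement Ω (α / 2) f →
          IsWeakSolution Ω α f u →
          ∀ g : NativeSpace Ω hε (lt_dim hd hα1),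
            (∀ᵐ x ∂(volume : Measure (Sp d)), ∀ hx : x ∈ Ω, u x = g ⟨x, hx⟩) →
            bestApprox Ω ε α X u ≤
              ENNReal.ofReal (Real.exp (-c / fillDistance Ω X) * ‖g‖)) := by
  have hΩo := hΩ.isOpen
  have hb := hΩ.isBounded
  have huniv : Ω ≠ univ := by
    rintro rfl
    have : Nonempty (Fin d) := ⟨⟨0, hd⟩⟩
    exact NormedSpace.unbounded_univ ℝ (Sp d) hb
  obtain ⟨K⟩ := hΩ.nonempty_boundaryCharts huniv
  refine ⟨?_, fun ε hε => ?_⟩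
  · obtain ⟨C₀, hC₀, hcea⟩ := K.exists_galerkin_le hd hΩo hb huniv hα0 hα1
    refine ⟨C₀, hC₀, fun ε hε X _ hX f u uN _ hu huN s C _ _ _ happ => ?_⟩
    refine (hcea ε hε X hX f u uN hu huN).trans ((mul_le_mul_right happ _).trans_eq ?_)
    rw [← mul_assoc, ← ENNReal.ofReal_mul hC₀.le, mul_assoc C₀]
  · obtain ⟨c, h₀, hc, hh₀, h⟩ := K.exists_bestApprox_le_exp hd hΩo hb hε hα0 hα1
    exact ⟨c, h₀, hc, hh₀, fun X hX0 hX hh f u _ hu g hug => h X hX0 hX hh u g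
      ((memSobolev_iff hΩo (by linarith) (by linarith)).mp hu.mem.1) hug⟩
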